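/- **Theorem (efficiency of the residual estimator).** *Setting.* Let $\Omega\subset\mathbb R^2$ be a bounded open polygonal region crossed by one fracture $\Gamma$, a simple polygonal arc whose interior lies in $\Omega$ and whose ends lie on $\partial\Omega$, such that $\Omega_B=\Omega\setminus\Gamma=\Omega_{B,1}\cup\Omega_{B,2}$ with disjoint open $\Omega_{B,i}$, and let $n_\Gamma$ be the unit normal of $\Gamma$ pointing from $\Omega_{B,1}$ to $\Omega_{B,2}$. On $\Gamma$ put $[q]=q_1-q_2$ and $\{q\}=\frac12(q_1+q_2)$ for the traces $q_i$ from $\Omega_{B,i}$. Let the isotropic permeability $K$, and $\kappa_\Gamma^*,\kappa_\Gamma^n,\ell_\Gamma$ on $\Gamma$, be piecewise constant and bounded above and below by positive constants, let $\xi\in(\frac12,1]$, and put $K_\Gamma=\kappa_\Gamma^*\ell_\Gamma$, $\eta_\Gamma=\ell_\Gamma/\kappa_\Gamma^n$, $\alpha_\Gamma=\eta_\Gamma(\frac\xi2-\frac14)$. Let $f\in L^2(\Omega_B)$ and $f_\Gamma\in L^2(\Gamma)$. *Continuous problem.* Let $Q=L^2(\Omega_B)^2$, let $U$ be the space of functions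 that are $H^1$ on $\Omega_{B,1}$ and on $\Omega_{B,2}$ and vanish on $\partial\Omega$, and let $V_\Gamma=H^1_0(\Gamma)$. Let $(u,p,p_\Gamma)\in Q\times U\times V_\Gamma$ satisfy, for all $(v,q,q_\Gamma)\in Q\times U\times V_\Gamma$, $$(K^{-1}u,v)_{\Omega_B}+(v,\nabla p)_{\Omega_B}=0,$$ $$\langle\alpha_\Gamma^{-1}(\{p\}-p_\Gamma),\{q\}\rangle_\Gamma+\langle\eta_\Gamma^{-1}[p],[q]\rangle_\Gamma-(u,\nabla q)_{\Omega_B}=(f,q)_{\Omega_B},$$ $$\langle K_\Gamma\nabla_tp_\Gamma,\nabla_tq_\Gamma\rangle_\Gamma-\langle\alpha_\Gamma^{-1}(\{p\}-p_\Gamma),q_\Gamma\rangle_\Gamma=\langle\ell_\Gamma f_\Gamma,q_\Gamma\rangle_\Gamma .$$ *Mesh.* Let $\mathcal T_u$ be a polygonal mesh of $\Omega$ fitted to $\Gamma$ (hanging nodes count as vertices). Let $\mathcal T_h$ be the triangulation obtained by joining a point $\nu$ of each polygon to its vertices, and let the coefficients be constant on each triangle and on each fracture edge. Let $\mathcal F_p$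 be the set of new edges, $\mathcal F_h^\Gamma$ the set of edges on $\Gamma$, $\mathcal F_u^0$ the set of polygon edges that lie neither on $\Gamma$ nor on $\partial\Omega$, and $\mathcal N_h^0(\Gamma)$ the set of interior nodes of $\mathcal F_h^\Gamma$. Assume that every polygon $S$ with point $\nu$ and diameter $h_S$ is star-shaped with respect to a ball centred at $\nu$ of radius at least $\rho_Sh_S$, and that each of its edges has length at least $\rho_Eh_S$. Let $h_\tau$ be the diameter of $\tau\in\mathcal T_h$, $h_e$ the length of $e$, and $h_z$ the larger length of the two fracture edges at $z$. On edges $e\in\mathcal F_p\cup\mathcal F_u^0$, shared by $\tau_1,\tau_2\in\mathcal T_h$ and with unit normal $n$ pointing from $\tau_1$ to $\tau_2$, put $[q]=q|_{\tau_1}-q|_{\tau_2}$ and $[v\cdot n]=v|_{\tau_1}\cdot n-v|_{\tau_2}\cdot n$. *Discrete problem.* For $k\ge0$ let $S_h$ be the space of piecewise $P^k$ functions $q$ on $\mathcal T_h$ with $[q]=0$ on $\mathcal F_u^0$ and $q=0$ on $\partial\Omega$; $V_h$ the space of piecewise $(P^k)^2$ fields $v$ on $\mathcal T_h$ with $[v\cdot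 n]=0$ on $\mathcal F_p$; and $W_h$ the space of functions in $H^1_0(\Gamma)$ that are $P^k$ on each $e\in\mathcal F_h^\Gamma$. Let $(u_h,p_h,p_{\Gamma,h})\in V_h\times S_h\times W_h$ satisfy, for all $(v,q,q_\Gamma)\in V_h\times S_h\times W_h$, $$(K^{-1}u_h,v)_{\Omega_B}+b_h^*(p_h,v)=0,$$ $$-b_h(u_h,q)+\langle\alpha_\Gamma^{-1}(\{p_h\}-p_{\Gamma,h}),\{q\}\rangle_\Gamma+\langle\eta_\Gamma^{-1}[p_h],[q]\rangle_\Gamma=(f,q)_{\Omega_B},$$ $$\langle K_\Gamma\nabla_tp_{\Gamma,h},\nabla_tq_\Gamma\rangle_\Gamma-\langle\alpha_\Gamma^{-1}(\{p_h\}-p_{\Gamma,h}),q_\Gamma\rangle_\Gamma=\langle\ell_\Gamma f_\Gamma,q_\Gamma\rangle_\Gamma,$$ where $$b_h(v,q)=-\sum_{e\in\mathcal F_p}\langle v\cdot n,[q]\rangle_e+\sum_{\tau\in\mathcal T_h}(v,\nabla q)_\tau,$$ $$b_h^*(q,v)=\sum_{e\in\mathcal F_u^0}\langle q,[v\cdot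 n]\rangle_e-\sum_{\tau\in\mathcal T_h}(q,\nabla\cdot v)_\tau+\sum_{e\in\mathcal F_h^\Gamma}\big(\langle[q],\{v\cdot n_\Gamma\}\rangle_e+\langle\{q\},[v\cdot n_\Gamma]\rangle_e\big).$$ *Estimator, error and oscillation.* Let $$\begin{aligned}\eta={}&\Big(\sum_{\tau\in\mathcal T_h}\|K^{-1/2}u_h+K^{1/2}\nabla p_h\|_{0,\tau}^2\Big)^{1/2}+\Big(\sum_{\tau\in\mathcal T_h}h_\tau^2\|f-\nabla\cdot u_h\|_{0,\tau}^2\Big)^{1/2}+\Big(\sum_{e\in\mathcal F_p}h_e^{-1}\|[p_h]\|_{0,e}^2\Big)^{1/2}\\ &+\Big(\sum_{e\in\mathcal F_u^0}h_e\|[u_h\cdot n]\|_{0,e}^2\Big)^{1/2}+\Big(\sum_{e\in\mathcal F_h^\Gamma}h_e^2\|\ell_\Gamma f_\Gamma+\nabla_t\cdot(K_\Gamma\nabla_tp_{\Gamma,h})+[u_h\cdot n_\Gamma]\|_{0,e}^2\Big)^{1/2}+\Big(\sum_{z\in\mathcal N_h^0(\Gamma)}h_zJ_z^2\Big)^{1/2}\\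 &+\Big(\sum_{e\in\mathcal F_h^\Gamma}h_e\|\alpha_\Gamma^{-1}(\{p_h\}-p_{\Gamma,h})-[u_h\cdot n_\Gamma]\|_{0,e}^2\Big)^{1/2}+\Big(\sum_{e\in\mathcal F_h^\Gamma}h_e\|\{u_h\cdot n_\Gamma\}-\eta_\Gamma^{-1}[p_h]\|_{0,e}^2\Big)^{1/2},\end{aligned}$$ where $J_z^2=[K_\Gamma\nabla_tp_{\Gamma,h}]_z^2/\{K_\Gamma\}_z$ with the jump at $z$ and the mean $\{K_\Gamma\}_z$ of the two values of $K_\Gamma$ at $z$; so $J_z^2=[K_\Gamma^{1/2}\nabla_tp_{\Gamma,h}]_z^2$ where $K_\Gamma$ does not jump at $z$. With $v=u-u_h$, $q=p-p_h$, $q_\Gamma=p_\Gamma-p_{\Gamma,h}$ and the piecewise gradient, let $$\begin{aligned}\|(v,q,q_\Gamma)\|_{sdg}^2={}&\|K^{-1/2}v\|_{0,\Omega_B}^2+\|\alpha_\Gamma^{-1/2}(\{q\}-q_\Gamma)\|_{0,\Gamma}^2+\|\eta_\Gamma^{-1/2}[q]\|_{0,\Gamma}^2+\|K^{1/2}\nabla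 q\|_{0,\Omega_B}^2\\&+\|K_\Gamma^{1/2}\nabla_tq_\Gamma\|_{0,\Gamma}^2+\|[v\cdot n_\Gamma]\|_{0,\Gamma}^2+\|\{v\cdot n_\Gamma\}\|_{0,\Gamma}^2.\end{aligned}$$ For piecewise polynomial approximations $f_h$ of $f$ (on $\mathcal T_h$) and $f_{\Gamma,h}$ of $f_\Gamma$ (on $\mathcal F_h^\Gamma$), of degree at most $m$, let $$\mathrm{osc}(f,f_\Gamma)^2=\sum_{e\in\mathcal F_h^\Gamma}h_e^2\|\ell_\Gamma(f_{\Gamma,h}-f_\Gamma)\|_{0,e}^2+\sum_{\tau\in\mathcal T_h}h_\tau^2\|f-f_h\|_{0,\tau}^2.$$ *Claim.* The field $u$ has normal traces in $L^2(\Gamma)$ from both sides, and there is a constant $C>0$, which depends only on $\Omega$, $\Gamma$, the coefficients, $k$, $m$, $\rho_S$, $\rho_E$ (not on the mesh size, the mesh, the data, the solutions or the choice of $f_h,f_{\Gamma,h}$), such that $$\eta\le C\big(\|(u-u_h,\,p-p_h,\,p_\Gamma-p_{\Gamma,h})\|_{sdg}+\mathrm{osc}(f,f_\Gamma)\big).$$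 -/

import Mathlib

open MeasureTheory Set
open scoped ContDiff

noncomputable section

namespace FractureSDG

abbrev Plane := EuclideanSpace ℝ (Fin 2)

/-- Clockwise rotation by a right angle. -/
def rotcw (v : Plane) : Plane := !₂[v 1, -v 0]

def cross (v w : Plane) : ℝ := v 0 * w 1 - v 1 * w 0

/-- Divergence of a (smooth) vector field. -/
def divergence (φ : Plane → Plane) (x : Plane) : ℝ :=
  ∑ i : Fin 2, (fderiv ℝ φ x (EuclideanSpace.single i 1)) i

/-! ### The fractured domain and the coefficients -/

/-- `0 = t 0 < ... < t (n+1) = L` is a partition such that `γ` is affine with unit speed on each of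
the `n + 1` intervals. -/
def IsPolygonalPartition (γ : ℝ → Plane) (L : ℝ) (n : ℕ) (t : Fin (n + 2) → ℝ) : Prop :=
  StrictMono t ∧ t 0 = 0 ∧ t (Fin.last (n + 1)) = L ∧
    ∀ j : Fin (n + 1), ∃ d : Plane, ‖d‖ = 1 ∧
      ∀ s ∈ Icc (t j.castSucc) (t j.succ), γ s = γ (t j.castSucc) + (s - t j.castSucc) • d

/-- A bounded planar region `Ω` crossed by one fracture, a simple polygonal arc
`Γ = γ([0, L])` parametrised by arc length, which splits it into the two bulk subdomains
`Ωb 0` and `Ωb 1`.  The unit normal of `Γ`, the clockwise rotation of the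
unit tangent `γ'`, points out of `Ωb 0` (and into `Ωb 1`). Functions on `Γ` are written as functions
of the arc length `s ∈ [0, L]`. -/
structure FracturedDomain where
  Ω : Set Plane
  Ωb : Fin 2 → Set Plane
  L : ℝ
  γ : ℝ → Plane
  isOpen : IsOpen Ω
  bounded : Bornology.IsBounded Ω
  regular : interior (closure Ω) = Ω
  L_pos : 0 < L
  injOn : InjOn γ (Icc 0 L)
  polygonal : ∃ (n : ℕ) (t : Fin (n + 2) → ℝ), IsPolygonalPartition γ L n t
  inside : ∀ s ∈ Ioo 0 L, γ s ∈ Ω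
  ends : γ 0 ∈ frontier Ω ∧ γ L ∈ frontier Ω
  sub_open : ∀ i, IsOpen (Ωb i)
  sub_disjoint : Disjoint (Ωb 0) (Ωb 1)
  sub_union : Ωb 0 ∪ Ωb 1 = Ω \ γ '' Icc 0 L
  sides : ∀ s ∈ Ioo 0 L, DifferentiableAt ℝ γ s →
    ∀ᶠ t in nhdsWithin (0 : ℝ) (Ioi 0),
      γ s - t • rotcw (deriv γ s) ∈ Ωb 0 ∧ γ s + t • rotcw (deriv γ s) ∈ Ωb 1

namespace FracturedDomain

variable (D : FracturedDomain)

/-- The unit normal `n_Γ` at arc length `s`. -/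
def normal (s : ℝ) : Plane := rotcw (deriv D.γ s)

def ΩB : Set Plane := D.Ωb 0 ∪ D.Ωb 1

/-- Lebesgue measure on the bulk region. -/
def bulk : Measure Plane := volume.restrict D.ΩB

/-- Arc length measure on the fracture. -/
def frac : Measure ℝ := volume.restrict (Icc 0 D.L)

end FracturedDomain

/-- The permeability `K` (isotropic), the tangential and normal permeabilities `κt`, `κn` and the
thickness `ℓ` of the fracture, and the model parameter `ξ`. -/
structure Coefficients (D : FracturedDomain) where
  K : Plane → ℝ
  κt : ℝ → ℝ
  κn : ℝ → ℝ
  ℓ : ℝ → ℝ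
  ξ : ℝ
  K_meas : Measurable K
  κt_meas : Measurable κt
  κn_meas : Measurable κn
  ℓ_meas : Measurable ℓ
  K_bdd : ∃ a b : ℝ, 0 < a ∧ ∀ᵐ x ∂D.bulk, a ≤ K x ∧ K x ≤ b
  κt_bdd : ∃ a b : ℝ, 0 < a ∧ ∀ᵐ s ∂D.frac, a ≤ κt s ∧ κt s ≤ b
  κn_bdd : ∃ a b : ℝ, 0 < a ∧ ∀ᵐ s ∂D.frac, a ≤ κn s ∧ κn s ≤ b
  ℓ_bdd : ∃ a b : ℝ, 0 < a ∧ ∀ᵐ s ∂D.frac, a ≤ ℓ s ∧ ℓ s ≤ b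
  ξ_gt : 1 / 2 < ξ
  ξ_le : ξ ≤ 1

namespace Coefficients

variable {D : FracturedDomain} (c : Coefficients D)

def KΓ (s : ℝ) : ℝ := c.κt s * c.ℓ s
def ηΓ (s : ℝ) : ℝ := c.ℓ s / c.κn s
def αΓ (s : ℝ) : ℝ := c.ηΓ s * (c.ξ / 2 - 1 / 4)

end Coefficients

/-! ### The continuous problem -/

/-- The space `U`: functions that are `H¹` on both subdomains and vanish on `∂Ω`, together with
their weak gradient `grad` and their traces `tr 0`, `tr 1` on `Γ` from the two subdomains.
In Green's formula on `Ωb i` against a smooth field `φ` only the integral over `Γ` appears: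
with `φ` compactly supported in `Ωb i` this says that `grad` is the weak gradient,
and with general `φ` that the boundary trace is `tr i` on `Γ` and `0` elsewhere. -/
structure BulkH1 (D : FracturedDomain) where
  val : Plane → ℝ
  grad : Plane → Plane
  tr : Fin 2 → ℝ → ℝ
  val_mem : MemLp val 2 D.bulk
  grad_mem : MemLp grad 2 D.bulk
  tr_mem : ∀ i, MemLp (tr i) 2 D.frac
  green_zero : ∀ φ : Plane → Plane, ContDiff ℝ ∞ φ →
    ∫ x in D.Ωb 0, (val x * divergence φ x + inner ℝ (grad x) (φ x)) =
      ∫ s in (0 : ℝ)..D.L, tr 0 s * inner ℝ (φ (D.γ s)) (D.normal s)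
  green_one : ∀ φ : Plane → Plane, ContDiff ℝ ∞ φ →
    ∫ x in D.Ωb 1, (val x * divergence φ x + inner ℝ (grad x) (φ x)) =
      -∫ s in (0 : ℝ)..D.L, tr 1 s * inner ℝ (φ (D.γ s)) (D.normal s)

namespace BulkH1

variable {D : FracturedDomain} (q : BulkH1 D)

/-- The jump `[q]` and the average `{q}` on the fracture. -/
def jump (s : ℝ) : ℝ := q.tr 0 s - q.tr 1 s
def avg (s : ℝ) : ℝ := (q.tr 0 s + q.tr 1 s) / 2

end BulkH1

/-- The space `V_Γ = H¹₀(Γ)`: absolutely continuous functions of arc length with square integrable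
derivative `der` that vanish at both ends. -/
structure FracH10 (D : FracturedDomain) where
  val : ℝ → ℝ
  der : ℝ → ℝ
  der_mem : MemLp der 2 D.frac
  val_eq : ∀ s ∈ Icc 0 D.L, val s = ∫ t in (0 : ℝ)..s, der t
  val_end : val D.L = 0

/-- `(u, p, pΓ) ∈ Q × U × V_Γ` is the weak solution for the data `f`, `fΓ`. -/
structure IsWeakSolution {D : FracturedDomain} (c : Coefficients D) (f : Plane → ℝ) (fΓ : ℝ → ℝ)
    (u : Plane → Plane) (p : BulkH1 D) (pΓ : FracH10 D) : Prop where
  u_mem : MemLp u 2 D.bulk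
  darcy : ∀ v : Plane → Plane, MemLp v 2 D.bulk →
    ∫ x, (c.K x)⁻¹ * inner ℝ (u x) (v x) ∂D.bulk + ∫ x, inner ℝ (v x) (p.grad x) ∂D.bulk = 0
  balance : ∀ q : BulkH1 D,
    (∫ s in (0 : ℝ)..D.L, (c.αΓ s)⁻¹ * (p.avg s - pΓ.val s) * q.avg s)
      + (∫ s in (0 : ℝ)..D.L, (c.ηΓ s)⁻¹ * p.jump s * q.jump s)
      - ∫ x, inner ℝ (u x) (q.grad x) ∂D.bulk = ∫ x, f x * q.val x ∂D.bulk
  fracture : ∀ q : FracH10 D,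
    (∫ s in (0 : ℝ)..D.L, c.KΓ s * pΓ.der s * q.der s)
      - (∫ s in (0 : ℝ)..D.L, (c.αΓ s)⁻¹ * (p.avg s - pΓ.val s) * q.val s)
      = ∫ s in (0 : ℝ)..D.L, c.ℓ s * fΓ s * q.val s

/-- The field `u` has a square integrable weak divergence `d` on the two subdomains and
square integrable normal traces `u|_{Ωb i} · n_Γ = g i` on the fracture, in the sense of Green's
formula against all functions of `U` (`n_Γ` is outward for `Ωb 0` and inward for `Ωb 1`). -/
def HasNormalTraces (D : FracturedDomain) (u : Plane → Plane) (g : Fin 2 → ℝ → ℝ) : Prop :=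
  (∀ i, MemLp (g i) 2 D.frac) ∧ ∃ d : Plane → ℝ, MemLp d 2 D.bulk ∧
    ∀ q : BulkH1 D,
      ∫ x, (inner ℝ (u x) (q.grad x) + d x * q.val x) ∂D.bulk =
        ∫ s in (0 : ℝ)..D.L, (g 0 s * q.tr 0 s - g 1 s * q.tr 1 s)

/-! ### Meshes -/

/-- A finite family of polygons, each given by its vertices in cyclic order (hanging nodes count as
vertices) and an interior point. -/
structure Polygons where
  nEl : ℕ
  nVert : Fin nEl → ℕ
  vert : (T : Fin nEl) → Fin (nVert T) → Plane
  center : Fin nEl → Plane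

namespace Polygons

variable (P : Polygons)

/-- Index set of the triangles obtained by joining the interior points to the vertices. -/
abbrev Tri : Type := Σ T : Fin P.nEl, Fin (P.nVert T)

variable {P}

/-- The triangle `τ` has the vertices `ctr τ`, `src τ`, `tgt τ`; its side from `src τ` to `tgt τ` is
an edge of the polygon. -/
def ctr (τ : P.Tri) : Plane := P.center τ.1
def src (τ : P.Tri) : Plane := P.vert τ.1 τ.2
def tgt (τ : P.Tri) : Plane := P.vert τ.1 (finRotate _ τ.2)

/-- The next triangle of the same polygon: it shares with `τ` the edge from `ctr τ` to `tgt τ`. -/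
def next (τ : P.Tri) : P.Tri := ⟨τ.1, finRotate _ τ.2⟩

def tri (τ : P.Tri) : Set Plane := convexHull ℝ {ctr τ, src τ, tgt τ}

/-- The side of `τ` that is an edge of the polygon, with its length and outward unit normal. -/
def outer (τ : P.Tri) : Set Plane := segment ℝ (src τ) (tgt τ)
def outerLen (τ : P.Tri) : ℝ := dist (src τ) (tgt τ)
def outerNormal (τ : P.Tri) : Plane := (outerLen τ)⁻¹ • rotcw (tgt τ - src τ)

/-- The edge shared by `τ` and `next τ`, with its length and the unit normal that points from `τ`
to `next τ`. -/
def inner (τ : P.Tri) : Set Plane := segment ℝ (ctr τ) (tgt τ)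
def innerLen (τ : P.Tri) : ℝ := dist (ctr τ) (tgt τ)
def innerNormal (τ : P.Tri) : Plane := (innerLen τ)⁻¹ • rotcw (ctr τ - tgt τ)

variable (P)

/-- The closed polygon. -/
def elem (T : Fin P.nEl) : Set Plane := ⋃ j : Fin (P.nVert T), tri (P := P) ⟨T, j⟩

end Polygons

open Polygons (ctr src tgt next tri outer outerLen outerNormal innerLen innerNormal)

/-- A polygonal mesh fitted to the fracture, with the triangulation obtained by joining the interior
point of each polygon to its vertices. The edges from `ctr τ` to `tgt τ` (indexed by `τ`)
are the edges `F_p` created by the subdivision. -/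
structure Mesh (D : FracturedDomain) extends Polygons where
  three_le : ∀ T, 3 ≤ nVert T
  /-- the vertices run counterclockwise around the interior point -/
  ccw : ∀ τ : toPolygons.Tri, 0 < cross (src τ - ctr τ) (tgt τ - ctr τ)
  disjoint_tri : Pairwise fun τ τ' : toPolygons.Tri => Disjoint (interior (tri τ)) (interior (tri τ'))
  /-- the subdomain that contains the polygon -/
  sub : Fin nEl → Fin 2
  cover : ∀ i, closure (D.Ωb i) = ⋃ T ∈ {T | sub T = i}, toPolygons.elem T
  fitted : ∀ T, interior (toPolygons.elem T) ⊆ D.Ωb (sub T)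
  /-- the mesh of the fracture: `nΓ + 1` edges, with the `nΓ + 2` endpoints `γ (node j)` -/
  nΓ : ℕ
  node : Fin (nΓ + 2) → ℝ
  partition : IsPolygonalPartition D.γ D.L nΓ node
  /-- the two triangles at a fracture edge, the first in `Ωb 0` and the second in `Ωb 1` -/
  fracTri : Fin 2 → Fin (nΓ + 1) → toPolygons.Tri
  fracTri_sub : ∀ i j, sub (fracTri i j).1 = i
  fracTri_zero : ∀ j, src (fracTri 0 j) = D.γ (node j.castSucc) ∧
    tgt (fracTri 0 j) = D.γ (node j.succ)
  fracTri_one : ∀ j, src (fracTri 1 j) = D.γ (node j.succ) ∧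
    tgt (fracTri 1 j) = D.γ (node j.castSucc)
  /-- the interior primal edges `F_u⁰`, each given once, as the pair of the two triangles that
  share it; the normal of the edge points from the first to the second one -/
  intEdges : Finset (toPolygons.Tri × toPolygons.Tri)
  mem_intEdges : ∀ τ τ' : toPolygons.Tri, ((τ, τ') ∈ intEdges ∨ (τ', τ) ∈ intEdges) ↔
    (sub τ.1 = sub τ'.1 ∧ src τ = tgt τ' ∧ tgt τ = src τ')
  intEdges_once : ∀ τ τ' : toPolygons.Tri, (τ, τ') ∈ intEdges → (τ', τ) ∉ intEdges
  /-- an edge of a polygon lies on the boundary, or on the fracture, or is shared -/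
  edge_cases : ∀ τ : toPolygons.Tri, outer τ ⊆ frontier D.Ω ∨ (∃ i j, τ = fracTri i j) ∨
    ∃ τ', (τ, τ') ∈ intEdges ∨ (τ', τ) ∈ intEdges

namespace Mesh

variable {D : FracturedDomain} (M : Mesh D)

/-- Each polygon is star-shaped with respect to a ball around its interior point, of
radius at least `ρ` times the diameter of the polygon. -/
def StarShaped (ρ : ℝ) : Prop :=
  ∀ T, ∀ y ∈ Metric.ball (M.center T) (ρ * Metric.diam (M.elem T)), StarConvex ℝ y (M.elem T)

/-- The edges of each polygon are not shorter than `ρ` times its diameter. -/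
def EdgesComparable (ρ : ℝ) : Prop :=
  ∀ τ : M.Tri, ρ * Metric.diam (M.elem τ.1) ≤ outerLen τ

/-- The coefficients are piecewise constant with respect to the mesh. -/
def Resolves (c : Coefficients D) : Prop :=
  (∀ τ : M.Tri, ∃ a, ∀ x ∈ interior (tri τ), c.K x = a) ∧
  ∀ j : Fin (M.nΓ + 1),
    (∃ a, ∀ s ∈ Ioo (M.node j.castSucc) (M.node j.succ), c.κt s = a) ∧
    (∃ a, ∀ s ∈ Ioo (M.node j.castSucc) (M.node j.succ), c.κn s = a) ∧
    (∃ a, ∀ s ∈ Ioo (M.node j.castSucc) (M.node j.succ), c.ℓ s = a)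

/-- The diameter `h_τ` of a triangle, and the length `h_e` of a fracture edge. -/
def hTri (τ : M.Tri) : ℝ := Metric.diam (tri τ)
def hFrac (j : Fin (M.nΓ + 1)) : ℝ := M.node j.succ - M.node j.castSucc

/-- The integral over a fracture edge. -/
def intFrac (j : Fin (M.nΓ + 1)) (g : ℝ → ℝ) : ℝ :=
  ∫ s in (M.node j.castSucc)..(M.node j.succ), g s

end Mesh

/-- The integral over the segment from `a` to `b` with respect to length. -/
def edgeInt (a b : Plane) (g : Plane → ℝ) : ℝ :=
  dist a b * ∫ t in (0 : ℝ)..1, g (AffineMap.lineMap a b t)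

/-! ### Discrete spaces -/

/-- Values, gradient and divergence of polynomials and polynomial vector fields. -/
def pval (q : MvPolynomial (Fin 2) ℝ) (x : Plane) : ℝ := MvPolynomial.eval (fun i => x i) q
def pgrad (q : MvPolynomial (Fin 2) ℝ) (x : Plane) : Plane :=
  !₂[pval (MvPolynomial.pderiv 0 q) x, pval (MvPolynomial.pderiv 1 q) x]
def vval (v : Fin 2 → MvPolynomial (Fin 2) ℝ) (x : Plane) : Plane := !₂[pval (v 0) x, pval (v 1) x]
def vdiv (v : Fin 2 → MvPolynomial (Fin 2) ℝ) (x : Plane) : ℝ :=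
  pval (MvPolynomial.pderiv 0 (v 0)) x + pval (MvPolynomial.pderiv 1 (v 1)) x

namespace Mesh

variable {D : FracturedDomain} (M : Mesh D)

/-- Piecewise polynomial functions, piecewise polynomial vector fields, and functions on
the fracture that are polynomials in the arc length on each edge. -/
abbrev PwPoly := M.Tri → MvPolynomial (Fin 2) ℝ
abbrev PwVec := M.Tri → Fin 2 → MvPolynomial (Fin 2) ℝ
abbrev PwFrac := Fin (M.nΓ + 1) → Polynomial ℝ

/-- The space `S_h`. -/
def InS (k : ℕ) (q : M.PwPoly) : Prop :=
  (∀ τ, (q τ).totalDegree ≤ k) ∧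
  (∀ e ∈ M.intEdges, ∀ x ∈ outer e.1, pval (q e.1) x = pval (q e.2) x) ∧
  ∀ τ : M.Tri, outer τ ⊆ frontier D.Ω → ∀ x ∈ outer τ, pval (q τ) x = 0

/-- The space `V_h`. -/
def InV (k : ℕ) (v : M.PwVec) : Prop :=
  (∀ τ i, (v τ i).totalDegree ≤ k) ∧
  ∀ τ : M.Tri, ∀ x ∈ Polygons.inner τ,
    inner ℝ (vval (v τ) x) (innerNormal τ) = inner ℝ (vval (v (next τ)) x) (innerNormal τ)

/-- The space `W_h`: continuous at the nodes and zero at the two ends. -/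
def InW (k : ℕ) (w : M.PwFrac) : Prop :=
  (∀ j, (w j).natDegree ≤ k) ∧
  (∀ z : Fin M.nΓ, (w z.castSucc).eval (M.node z.succ.castSucc)
    = (w z.succ).eval (M.node z.succ.castSucc)) ∧
  (w 0).eval 0 = 0 ∧ (w (Fin.last M.nΓ)).eval D.L = 0

/-- Jump and average of a piecewise polynomial on the `j`-th fracture edge. -/
def jumpΓ (q : M.PwPoly) (j : Fin (M.nΓ + 1)) (s : ℝ) : ℝ :=
  pval (q (M.fracTri 0 j)) (D.γ s) - pval (q (M.fracTri 1 j)) (D.γ s)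
def avgΓ (q : M.PwPoly) (j : Fin (M.nΓ + 1)) (s : ℝ) : ℝ :=
  (pval (q (M.fracTri 0 j)) (D.γ s) + pval (q (M.fracTri 1 j)) (D.γ s)) / 2

/-- Normal trace, from the subdomain `i`, of a piecewise polynomial field on the `j`-th
fracture edge; jump and average of these. -/
def trN (v : M.PwVec) (i : Fin 2) (j : Fin (M.nΓ + 1)) (s : ℝ) : ℝ :=
  inner ℝ (vval (v (M.fracTri i j)) (D.γ s)) (D.normal s)
def jumpN (v : M.PwVec) (j : Fin (M.nΓ + 1)) (s : ℝ) : ℝ := M.trN v 0 j s - M.trN v 1 j s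
def avgN (v : M.PwVec) (j : Fin (M.nΓ + 1)) (s : ℝ) : ℝ := (M.trN v 0 j s + M.trN v 1 j s) / 2

/-- Jump of the normal component of a field on an interior primal edge. -/
def jumpE (v : M.PwVec) (e : M.Tri × M.Tri) (x : Plane) : ℝ :=
  inner ℝ (vval (v e.1) x) (outerNormal e.1) - inner ℝ (vval (v e.2) x) (outerNormal e.1)

/-- Jump of a function on the edge shared by `τ` and `next τ`. -/
def jumpP (q : M.PwPoly) (τ : M.Tri) (x : Plane) : ℝ := pval (q τ) x - pval (q (next τ)) x

/-! ### The discrete problem -/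

/-- `b_h(v, q)`; the normal component of `v` is continuous across the edges of `F_p`. -/
def b (v : M.PwVec) (q : M.PwPoly) : ℝ :=
  -(∑ τ : M.Tri, edgeInt (ctr τ) (tgt τ)
      (fun x => inner ℝ (vval (v τ) x) (innerNormal τ) * M.jumpP q τ x))
    + ∑ τ : M.Tri, ∫ x in tri τ, inner ℝ (vval (v τ) x) (pgrad (q τ) x)

/-- `b_h^*(q, v)`; `q` is continuous across the edges of `F_u⁰`. -/
def bStar (q : M.PwPoly) (v : M.PwVec) : ℝ :=
  (∑ e ∈ M.intEdges, edgeInt (src e.1) (tgt e.1) (fun x => pval (q e.1) x * M.jumpE v e x))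
    - (∑ τ : M.Tri, ∫ x in tri τ, pval (q τ) x * vdiv (v τ) x)
    + (∑ j, M.intFrac j (fun s => M.jumpΓ q j s * M.avgN v j s))
    + ∑ j, M.intFrac j (fun s => M.avgΓ q j s * M.jumpN v j s)

/-- `(uh, ph, wh) ∈ V_h × S_h × W_h` solves the staggered discontinuous Galerkin equations. -/
structure IsDiscreteSolution (c : Coefficients D) (k : ℕ) (f : Plane → ℝ) (fΓ : ℝ → ℝ)
    (uh : M.PwVec) (ph : M.PwPoly) (wh : M.PwFrac) : Prop where
  uh_mem : M.InV k uh
  ph_mem : M.InS k ph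
  wh_mem : M.InW k wh
  darcy : ∀ v, M.InV k v →
    (∑ τ : M.Tri, ∫ x in tri τ, (c.K x)⁻¹ * inner ℝ (vval (uh τ) x) (vval (v τ) x))
      + M.bStar ph v = 0
  balance : ∀ q, M.InS k q →
    -M.b uh q
      + (∑ j, M.intFrac j (fun s =>
          (c.αΓ s)⁻¹ * (M.avgΓ ph j s - (wh j).eval s) * M.avgΓ q j s))
      + (∑ j, M.intFrac j (fun s => (c.ηΓ s)⁻¹ * M.jumpΓ ph j s * M.jumpΓ q j s))
      = ∑ τ : M.Tri, ∫ x in tri τ, f x * pval (q τ) x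
  fracture : ∀ r, M.InW k r →
    (∑ j, M.intFrac j (fun s => c.KΓ s * (wh j).derivative.eval s * (r j).derivative.eval s))
      - (∑ j, M.intFrac j (fun s =>
          (c.αΓ s)⁻¹ * (M.avgΓ ph j s - (wh j).eval s) * (r j).eval s))
      = ∑ j, M.intFrac j (fun s => c.ℓ s * fΓ s * (r j).eval s)

/-! ### Error, estimator and oscillation -/

/-- The norm `‖(u - uh, p - ph, pΓ - wh)‖_sdg`, where `g i` is the normal trace of `u` on the
fracture from the subdomain `i`. -/
def sdgError (c : Coefficients D) (u : Plane → Plane) (g : Fin 2 → ℝ → ℝ) (p : BulkH1 D)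
    (pΓ : FracH10 D) (uh : M.PwVec) (ph : M.PwPoly) (wh : M.PwFrac) : ℝ :=
  Real.sqrt (
    (∑ τ : M.Tri, ∫ x in tri τ, (c.K x)⁻¹ * ‖u x - vval (uh τ) x‖ ^ 2)
    + (∑ j, M.intFrac j (fun s =>
        (c.αΓ s)⁻¹ * ((p.avg s - M.avgΓ ph j s) - (pΓ.val s - (wh j).eval s)) ^ 2))
    + (∑ j, M.intFrac j (fun s => (c.ηΓ s)⁻¹ * (p.jump s - M.jumpΓ ph j s) ^ 2))
    + (∑ τ : M.Tri, ∫ x in tri τ, c.K x * ‖p.grad x - pgrad (ph τ) x‖ ^ 2)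
    + (∑ j, M.intFrac j (fun s => c.KΓ s * (pΓ.der s - (wh j).derivative.eval s) ^ 2))
    + (∑ j, M.intFrac j (fun s => ((g 0 s - g 1 s) - M.jumpN uh j s) ^ 2))
    + ∑ j, M.intFrac j (fun s => ((g 0 s + g 1 s) / 2 - M.avgN uh j s) ^ 2))

/-- The (constant) value of `K_Γ` on the `j`-th fracture edge. -/
def KΓe (c : Coefficients D) (j : Fin (M.nΓ + 1)) : ℝ :=
  c.KΓ ((M.node j.castSucc + M.node j.succ) / 2)

/-- The squared vertex residual `[K_Γ ∇_t wh]_z² / {K_Γ}_z` at an interior node `z`, with the mean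
value `{K_Γ}_z` of `K_Γ` on the two adjacent edges. It equals
`[K_Γ^{1/2} ∇_t wh]_z²` if `K_Γ` has the same value on these edges. -/
def vertexResidual (c : Coefficients D) (wh : M.PwFrac) (z : Fin M.nΓ) : ℝ :=
  (M.KΓe c z.castSucc * (wh z.castSucc).derivative.eval (M.node z.succ.castSucc)
    - M.KΓe c z.succ * (wh z.succ).derivative.eval (M.node z.succ.castSucc)) ^ 2
    / ((M.KΓe c z.castSucc + M.KΓe c z.succ) / 2)

/-- The residual estimator `η`. -/
def estimator (c : Coefficients D) (f : Plane → ℝ) (fΓ : ℝ → ℝ)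
    (uh : M.PwVec) (ph : M.PwPoly) (wh : M.PwFrac) : ℝ :=
  Real.sqrt (∑ τ : M.Tri, ∫ x in tri τ,
      ‖(Real.sqrt (c.K x))⁻¹ • vval (uh τ) x + Real.sqrt (c.K x) • pgrad (ph τ) x‖ ^ 2)
  + Real.sqrt (∑ τ : M.Tri, M.hTri τ ^ 2 * ∫ x in tri τ, (f x - vdiv (uh τ) x) ^ 2)
  + Real.sqrt (∑ τ : M.Tri, (innerLen τ)⁻¹ *
      edgeInt (ctr τ) (tgt τ) (fun x => M.jumpP ph τ x ^ 2))
  + Real.sqrt (∑ e ∈ M.intEdges, outerLen e.1 *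
      edgeInt (src e.1) (tgt e.1) (fun x => M.jumpE uh e x ^ 2))
  + Real.sqrt (∑ j, M.hFrac j ^ 2 * M.intFrac j (fun s =>
      (c.ℓ s * fΓ s + M.KΓe c j * (wh j).derivative.derivative.eval s + M.jumpN uh j s) ^ 2))
  + Real.sqrt (∑ z : Fin M.nΓ, max (M.hFrac z.castSucc) (M.hFrac z.succ) * M.vertexResidual c wh z)
  + Real.sqrt (∑ j, M.hFrac j * M.intFrac j (fun s =>
      ((c.αΓ s)⁻¹ * (M.avgΓ ph j s - (wh j).eval s) - M.jumpN uh j s) ^ 2))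
  + Real.sqrt (∑ j, M.hFrac j * M.intFrac j (fun s =>
      (M.avgN uh j s - (c.ηΓ s)⁻¹ * M.jumpΓ ph j s) ^ 2))

/-- The data oscillation for the piecewise polynomial approximations `fh`, `fΓh` of `f`, `fΓ`. -/
def osc (c : Coefficients D) (f : Plane → ℝ) (fΓ : ℝ → ℝ) (fh : M.PwPoly) (fΓh : M.PwFrac) : ℝ :=
  Real.sqrt (
    (∑ j, M.hFrac j ^ 2 * M.intFrac j (fun s => (c.ℓ s * ((fΓh j).eval s - fΓ s)) ^ 2))
    + ∑ τ : M.Tri, M.hTri τ ^ 2 * ∫ x in tri τ, (f x - pval (fh τ) x) ^ 2)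

end Mesh

end FractureSDG

end

open scoped ContDiff

noncomputable section

namespace FractureSDG

open Polygons (ctr src tgt next tri outer outerLen outerNormal innerLen innerNormal)

/-! ### Plane geometry in affine coordinates -/

/-! The normal traces of `u` can be read off from the weak formulation. With the jump
$\alpha_\Gamma^{-1}(\{p\}-p_\Gamma)$ (`fluxJump`) and the mean $\eta_\Gamma^{-1}[p]$ (`fluxAvg`),
the bulk balance is literally Green's formula for `u` with divergence `f`
(`IsWeakSolution.hasNormalTraces`). So the exact solution satisfies both interface laws pointwise,
and the last two terms of the estimator are differences between discrete and exact laws, bounded by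
the triangle inequality. In the same way Darcy's law holds almost everywhere, and the first term is
a combination of the errors of flux and gradient.

The bulk residual, the normal jumps on primal edges and the residual on fracture edges are handled
with bubble functions. A polynomial residual is multiplied by a bubble supported on one triangle, on
the two triangles at an edge, or on one fracture edge. The exact equation, tested with this product,
expresses a weighted norm of the residual through the error, and the part of the data that is not
polynomial becomes oscillation. Young's inequality absorbs the norm of the test function. The
constants are uniform because the norm equivalences are proved once, on the reference triangle and
interval, for polynomials of bounded degree (`exists_bubble_bound`, `exists_edgeBubble_bound`), and
are carried over by affine maps. The scaling needs triangles whose area is at least a multiple of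
$h_\tau^2$. This is `Mesh.StarShaped.le_area`: a ball of star centres around $\nu$ cannot reach
across an edge, so $\nu$ has height at least $\rho_Sh_S$ over every edge.

The vertex residual is tested with the hat function at `z`. The two edges at `z` then enter with
their own lengths, which must be comparable. A walk around `z` through triangles on one side of the
fracture shows this (`Mesh.exists_hFrac_comparable`): it has boundedly many steps by an area count,
and neighbouring polygons share an edge comparable to both diameters.

The jumps of `p_h` on $\mathcal F_p$ are no component of the error, and here the discrete equation
is used instead. The space $V_h$ contains a field whose normal component on these edges is the jump
divided by the length (`Mesh.jumpField`). The two discrete forms are adjoint (`Mesh.bStar_eq_b`), so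
the discrete Darcy law equates the scaled sum of squared jumps with the Darcy residual tested by
this field. The jumps are thus controlled by the first term of the estimator (`Mesh.sum_jumpP_le`).
-/

theorem Plane.ext_iff_coord {x y : Plane} : x = y ↔ x 0 = y 0 ∧ x 1 = y 1 := by
  refine ⟨fun h => by simp [h], fun ⟨h0, h1⟩ => ?_⟩
  ext i; fin_cases i <;> assumption

theorem plane_inner (x y : Plane) : inner ℝ x y = x 0 * y 0 + x 1 * y 1 := by
  simp [PiLp.inner_apply, Fin.sum_univ_two, mul_comm]

theorem plane_norm_sq (x : Plane) : ‖x‖ ^ 2 = x 0 ^ 2 + x 1 ^ 2 := by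
  simp [EuclideanSpace.norm_sq_eq, Fin.sum_univ_two]

@[simp] theorem rotcw_zero (v : Plane) : rotcw v 0 = v 1 := by simp [rotcw]
@[simp] theorem rotcw_one (v : Plane) : rotcw v 1 = -v 0 := by simp [rotcw]

theorem inner_rotcw (v w : Plane) : inner ℝ v (rotcw w) = cross v w := by
  simp [plane_inner, cross]; ring

theorem norm_rotcw (v : Plane) : ‖rotcw v‖ = ‖v‖ := by
  have : ‖rotcw v‖ ^ 2 = ‖v‖ ^ 2 := by simp [plane_norm_sq]; ring
  exact (sq_eq_sq₀ (norm_nonneg _) (norm_nonneg _)).1 this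

theorem rotcw_smul (r : ℝ) (v : Plane) : rotcw (r • v) = r • rotcw v := by
  rw [Plane.ext_iff_coord]; simp

theorem abs_cross_le (v w : Plane) : |cross v w| ≤ ‖v‖ * ‖w‖ := by
  rw [← inner_rotcw, ← norm_rotcw w]
  exact abs_real_inner_le_norm _ _

theorem cross_swap (v w : Plane) : cross v w = -cross w v := by simp [cross]; ring
theorem cross_add_left (v v' w : Plane) : cross (v + v') w = cross v w + cross v' w := by
  simp [cross]; ring
theorem cross_smul_left (r : ℝ) (v w : Plane) : cross (r • v) w = r * cross v w := by
  simp [cross]; ring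

/-- Affine coordinates with origin `A` and axes through `B` and `C`. -/
def aff (A B C : Plane) (p : ℝ × ℝ) : Plane := A + p.1 • (B - A) + p.2 • (C - A)

/-- Twice the signed area of the triangle `ABC`. -/
def area2 (A B C : Plane) : ℝ := cross (B - A) (C - A)

/-- Cramer's rule for the inverse of `aff`. In a mesh triangle `A`, `B`, `C` are `src`, `tgt`,
`ctr`, so the polygon edge is where the second coordinate vanishes, and the interior point of the
polygon is `(0, 1)`. -/
def co (A B C : Plane) (x : Plane) : ℝ × ℝ :=
  (cross (x - A) (C - A) / area2 A B C, cross (B - A) (x - A) / area2 A B C)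

theorem co_aff {A B C : Plane} (h : area2 A B C ≠ 0) (p : ℝ × ℝ) : co A B C (aff A B C p) = p := by
  unfold co
  ext <;> simp only <;> rw [div_eq_iff h] <;> simp [aff, area2, cross] <;> ring

theorem aff_co {A B C : Plane} (h : area2 A B C ≠ 0) (x : Plane) : aff A B C (co A B C x) = x := by
  rw [Plane.ext_iff_coord]
  constructor <;> simp only [aff, co, PiLp.add_apply, PiLp.smul_apply, PiLp.sub_apply, smul_eq_mul]
    <;> field_simp <;> simp [area2, cross] <;> ring

theorem continuous_aff (A B C : Plane) : Continuous (aff A B C) := by unfold aff; fun_prop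

theorem contDiff_co (A B C : Plane) {n : WithTop ℕ∞} : ContDiff ℝ n (co A B C) := by
  have h : ∀ i : Fin 2, ContDiff ℝ n (fun x : Plane => x i) := fun i => by fun_prop
  unfold co cross
  simp only [PiLp.sub_apply]
  have h0 := h 0
  have h1 := h 1
  fun_prop

theorem continuous_co (A B C : Plane) : Continuous (co A B C) :=
  (contDiff_co A B C (n := 0)).continuous

/-- The reference triangle. -/
def refTri : Set (ℝ × ℝ) := {p | 0 ≤ p.1 ∧ 0 ≤ p.2 ∧ p.1 + p.2 ≤ 1}

theorem isClosed_refTri : IsClosed refTri := by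
  have h1 : IsClosed {p : ℝ × ℝ | 0 ≤ p.1} := isClosed_le (by fun_prop) (by fun_prop)
  have h2 : IsClosed {p : ℝ × ℝ | 0 ≤ p.2} := isClosed_le (by fun_prop) (by fun_prop)
  have h3 : IsClosed {p : ℝ × ℝ | p.1 + p.2 ≤ 1} := isClosed_le (by fun_prop) (by fun_prop)
  exact h1.inter (h2.inter h3)

theorem refTri_subset : refTri ⊆ Icc 0 1 ×ˢ Icc 0 1 := by
  rintro ⟨s, t⟩ ⟨h1, h2, h3⟩
  simp only at h1 h2 h3
  simp only [mem_prod, mem_Icc]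
  exact ⟨⟨h1, by linarith⟩, h2, by linarith⟩

theorem isCompact_refTri : IsCompact refTri :=
  (isCompact_Icc.prod isCompact_Icc).of_isClosed_subset isClosed_refTri refTri_subset

theorem convex_refTri : Convex ℝ refTri := by
  rintro ⟨s, t⟩ ⟨h1, h2, h3⟩ ⟨s', t'⟩ ⟨h1', h2', h3'⟩ a b ha hb hab
  simp only at h1 h2 h3 h1' h2' h3'
  refine ⟨?_, ?_, ?_⟩ <;> simp only [Prod.smul_mk, Prod.mk_add_mk, smul_eq_mul]
  · positivity
  · positivity
  · nlinarith

theorem convexHull_eq_image (A B C : Plane) : convexHull ℝ {C, A, B} = aff A B C '' refTri := by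
  apply Subset.antisymm
  · apply convexHull_min
    · rintro x (rfl | rfl | rfl)
      · exact ⟨(0, 1), by simp [refTri], by simp [aff]⟩
      · exact ⟨(0, 0), by simp [refTri], by simp [aff]⟩
      · exact ⟨(1, 0), by simp [refTri], by simp [aff]⟩
    · rintro _ ⟨p, hp, rfl⟩ _ ⟨q, hq, rfl⟩ a b ha hb hab
      refine ⟨a • p + b • q, convex_refTri hp hq ha hb hab, ?_⟩
      have hb' : b = 1 - a := by linarith
      rw [Plane.ext_iff_coord]
      constructor <;> simp [aff, hb'] <;> ring
  · rintro _ ⟨⟨s, t⟩, ⟨h1, h2, h3⟩, rfl⟩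
    simp only at h1 h2 h3
    have hc := convex_convexHull ℝ ({C, A, B} : Set Plane)
    have hC : C ∈ convexHull ℝ ({C, A, B} : Set Plane) := subset_convexHull _ _ (by simp)
    have hA : A ∈ convexHull ℝ ({C, A, B} : Set Plane) := subset_convexHull _ _ (by simp)
    have hB : B ∈ convexHull ℝ ({C, A, B} : Set Plane) := subset_convexHull _ _ (by simp)
    have := hc.sum_mem (t := Finset.univ) (w := ![1 - s - t, s, t]) (z := ![A, B, C])
      (by intro i _; fin_cases i <;> simp <;> linarith) (by simp [Fin.sum_univ_three]; ring)
      (by intro i _; fin_cases i <;> simpa)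
    convert this using 1
    rw [Plane.ext_iff_coord]
    constructor <;> simp [Fin.sum_univ_three, aff] <;> ring

theorem mem_convexHull_iff {A B C : Plane} (h : area2 A B C ≠ 0) (x : Plane) :
    x ∈ convexHull ℝ ({C, A, B} : Set Plane) ↔ co A B C x ∈ refTri := by
  rw [convexHull_eq_image]
  refine ⟨?_, fun hx => ⟨_, hx, aff_co h x⟩⟩
  rintro ⟨p, hp, rfl⟩
  rwa [co_aff h]

theorem mem_interior_convexHull {A B C : Plane} (h : area2 A B C ≠ 0) {x : Plane}
    (h1 : 0 < (co A B C x).1) (h2 : 0 < (co A B C x).2)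
    (h3 : (co A B C x).1 + (co A B C x).2 < 1) :
    x ∈ interior (convexHull ℝ ({C, A, B} : Set Plane)) := by
  rw [mem_interior_iff_mem_nhds]
  have hc := (continuous_co A B C)
  have e1 := (hc.fst.tendsto x).eventually (lt_mem_nhds h1)
  have e2 := (hc.snd.tendsto x).eventually (lt_mem_nhds h2)
  have e3 := ((hc.fst.add hc.snd).tendsto x).eventually (gt_mem_nhds h3)
  filter_upwards [e1, e2, e3] with y y1 y2 y3
  exact (mem_convexHull_iff h y).2 ⟨y1.le, y2.le, y3.le⟩

/-! ### Integrals over a triangle in reference coordinates -/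

theorem measurePreserving_toPlane :
    MeasurePreserving (fun p : ℝ × ℝ => (!₂[p.1, p.2] : Plane)) volume volume :=
  (PiLp.volume_preserving_toLp (Fin 2)).comp (volume_preserving_finTwoArrow ℝ).symm

theorem measurableEmbedding_toPlane :
    MeasurableEmbedding (fun p : ℝ × ℝ => (!₂[p.1, p.2] : Plane)) :=
  ((MeasurableEquiv.toLp 2 (Fin 2 → ℝ)).measurableEmbedding).comp
    (MeasurableEquiv.finTwoArrow (α := ℝ)).symm.measurableEmbedding

theorem setIntegral_convexHull {A B C : Plane} (h : 0 < area2 A B C) (f : Plane → ℝ) :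
    ∫ x in convexHull ℝ {C, A, B}, f x = area2 A B C * ∫ p in refTri, f (aff A B C p) := by
  -- The linear part of `aff`, moved to `ℝ × ℝ` so that its determinant is that of an explicit
  -- matrix.
  set L : ℝ × ℝ →ₗ[ℝ] ℝ × ℝ :=
    Matrix.toLin (Module.Basis.finTwoProd ℝ) (Module.Basis.finTwoProd ℝ)
      !![B 0 - A 0, C 0 - A 0; B 1 - A 1, C 1 - A 1] with hL
  have hLa : ∀ p, L p = ((B 0 - A 0) * p.1 + (C 0 - A 0) * p.2,
      (B 1 - A 1) * p.1 + (C 1 - A 1) * p.2) := fun p => by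
    rw [hL, Matrix.toLin_finTwoProd_apply]
  have hdet : L.det = area2 A B C := by
    rw [hL, LinearMap.det_toLin, Matrix.det_fin_two]; simp [area2, cross]; ring
  set T : ℝ × ℝ → ℝ × ℝ := fun p => (A 0, A 1) + L p with hT
  have hTa : ∀ p, (!₂[(T p).1, (T p).2] : Plane) = aff A B C p := fun p => by
    rw [Plane.ext_iff_coord]
    constructor <;> simp [hT, hLa, aff] <;> ring
  rw [← measurePreserving_toPlane.setIntegral_preimage_emb measurableEmbedding_toPlane]
  have hpre : (fun p : ℝ × ℝ => (!₂[p.1, p.2] : Plane)) ⁻¹' (convexHull ℝ {C, A, B}) =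
      T '' refTri := by
    rw [convexHull_eq_image]
    ext p
    simp only [mem_preimage, mem_image]
    refine exists_congr fun q => and_congr_right fun _ => ?_
    rw [← hTa q, Plane.ext_iff_coord, Prod.ext_iff]
    simp
  have hinj : InjOn T refTri := by
    intro p _ q _ hpq
    have : aff A B C p = aff A B C q := by rw [← hTa p, ← hTa q, hpq]
    rw [← co_aff h.ne' p, this, co_aff h.ne']
  have hder : ∀ x ∈ refTri, HasFDerivWithinAt T (LinearMap.toContinuousLinearMap L) refTri x :=
    fun x _ => ((LinearMap.toContinuousLinearMap L).hasFDerivAt.const_add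
      ((A 0, A 1) : ℝ × ℝ)).hasFDerivWithinAt
  rw [hpre, integral_image_eq_integral_abs_det_fderiv_smul _ isClosed_refTri.measurableSet hder hinj,
    ← integral_const_mul]
  refine integral_congr_ae (Filter.Eventually.of_forall fun p => ?_)
  simp only [ContinuousLinearMap.det, LinearMap.coe_toContinuousLinearMap, hdet, abs_of_pos h,
    smul_eq_mul, hTa]

theorem setIntegral_refTri {g : ℝ × ℝ → ℝ} (hg : Continuous g) :
    ∫ p in refTri, g p = ∫ s in (0 : ℝ)..1, ∫ t in (0 : ℝ)..(1 - s), g (s, t) := by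
  have hint : Integrable (refTri.indicator g) :=
    (hg.continuousOn.integrableOn_compact isCompact_refTri).integrable_indicator
      isClosed_refTri.measurableSet
  rw [← integral_indicator isClosed_refTri.measurableSet, Measure.volume_eq_prod,
    integral_prod _ hint, intervalIntegral.integral_of_le zero_le_one, ← integral_Icc_eq_integral_Ioc,
    ← integral_indicator measurableSet_Icc]
  congr 1
  ext s
  by_cases hs : s ∈ Icc (0 : ℝ) 1
  · rw [indicator_of_mem hs, intervalIntegral.integral_of_le (by linarith [hs.2]),
      ← integral_Icc_eq_integral_Ioc, ← integral_indicator measurableSet_Icc]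
    congr 1
    ext t
    have : (s, t) ∈ refTri ↔ t ∈ Icc 0 (1 - s) := by
      simp only [refTri, mem_ofPred_eq, mem_Icc]
      exact ⟨fun h => ⟨h.2.1, by linarith [h.2.2]⟩, fun h => ⟨hs.1, h.1, by linarith [h.2]⟩⟩
    by_cases ht : t ∈ Icc 0 (1 - s)
    · rw [indicator_of_mem (this.2 ht), indicator_of_mem ht]
    · rw [indicator_of_notMem (fun h => ht (this.1 h)), indicator_of_notMem ht]
  · rw [indicator_of_notMem hs]
    have : ∀ t, refTri.indicator g (s, t) = 0 := fun t =>
      indicator_of_notMem (fun h => hs (refTri_subset h).1) _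
    simp [this]

theorem setIntegral_refTri_symm {g : ℝ × ℝ → ℝ} (hg : Continuous g) :
    ∫ p in refTri, g p = ∫ t in (0 : ℝ)..1, ∫ s in (0 : ℝ)..(1 - t), g (s, t) := by
  rw [← setIntegral_refTri (g := fun p => g (p.2, p.1)) (by fun_prop)]
  have h : MeasurePreserving (Prod.swap : ℝ × ℝ → ℝ × ℝ) volume volume :=
    Measure.measurePreserving_swap
  rw [← h.setIntegral_preimage_emb (MeasurableEquiv.prodComm (α := ℝ) (β := ℝ)).measurableEmbedding]
  have : (Prod.swap : ℝ × ℝ → ℝ × ℝ) ⁻¹' refTri = refTri := by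
    ext ⟨s, t⟩
    simp only [refTri, mem_preimage, Prod.swap, mem_ofPred_eq, add_comm s t]
    tauto
  rw [this]
  rfl

/-! ### Fluxes through segments and the divergence theorem -/

/-- The flux of `F` through the segment from `p` to `q`, to the right of its direction. -/
def flux (F : Plane → Plane) (p q : Plane) : ℝ :=
  ∫ t in (0 : ℝ)..1, inner ℝ (F (AffineMap.lineMap p q t)) (rotcw (q - p))

theorem flux_swap (F : Plane → Plane) (p q : Plane) : flux F p q = -flux F q p := by
  unfold flux
  rw [← intervalIntegral.integral_neg]
  have := intervalIntegral.integral_comp_sub_left (a := 0) (b := 1)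
    (fun t => inner ℝ (F (AffineMap.lineMap p q t)) (rotcw (q - p))) 1
  simp only [sub_zero, sub_self] at this
  rw [← this]
  congr 1
  ext t
  rw [AffineMap.lineMap_apply_one_sub, inner_rotcw, inner_rotcw]
  simp [cross]; ring

theorem plane_decomp (v : Plane) :
    v = v 0 • EuclideanSpace.single 0 1 + v 1 • EuclideanSpace.single 1 1 := by
  rw [Plane.ext_iff_coord]; simp

/-- The derivative of a determinant is the determinant times the trace. For the derivative of a
field it turns the divergence, multiplied by the Jacobian, into a sum of two partial derivatives in
reference coordinates. -/
theorem piola (M : Plane →L[ℝ] Plane) (a b : Plane) :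
    cross (M a) b + cross a (M b) =
      cross a b * ∑ i : Fin 2, (M (EuclideanSpace.single i 1)) i := by
  have ha : M a = a 0 • M (EuclideanSpace.single 0 1) + a 1 • M (EuclideanSpace.single 1 1) := by
    conv_lhs => rw [plane_decomp a]
    simp
  have hb : M b = b 0 • M (EuclideanSpace.single 0 1) + b 1 • M (EuclideanSpace.single 1 1) := by
    conv_lhs => rw [plane_decomp b]
    simp
  rw [ha, hb, Fin.sum_univ_two]
  simp [cross]; ring

theorem continuous_divergence {F : Plane → Plane} (hF : ContDiff ℝ 1 F) :
    Continuous (divergence F) := by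
  unfold divergence
  have h : Continuous (fderiv ℝ F) := hF.continuous_fderiv one_ne_zero
  refine continuous_finsetSum _ fun i _ => ?_
  have h2 : Continuous fun x => fderiv ℝ F x (EuclideanSpace.single i 1) :=
    h.clm_apply continuous_const
  fun_prop

/-- The divergence theorem on a triangle. -/
theorem setIntegral_divergence {A B C : Plane} (h : 0 < area2 A B C) {F : Plane → Plane}
    (hF : ContDiff ℝ 1 F) :
    ∫ x in convexHull ℝ {C, A, B}, divergence F x = flux F A B + flux F B C + flux F C A := by
  set G : ℝ × ℝ → Plane := fun p => F (aff A B C p) with hG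
  have hGc : Continuous G := hF.continuous.comp (continuous_aff A B C)
  have hfc : Continuous (fderiv ℝ F) := hF.continuous_fderiv one_ne_zero
  set Ma : ℝ × ℝ → Plane := fun p => fderiv ℝ F (aff A B C p) (B - A) with hMa
  set Mb : ℝ × ℝ → Plane := fun p => fderiv ℝ F (aff A B C p) (C - A) with hMb
  have hMac : Continuous Ma := (hfc.comp (continuous_aff A B C)).clm_apply continuous_const
  have hMbc : Continuous Mb := (hfc.comp (continuous_aff A B C)).clm_apply continuous_const
  have hcross : ∀ {f g : ℝ × ℝ → Plane}, Continuous f → Continuous g →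
      Continuous fun p => cross (f p) (g p) := fun hf hg => by
    unfold cross; fun_prop
  have hdF : ∀ p, HasFDerivAt F (fderiv ℝ F (aff A B C p)) (aff A B C p) := fun p =>
    (hF.differentiable one_ne_zero _).hasFDerivAt
  have hs : ∀ s t, HasDerivAt (fun s => G (s, t)) (Ma (s, t)) s := fun s t => by
    have h1 : HasDerivAt (fun s : ℝ => aff A B C (s, t)) (B - A) s := by
      have := ((hasDerivAt_id s).smul_const (B - A)).const_add A |>.add_const (t • (C - A))
      simpa [aff] using this
    exact (hdF (s, t)).comp_hasDerivAt s h1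
  have ht : ∀ s t, HasDerivAt (fun t => G (s, t)) (Mb (s, t)) t := fun s t => by
    have h1 : HasDerivAt (fun t : ℝ => aff A B C (s, t)) (C - A) t := by
      have := ((hasDerivAt_id t).smul_const (C - A)).const_add (A + s • (B - A))
      simpa [aff] using this
    exact (hdF (s, t)).comp_hasDerivAt t h1
  have hco : ∀ {f : ℝ → Plane} {f' : Plane} {s : ℝ} (i : Fin 2), HasDerivAt f f' s →
      HasDerivAt (fun s => f s i) (f' i) s := fun i hf =>
    (EuclideanSpace.proj i : Plane →L[ℝ] ℝ).hasFDerivAt.comp_hasDerivAt _ hf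
  rw [setIntegral_convexHull h, ← integral_const_mul]
  -- The integrand is an exact derivative in `s` plus an exact derivative in `t`. Integrating each
  -- one first in its own variable leaves only values on the three sides.
  have hsplit : ∀ p, area2 A B C * divergence F (aff A B C p) =
      cross (Ma p) (C - A) + cross (B - A) (Mb p) := fun p =>
    (piola (fderiv ℝ F (aff A B C p)) (B - A) (C - A)).symm
  simp_rw [hsplit]
  have hc1 := hcross hMac (continuous_const (y := C - A))
  have hc2 := hcross (continuous_const (y := B - A)) hMbc
  rw [integral_add (hc1.continuousOn.integrableOn_compact isCompact_refTri)
    (hc2.continuousOn.integrableOn_compact isCompact_refTri),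
    setIntegral_refTri_symm hc1, setIntegral_refTri hc2]
  have e1 : ∀ t : ℝ, ∫ s in (0 : ℝ)..(1 - t), cross (Ma (s, t)) (C - A) =
      cross (G (1 - t, t)) (C - A) - cross (G (0, t)) (C - A) := fun t => by
    refine intervalIntegral.integral_eq_sub_of_hasDerivAt
      (f := fun s => cross (G (s, t)) (C - A)) (fun s _ => ?_)
      (Continuous.intervalIntegrable (hc1.comp (by fun_prop : Continuous fun s : ℝ => (s, t))) _ _)
    unfold cross
    exact ((hco 0 (hs s t)).mul_const _).sub ((hco 1 (hs s t)).mul_const _)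
  have e2 : ∀ s : ℝ, ∫ t in (0 : ℝ)..(1 - s), cross (B - A) (Mb (s, t)) =
      cross (B - A) (G (s, 1 - s)) - cross (B - A) (G (s, 0)) := fun s => by
    refine intervalIntegral.integral_eq_sub_of_hasDerivAt
      (f := fun t => cross (B - A) (G (s, t))) (fun t _ => ?_)
      (Continuous.intervalIntegrable (hc2.comp (by fun_prop : Continuous fun t : ℝ => (s, t))) _ _)
    unfold cross
    exact ((hco 1 (ht s t)).const_mul _).sub ((hco 0 (ht s t)).const_mul _)
  simp_rw [e1, e2]
  have l1 : ∀ t : ℝ, aff A B C (1 - t, t) = AffineMap.lineMap B C t := fun t => by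
    rw [Plane.ext_iff_coord]; constructor <;> simp [aff, AffineMap.lineMap_apply] <;> ring
  have l2 : ∀ t : ℝ, aff A B C (0, t) = AffineMap.lineMap A C t := fun t => by
    rw [Plane.ext_iff_coord]; constructor <;> simp [aff, AffineMap.lineMap_apply] <;> ring
  have l3 : ∀ t : ℝ, aff A B C (t, 0) = AffineMap.lineMap A B t := fun t => by
    rw [Plane.ext_iff_coord]; constructor <;> simp [aff, AffineMap.lineMap_apply] <;> ring
  -- On the side from `B` to `C` the two boundary terms come with opposite parametrisations;
  -- reversing one of them lets them combine into a single flux.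
  have hsub : ∫ s in (0 : ℝ)..1, (cross (B - A) (G (s, 1 - s)) - cross (B - A) (G (s, 0))) =
      ∫ t in (0 : ℝ)..1, (cross (B - A) (G (1 - t, t)) - cross (B - A) (G (t, 0))) := by
    have i1 : Continuous fun s : ℝ => cross (B - A) (G (s, 1 - s)) := by
      have : Continuous fun s : ℝ => G (s, 1 - s) := hGc.comp (by fun_prop)
      unfold cross; fun_prop
    have i1' : Continuous fun s : ℝ => cross (B - A) (G (1 - s, s)) := by
      have : Continuous fun s : ℝ => G (1 - s, s) := hGc.comp (by fun_prop)
      unfold cross; fun_prop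
    have i2 : Continuous fun s : ℝ => cross (B - A) (G (s, 0)) := by
      have : Continuous fun s : ℝ => G (s, 0) := hGc.comp (by fun_prop)
      unfold cross; fun_prop
    rw [intervalIntegral.integral_sub (i1.intervalIntegrable _ _) (i2.intervalIntegrable _ _),
      intervalIntegral.integral_sub (i1'.intervalIntegrable _ _) (i2.intervalIntegrable _ _)]
    have := intervalIntegral.integral_comp_sub_left (a := 0) (b := 1)
      (fun s => cross (B - A) (G (s, 1 - s))) 1
    simp only [sub_zero, sub_self, sub_sub_cancel] at this
    rw [this]
  rw [hsub, flux_swap F C A]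
  unfold flux
  have k1 : ∀ P Q : Plane, Continuous fun t : ℝ =>
      inner ℝ (F (AffineMap.lineMap P Q t)) (rotcw (Q - P)) := fun P Q =>
    (hF.continuous.comp AffineMap.lineMap_continuous).inner continuous_const
  have k2 : ∀ f : ℝ → ℝ × ℝ, Continuous f → Continuous fun t => cross (G (f t)) (C - A) :=
    fun f hf => by
      have := hGc.comp hf
      simp only [Function.comp_def] at this
      unfold cross; fun_prop
  have k3 : ∀ f : ℝ → ℝ × ℝ, Continuous f → Continuous fun t => cross (B - A) (G (f t)) :=
    fun f hf => by
      have := hGc.comp hf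
      simp only [Function.comp_def] at this
      unfold cross; fun_prop
  have q1 : Continuous fun t : ℝ => cross (G (1 - t, t)) (C - A) - cross (G (0, t)) (C - A) :=
    (k2 _ (by fun_prop)).sub (k2 _ (by fun_prop))
  have q2 : Continuous fun t : ℝ => cross (B - A) (G (1 - t, t)) - cross (B - A) (G (t, 0)) :=
    (k3 _ (by fun_prop)).sub (k3 _ (by fun_prop))
  have q3 : Continuous fun t : ℝ => inner ℝ (F (AffineMap.lineMap A B t)) (rotcw (B - A))
      + inner ℝ (F (AffineMap.lineMap B C t)) (rotcw (C - B)) := (k1 A B).add (k1 B C)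
  have q4 : Continuous fun t : ℝ => -inner ℝ (F (AffineMap.lineMap A C t)) (rotcw (C - A)) :=
    (k1 A C).neg
  rw [← intervalIntegral.integral_add (q1.intervalIntegrable _ _) (q2.intervalIntegrable _ _),
    ← intervalIntegral.integral_neg,
    ← intervalIntegral.integral_add ((k1 A B).intervalIntegrable _ _)
      ((k1 B C).intervalIntegrable _ _),
    ← intervalIntegral.integral_add (q3.intervalIntegrable _ _) (q4.intervalIntegrable _ _)]
  congr 1
  ext t
  simp only [hG, l1, l2, l3, inner_rotcw]
  simp [cross]; ring

/-! ### Equivalence of quadratic forms on spaces of polynomials -/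

section Forms

variable {V : Type*} [AddCommGroup V] [Module ℝ V]

/-- The weighted squared `L²` norm of the function `Ψ v`. -/
def l2form {X F : Type*} [MeasureSpace X] [NormedAddCommGroup F] [NormedSpace ℝ F]
    (K : Set X) (κ : X → ℝ) (Ψ : V →ₗ[ℝ] (X → F)) (v : V) : ℝ :=
  ∫ x in K, κ x * ‖Ψ v x‖ ^ 2

theorem continuous_l2form {X F : Type*} [MeasureSpace X] [NormedAddCommGroup F] [NormedSpace ℝ F]
    [TopologicalSpace X] [OpensMeasurableSpace X]
    [IsLocallyFiniteMeasure (volume : Measure X)]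
    {K : Set X} (hK : IsCompact K) {κ : X → ℝ} (hκ : Continuous κ) {Ψ : V →ₗ[ℝ] (X → F)}
    (hΨ : ∀ v, Continuous (Ψ v)) {n : ℕ} (e : Fin n → V) :
    Continuous fun c : Fin n → ℝ => l2form K κ Ψ (∑ i, c i • e i) := by
  unfold l2form
  refine continuous_parametric_integral_of_continuous
    (f := fun (c : Fin n → ℝ) x => κ x * ‖Ψ (∑ i, c i • e i) x‖ ^ 2) ?_ hK
  have h : (fun p : (Fin n → ℝ) × X => κ p.2 * ‖Ψ (∑ i, p.1 i • e i) p.2‖ ^ 2) =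
      fun p => κ p.2 * ‖∑ i, p.1 i • Ψ (e i) p.2‖ ^ 2 := by
    ext p; simp [map_sum]
  change Continuous fun p : (Fin n → ℝ) × X => κ p.2 * ‖Ψ (∑ i, p.1 i • e i) p.2‖ ^ 2
  rw [h]
  have hs : Continuous fun p : (Fin n → ℝ) × X => ∑ i, p.1 i • Ψ (e i) p.2 :=
    continuous_finsetSum _ fun i _ => by
      have := (hΨ (e i)).comp (continuous_snd (X := Fin n → ℝ))
      simp only [Function.comp_def] at this
      fun_prop
  fun_prop

theorem l2form_smul {X F : Type*} [MeasureSpace X] [NormedAddCommGroup F] [NormedSpace ℝ F]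
    (K : Set X) (κ : X → ℝ) (Ψ : V →ₗ[ℝ] (X → F)) (r : ℝ) (v : V) :
    l2form K κ Ψ (r • v) = r ^ 2 * l2form K κ Ψ v := by
  unfold l2form
  rw [← integral_const_mul]
  congr 1
  ext x
  simp only [map_smul, Pi.smul_apply, norm_smul, mul_pow, Real.norm_eq_abs, sq_abs]
  ring

/-- On the unit sphere of the coordinate space `a` has a positive minimum and `b` a maximum;
homogeneity of degree two extends the comparison to all vectors. The functions need not be quadratic
forms. -/
theorem exists_form_le [Module.Finite ℝ V] {a b : V → ℝ}
    (ha : ∀ {n : ℕ} (e : Fin n → V), Continuous fun c : Fin n → ℝ => a (∑ i, c i • e i))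
    (hb : ∀ {n : ℕ} (e : Fin n → V), Continuous fun c : Fin n → ℝ => b (∑ i, c i • e i))
    (ha2 : ∀ (r : ℝ) v, a (r • v) = r ^ 2 * a v) (hb2 : ∀ (r : ℝ) v, b (r • v) = r ^ 2 * b v)
    (hpos : ∀ v, v ≠ 0 → 0 < a v) : ∃ C : ℝ, 0 < C ∧ ∀ v, b v ≤ C * a v := by
  set B := Module.finBasis ℝ V
  have hrep : ∀ v, ∑ i, B.repr v i • B i = v := fun v => B.sum_repr v
  have ha0 : a 0 = 0 := by simpa using ha2 0 0
  have hb0 : b 0 = 0 := by simpa using hb2 0 0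
  set S := Metric.sphere (0 : Fin (Module.finrank ℝ V) → ℝ) 1
  have hS : IsCompact S := isCompact_sphere _ _
  -- An empty sphere means that `V` is trivial.
  rcases S.eq_empty_or_nonempty with hS0 | hSn
  · refine ⟨1, one_pos, fun v => ?_⟩
    have hv : v = 0 := by
      by_contra hv
      have hc : (fun i => B.repr v i) ≠ 0 := fun h => hv (by
        rw [← hrep v]; exact Finset.sum_eq_zero fun i _ => by rw [congrFun h i]; simp)
      have : (‖fun i => B.repr v i‖⁻¹ • fun i => B.repr v i) ∈ S := by
        simp only [S, mem_sphere_zero_iff_norm, norm_smul, norm_inv, norm_norm]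
        exact inv_mul_cancel₀ (norm_ne_zero_iff.2 hc)
      rw [hS0] at this; exact this
    rw [hv, ha0, hb0]; simp
  obtain ⟨c₁, hc₁, hmin⟩ := hS.exists_isMinOn hSn (ha B).continuousOn
  obtain ⟨c₂, hc₂, hmax⟩ := hS.exists_isMaxOn hSn (hb B).continuousOn
  set α := a (∑ i, c₁ i • B i) with hα
  set β := b (∑ i, c₂ i • B i) with hβ
  have hαpos : 0 < α := hpos _ fun h => by
    have h0 := Fintype.linearIndependent_iff.1 B.linearIndependent c₁ h
    have : c₁ = 0 := funext h0
    rw [this] at hc₁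
    simp [S] at hc₁
  -- The maximum with `1` keeps the constant positive when `β` is not.
  refine ⟨max β 1 / α, by positivity, fun v => ?_⟩
  by_cases hv : v = 0
  · rw [hv, ha0, hb0]; simp
  set d : Fin (Module.finrank ℝ V) → ℝ := fun i => B.repr v i with hd
  have hdn : d ≠ 0 := fun h => hv (by
    rw [← hrep v]; exact Finset.sum_eq_zero fun i _ => by rw [show B.repr v i = 0 from congrFun h i]; simp)
  have hdS : ‖d‖⁻¹ • d ∈ S := by
    simp only [S, mem_sphere_zero_iff_norm, norm_smul, norm_inv, norm_norm]
    exact inv_mul_cancel₀ (norm_ne_zero_iff.2 hdn)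
  have hv' : v = ‖d‖ • ∑ i, (‖d‖⁻¹ • d) i • B i := by
    conv_lhs => rw [← hrep v]
    rw [Finset.smul_sum]
    refine Finset.sum_congr rfl fun i _ => ?_
    rw [smul_smul, Pi.smul_apply, smul_eq_mul, mul_inv_cancel_left₀ (norm_ne_zero_iff.2 hdn)]
  have h1 : α ≤ a (∑ i, (‖d‖⁻¹ • d) i • B i) := hmin hdS
  have h2 : b (∑ i, (‖d‖⁻¹ • d) i • B i) ≤ β := hmax hdS
  rw [hv', ha2, hb2, mul_left_comm]
  refine mul_le_mul_of_nonneg_left ?_ (sq_nonneg _)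
  calc b (∑ i, (‖d‖⁻¹ • d) i • B i) ≤ max β 1 := h2.trans (le_max_left _ _)
    _ = max β 1 / α * α := by field_simp
    _ ≤ _ := mul_le_mul_of_nonneg_left h1 (by positivity)

/-- A continuous nonnegative integrand that is positive somewhere is positive on a nonempty open
set. The weight may vanish on the boundary of `K`, as bubbles do; what is needed is an open `U` on
which it is positive and on which a function of the family cannot vanish identically. -/
theorem l2form_pos {X F : Type*} [MeasureSpace X] [NormedAddCommGroup F] [NormedSpace ℝ F]
    [TopologicalSpace X] [OpensMeasurableSpace X] [T2Space X]
    [IsLocallyFiniteMeasure (volume : Measure X)] [(volume : Measure X).IsOpenPosMeasure]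
    {K U : Set X} (hK : IsCompact K) (hU : IsOpen U) (hUK : U ⊆ K) {κ : X → ℝ} (hκ : Continuous κ)
    (hκ0 : ∀ x ∈ K, 0 ≤ κ x) (hκU : ∀ x ∈ U, 0 < κ x) {Ψ : V →ₗ[ℝ] (X → F)}
    (hΨ : ∀ v, Continuous (Ψ v)) (hinj : ∀ v, (∀ x ∈ U, Ψ v x = 0) → v = 0) {v : V} (hv : v ≠ 0) :
    0 < l2form K κ Ψ v := by
  have hc : Continuous fun x => κ x * ‖Ψ v x‖ ^ 2 := by
    have := hΨ v
    fun_prop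
  obtain ⟨x, hxU, hx⟩ : ∃ x ∈ U, Ψ v x ≠ 0 := by
    by_contra! h
    exact hv (hinj v h)
  have hnn : 0 ≤ᵐ[volume.restrict K] fun x => κ x * ‖Ψ v x‖ ^ 2 := by
    rw [Filter.EventuallyLE, ae_restrict_iff' hK.measurableSet]
    exact Filter.Eventually.of_forall fun x hx => mul_nonneg (hκ0 x hx) (sq_nonneg _)
  unfold l2form
  rw [setIntegral_pos_iff_support_of_nonneg_ae hnn (hc.continuousOn.integrableOn_compact hK)]
  have hopen : IsOpen (Function.support (fun x => κ x * ‖Ψ v x‖ ^ 2) ∩ U) :=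
    (hc.isOpen_support).inter hU
  refine (hopen.measure_pos volume ⟨x, ?_, hxU⟩).trans_le (measure_mono fun y hy => ⟨hy.1, hUK hy.2⟩)
  rw [Function.mem_support]
  have := hκU x hxU
  have := norm_pos_iff.2 hx
  positivity

end Forms

/-! ### Polynomials -/

theorem pval_add (p q : MvPolynomial (Fin 2) ℝ) (x : Plane) : pval (p + q) x = pval p x + pval q x := by
  simp [pval]
theorem pval_sub (p q : MvPolynomial (Fin 2) ℝ) (x : Plane) : pval (p - q) x = pval p x - pval q x := by
  simp [pval]
theorem pval_smul (r : ℝ) (p : MvPolynomial (Fin 2) ℝ) (x : Plane) : pval (r • p) x = r * pval p x := by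
  simp [pval]

theorem contDiff_pval (q : MvPolynomial (Fin 2) ℝ) {n : WithTop ℕ∞} : ContDiff ℝ n (pval q) := by
  induction q using MvPolynomial.induction_on with
  | C a =>
    have : pval (MvPolynomial.C a) = fun _ => a := by ext; simp [pval]
    rw [this]; exact contDiff_const
  | add p q hp hq =>
    have : pval (p + q) = fun x => pval p x + pval q x := by ext; simp [pval]
    rw [this]; exact hp.add hq
  | mul_X p i hp =>
    have : pval (p * MvPolynomial.X i) = fun x => pval p x * x i := by ext; simp [pval]
    rw [this]
    exact hp.mul (by fun_prop)

theorem continuous_pval (q : MvPolynomial (Fin 2) ℝ) : Continuous (pval q) :=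
  (contDiff_pval q (n := 0)).continuous

theorem continuous_toPlane {X : Type*} [TopologicalSpace X] {f g : X → ℝ} (hf : Continuous f)
    (hg : Continuous g) : Continuous fun x => (!₂[f x, g x] : Plane) := by
  refine (PiLp.continuous_toLp 2 _).comp (continuous_pi fun i => ?_)
  fin_cases i <;> assumption

theorem contDiff_toPlane {X : Type*} [NormedAddCommGroup X] [NormedSpace ℝ X] {f g : X → ℝ}
    {n : WithTop ℕ∞} (hf : ContDiff ℝ n f)
    (hg : ContDiff ℝ n g) : ContDiff ℝ n fun x => (!₂[f x, g x] : Plane) := by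
  rw [contDiff_piLp]
  intro i
  fin_cases i <;> assumption

theorem continuous_pgrad (q : MvPolynomial (Fin 2) ℝ) : Continuous (pgrad q) :=
  continuous_toPlane (continuous_pval _) (continuous_pval _)

theorem contDiff_vval (v : Fin 2 → MvPolynomial (Fin 2) ℝ) {n : WithTop ℕ∞} :
    ContDiff ℝ n (vval v) :=
  contDiff_toPlane (contDiff_pval _) (contDiff_pval _)

theorem continuous_vval (v : Fin 2 → MvPolynomial (Fin 2) ℝ) : Continuous (vval v) :=
  (contDiff_vval v (n := 0)).continuous

theorem continuous_vdiv (v : Fin 2 → MvPolynomial (Fin 2) ℝ) : Continuous (vdiv v) :=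
  (continuous_pval _).add (continuous_pval _)

theorem hasFDerivAt_pval (q : MvPolynomial (Fin 2) ℝ) (x : Plane) :
    HasFDerivAt (pval q) (innerSL ℝ (pgrad q x)) x := by
  induction q using MvPolynomial.induction_on with
  | C a =>
    have : pval (MvPolynomial.C a) = fun _ => a := by ext; simp [pval]
    rw [this]
    exact (hasFDerivAt_const a x).congr_fderiv
      (ContinuousLinearMap.ext fun v => by simp [pgrad, pval, plane_inner])
  | add p q hp hq =>
    have : pval (p + q) = fun x => pval p x + pval q x := by ext; simp [pval]
    rw [this]
    exact (hp.add hq).congr_fderiv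
      (ContinuousLinearMap.ext fun v => by simp [pgrad, pval, plane_inner]; ring)
  | mul_X p i hp =>
    have : pval (p * MvPolynomial.X i) = fun x => pval p x * x i := by ext; simp [pval]
    rw [this]
    exact (hp.mul (EuclideanSpace.proj i : Plane →L[ℝ] ℝ).hasFDerivAt).congr_fderiv
      (ContinuousLinearMap.ext fun v => by
        fin_cases i <;> simp [pgrad, pval, plane_inner, MvPolynomial.pderiv_X] <;> ring)

theorem inner_pgrad (q : MvPolynomial (Fin 2) ℝ) (x v : Plane) :
    inner ℝ (pgrad q x) v = fderiv ℝ (pval q) x v := by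
  rw [(hasFDerivAt_pval q x).fderiv]; simp

theorem divergence_vval (v : Fin 2 → MvPolynomial (Fin 2) ℝ) (x : Plane) :
    divergence (vval v) x = vdiv v x := by
  have h : ∀ i : Fin 2, ∀ w, (fderiv ℝ (vval v) x w) i = inner ℝ (pgrad (v i) x) w := by
    intro i w
    have hd : HasFDerivAt (vval v) (fderiv ℝ (vval v) x) x :=
      ((contDiff_vval v (n := 1)).differentiable one_ne_zero x).hasFDerivAt
    have h1 := (EuclideanSpace.proj i : Plane →L[ℝ] ℝ).hasFDerivAt.comp x hd
    have h2 : (EuclideanSpace.proj i : Plane →L[ℝ] ℝ) ∘ vval v = pval (v i) := by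
      ext y; fin_cases i <;> simp [vval]
    rw [h2] at h1
    rw [inner_pgrad, h1.fderiv]
    simp
  simp [divergence, h, vdiv, Fin.sum_univ_two, pgrad, plane_inner]

/-- Divergence of the product of a function and a field. -/
theorem divergence_smul {q : Plane → ℝ} {F : Plane → Plane} {x : Plane}
    (hq : DifferentiableAt ℝ q x) (hF : DifferentiableAt ℝ F x) :
    divergence (fun y => q y • F y) x = q x * divergence F x + fderiv ℝ q x (F x) := by
  unfold divergence
  have h := (hq.hasFDerivAt.smul hF.hasFDerivAt).fderiv
  have h' : fderiv ℝ (fun y => q y • F y) x =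
    q x • fderiv ℝ F x + (fderiv ℝ q x).smulRight (F x) := h
  rw [h']
  conv_rhs => rw [plane_decomp (F x)]
  simp [Fin.sum_univ_two]
  ring

/-- The value of a polynomial at a point of the reference plane. -/
def rval (w : MvPolynomial (Fin 2) ℝ) (p : ℝ × ℝ) : ℝ := pval w !₂[p.1, p.2]

theorem contDiff_rval (w : MvPolynomial (Fin 2) ℝ) {n : WithTop ℕ∞} : ContDiff ℝ n (rval w) :=
  (contDiff_pval w).comp (contDiff_toPlane contDiff_fst contDiff_snd)

/-- The polynomial `w` in affine coordinates. -/
def pullback (A B C : Plane) (w : MvPolynomial (Fin 2) ℝ) : MvPolynomial (Fin 2) ℝ :=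
  MvPolynomial.bind₁ (fun i => MvPolynomial.C (A i) + MvPolynomial.C (B i - A i) * MvPolynomial.X 0
    + MvPolynomial.C (C i - A i) * MvPolynomial.X 1) w

theorem rval_pullback (A B C : Plane) (w : MvPolynomial (Fin 2) ℝ) (p : ℝ × ℝ) :
    rval (pullback A B C w) p = pval w (aff A B C p) := by
  unfold rval pval pullback
  rw [← MvPolynomial.coe_aeval_eq_eval, RingHom.coe_coe, MvPolynomial.aeval_bind₁,
    ← MvPolynomial.coe_aeval_eq_eval, RingHom.coe_coe]
  congr 2
  ext i
  simp [aff]; ring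

/-- Affine substitutions preserve the degree bound. The norm equivalences depend on it, and the test
field for the pressure jumps must have degree at most `k`. -/
theorem totalDegree_bind_le (f : Fin 2 → MvPolynomial (Fin 2) ℝ) (hf : ∀ i, (f i).totalDegree ≤ 1)
    (w : MvPolynomial (Fin 2) ℝ) : (MvPolynomial.bind₁ f w).totalDegree ≤ w.totalDegree := by
  rw [MvPolynomial.bind₁, MvPolynomial.aeval_def, MvPolynomial.eval₂]
  refine (MvPolynomial.totalDegree_finsetSum _ _).trans (Finset.sup_le fun d hd => ?_)
  refine (MvPolynomial.totalDegree_mul _ _).trans ?_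
  rw [MvPolynomial.algebraMap_eq, MvPolynomial.totalDegree_C, zero_add]
  refine (MvPolynomial.totalDegree_finsetProd _ _).trans ?_
  calc ∑ i ∈ d.support, (f i ^ d i).totalDegree ≤ ∑ i ∈ d.support, d i :=
        Finset.sum_le_sum fun i _ => (MvPolynomial.totalDegree_pow _ _).trans
          (by simpa using Nat.mul_le_mul_left (d i) (hf i))
    _ ≤ w.totalDegree := MvPolynomial.le_totalDegree hd

theorem totalDegree_affine_le (a b c : ℝ) :
    (MvPolynomial.C a + MvPolynomial.C b * MvPolynomial.X 0
      + MvPolynomial.C c * MvPolynomial.X 1 : MvPolynomial (Fin 2) ℝ).totalDegree ≤ 1 := by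
  have h : ∀ (r : ℝ) (i : Fin 2),
      (MvPolynomial.C r * MvPolynomial.X i : MvPolynomial (Fin 2) ℝ).totalDegree ≤ 1 := fun r i =>
    (MvPolynomial.totalDegree_mul _ _).trans (by simp)
  refine (MvPolynomial.totalDegree_add _ _).trans (max_le ?_ (h _ _))
  exact (MvPolynomial.totalDegree_add _ _).trans (max_le (by simp) (h _ _))

theorem totalDegree_pullback_le (A B C : Plane) (w : MvPolynomial (Fin 2) ℝ) :
    (pullback A B C w).totalDegree ≤ w.totalDegree :=
  totalDegree_bind_le _ (fun _ => totalDegree_affine_le _ _ _) w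

/-- The polynomial `w` along the line through `a` with direction `d`. -/
def onLine (a d : Plane) (w : MvPolynomial (Fin 2) ℝ) : Polynomial ℝ :=
  MvPolynomial.aeval (fun i => Polynomial.C (a i) + Polynomial.C (d i) * Polynomial.X) w

theorem eval_onLine (a d : Plane) (w : MvPolynomial (Fin 2) ℝ) (s : ℝ) :
    (onLine a d w).eval s = pval w (a + s • d) := by
  unfold onLine pval
  rw [← Polynomial.coe_evalRingHom, MvPolynomial.aeval_def, MvPolynomial.hom_eval₂,
    MvPolynomial.eval, MvPolynomial.coe_eval₂Hom]
  congr 1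
  · exact RingHom.ext fun r => by
      rw [RingHom.comp_apply, Polynomial.algebraMap_eq, Polynomial.coe_evalRingHom,
        Polynomial.eval_C, RingHom.id_apply]
  · ext i
    simp only [Polynomial.coe_evalRingHom, Polynomial.eval_add,
      Polynomial.eval_C, Polynomial.eval_mul, Polynomial.eval_X, PiLp.add_apply, PiLp.smul_apply,
      smul_eq_mul]
    rw [mul_comm s]

theorem natDegree_onLine_le (a d : Plane) {w : MvPolynomial (Fin 2) ℝ} {N : ℕ}
    (hw : w.totalDegree ≤ N) : (onLine a d w).natDegree ≤ N := by
  have := MvPolynomial.aeval_natDegree_le (n := 1) w hw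
    (fun i => Polynomial.C (a i) + Polynomial.C (d i) * Polynomial.X) (fun i => by
      rw [add_comm]; exact Polynomial.natDegree_linear_le)
  simpa [onLine] using this

/-! ### Bubble functions on the reference triangle and the reference interval -/

def bubble (p : ℝ × ℝ) : ℝ := p.1 * p.2 * (1 - p.1 - p.2)

theorem contDiff_bubble {n : WithTop ℕ∞} : ContDiff ℝ n bubble := by
  unfold bubble; fun_prop

/-- Multiplication by a fixed smooth function, followed by differentiation. -/
def fderivMul {V E : Type*} [AddCommGroup V] [Module ℝ V] [NormedAddCommGroup E] [NormedSpace ℝ E]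
    (Ψ : V →ₗ[ℝ] (E → ℝ)) (hΨ : ∀ v, ContDiff ℝ 1 (Ψ v)) : V →ₗ[ℝ] (E → E →L[ℝ] ℝ) where
  toFun v := fderiv ℝ (Ψ v)
  map_add' v w := by
    ext1 x
    rw [map_add]
    exact fderiv_add ((hΨ v).differentiable one_ne_zero x) ((hΨ w).differentiable one_ne_zero x)
  map_smul' r v := by
    ext1 x
    rw [map_smul]
    exact fderiv_const_smul ((hΨ v).differentiable one_ne_zero x) r

/-- With `β = 1` this is the polynomial itself, with `β = bubble` the test function made from it. -/
def rvalLin (N : ℕ) (β : ℝ × ℝ → ℝ) :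
    MvPolynomial.restrictTotalDegree (Fin 2) ℝ N →ₗ[ℝ] (ℝ × ℝ → ℝ) where
  toFun w p := β p * rval w p
  map_add' v w := by
    ext p
    rw [Pi.add_apply, rval, Submodule.coe_add, pval_add, mul_add, rval, rval]
  map_smul' r v := by
    ext p
    rw [Pi.smul_apply, rval, Submodule.coe_smul, pval_smul, RingHom.id_apply, smul_eq_mul,
      mul_left_comm]
    rfl

/-- Norm equivalences for the bubble function of the reference triangle. -/
theorem exists_bubble_bound (N : ℕ) : ∃ C : ℝ, 0 < C ∧ ∀ w : MvPolynomial (Fin 2) ℝ,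
    w.totalDegree ≤ N →
    0 ≤ ∫ p in refTri, bubble p * rval w p ^ 2 ∧
    ∫ p in refTri, rval w p ^ 2 ≤ C * ∫ p in refTri, bubble p * rval w p ^ 2 ∧
    ∫ p in refTri, (bubble p * rval w p) ^ 2 ≤ C * ∫ p in refTri, bubble p * rval w p ^ 2 ∧
    ∫ p in refTri, ‖fderiv ℝ (fun p => bubble p * rval w p) p‖ ^ 2
      ≤ C * ∫ p in refTri, bubble p * rval w p ^ 2 := by
  set Ψ := rvalLin N (fun _ => 1) with hΨ
  set Ψb := rvalLin N bubble with hΨb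
  have c1 : ∀ v, ContDiff ℝ 1 (Ψ v) := fun v => contDiff_const.mul (contDiff_rval _)
  have c2 : ∀ v, ContDiff ℝ 1 (Ψb v) := fun v => contDiff_bubble.mul (contDiff_rval _)
  set Ψd := fderivMul Ψb c2 with hΨd
  have c3 : ∀ v, Continuous (Ψd v) := fun v => (c2 v).continuous_fderiv one_ne_zero
  have hbub : Continuous bubble := (contDiff_bubble (n := 0)).continuous
  have hb0 : ∀ p ∈ refTri, 0 ≤ bubble p := fun p hp =>
    mul_nonneg (mul_nonneg hp.1 hp.2.1) (by linarith [hp.2.2])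
  have hpos : ∀ v, v ≠ 0 → 0 < l2form refTri bubble Ψ v := fun v hv => by
    -- The square lies in the triangle and is a product of infinite sets, on which a polynomial that
    -- vanishes is zero.
    refine l2form_pos (U := Ioo (0 : ℝ) (1 / 2) ×ˢ Ioo (0 : ℝ) (1 / 2)) isCompact_refTri
      (isOpen_Ioo.prod isOpen_Ioo) ?_ hbub hb0 ?_ (fun v => (c1 v).continuous) ?_ hv
    · rintro ⟨s, t⟩ ⟨⟨h1, h2⟩, h3, h4⟩
      simp only at h1 h2 h3 h4
      exact ⟨h1.le, h3.le, by simp only; linarith⟩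
    · rintro ⟨s, t⟩ ⟨⟨h1, h2⟩, h3, h4⟩
      simp only at h1 h2 h3 h4
      have : 0 < 1 - s - t := by linarith
      simp only [bubble]; positivity
    · intro w hw
      ext1
      refine MvPolynomial.funext_set (fun _ => Ioo (0 : ℝ) (1 / 2))
        (fun _ => Ioo_infinite (by norm_num)) fun x hx => ?_
      have := hw (x 0, x 1) ⟨hx 0 (mem_univ _), hx 1 (mem_univ _)⟩
      simp only [hΨ, rvalLin, LinearMap.coe_mk, AddHom.coe_mk, one_mul, rval, pval] at this
      simp only [ZeroMemClass.coe_zero, map_zero]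
      convert this using 2
      congr 1
      ext i; fin_cases i <;> simp
  have key : ∀ {F : Type} [NormedAddCommGroup F] [NormedSpace ℝ F]
      (Φ : MvPolynomial.restrictTotalDegree (Fin 2) ℝ N →ₗ[ℝ] (ℝ × ℝ → F)),
      (∀ v, Continuous (Φ v)) → ∃ C : ℝ, 0 < C ∧ ∀ v,
        l2form refTri (fun _ => 1) Φ v ≤ C * l2form refTri bubble Ψ v := fun Φ hΦ =>
    exists_form_le (continuous_l2form isCompact_refTri hbub fun v => (c1 v).continuous)
      (continuous_l2form isCompact_refTri continuous_const hΦ)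
      (l2form_smul _ _ _) (l2form_smul _ _ _) hpos
  obtain ⟨C1, hC1, h1⟩ := key Ψ fun v => (c1 v).continuous
  obtain ⟨C2, hC2, h2⟩ := key Ψb fun v => (c2 v).continuous
  obtain ⟨C3, hC3, h3⟩ := key Ψd c3
  -- The sum serves as a common constant for all the forms, since the bounding form is nonnegative.
  refine ⟨C1 + C2 + C3, by positivity, fun w hw => ?_⟩
  set v : MvPolynomial.restrictTotalDegree (Fin 2) ℝ N :=
    ⟨w, (MvPolynomial.mem_restrictTotalDegree _ _ _).2 hw⟩
  have h1 := h1 v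
  have h2 := h2 v
  have h3 := h3 v
  have ea : l2form refTri bubble Ψ v = ∫ p in refTri, bubble p * rval w p ^ 2 := by
    simp [l2form, hΨ, rvalLin, v]
  have e1 : l2form refTri (fun _ => 1) Ψ v = ∫ p in refTri, rval w p ^ 2 := by
    simp [l2form, hΨ, rvalLin, v]
  have e2 : l2form refTri (fun _ => 1) Ψb v = ∫ p in refTri, (bubble p * rval w p) ^ 2 := by
    simp [l2form, hΨb, rvalLin, v, mul_pow]
  have e3 : l2form refTri (fun _ => 1) Ψd v =
      ∫ p in refTri, ‖fderiv ℝ (fun p => bubble p * rval w p) p‖ ^ 2 := by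
    simp [l2form, hΨd, fderivMul, hΨb, rvalLin, v]
  rw [ea] at h1 h2 h3
  rw [e1] at h1
  rw [e2] at h2
  rw [e3] at h3
  have hnn : 0 ≤ ∫ p in refTri, bubble p * rval w p ^ 2 :=
    setIntegral_nonneg isClosed_refTri.measurableSet fun p hp => mul_nonneg (hb0 p hp) (sq_nonneg _)
  exact ⟨hnn, h1.trans (mul_le_mul_of_nonneg_right (by linarith) hnn),
    h2.trans (mul_le_mul_of_nonneg_right (by linarith) hnn),
    h3.trans (mul_le_mul_of_nonneg_right (by linarith) hnn)⟩

/-- The map `σ` is the identity for functions on the interval and the first projection for their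
extension to the triangle. -/
def evalLin (N : ℕ) {E : Type*} (β : E → ℝ) (σ : E → ℝ) :
    Polynomial.degreeLT ℝ (N + 1) →ₗ[ℝ] (E → ℝ) where
  toFun w p := β p * (w : Polynomial ℝ).eval (σ p)
  map_add' v w := by ext p; simp; ring
  map_smul' r v := by ext p; simp; ring

theorem contDiff_eval (w : Polynomial ℝ) {n : WithTop ℕ∞} :
    ContDiff ℝ n fun s : ℝ => w.eval s := by
  simpa using w.contDiff_aeval (𝕜 := ℝ) n

/-- The extension of an edge polynomial to the reference triangle, times the edge bubble. -/
def edgeBubble (w : Polynomial ℝ) (p : ℝ × ℝ) : ℝ := p.1 * (1 - p.1 - p.2) * w.eval p.1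

theorem contDiff_edgeBubble (w : Polynomial ℝ) {n : WithTop ℕ∞} :
    ContDiff ℝ n (edgeBubble w) := by
  have := (contDiff_eval w (n := n)).comp (contDiff_fst (E := ℝ) (F := ℝ))
  simp only [Function.comp_def] at this
  unfold edgeBubble
  exact ContDiff.mul (by fun_prop) this

theorem contDiff_polyMul (w : Polynomial ℝ) {n : WithTop ℕ∞} :
    ContDiff ℝ n (fun s : ℝ => s * (1 - s) * w.eval s) :=
  ContDiff.mul (by fun_prop) (contDiff_eval w)

set_option maxHeartbeats 800000 in
/-- Norm equivalences for the bubble function of the reference interval. -/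
theorem exists_edgeBubble_bound (N : ℕ) : ∃ C : ℝ, 0 < C ∧ ∀ w : Polynomial ℝ, w.natDegree ≤ N →
    0 ≤ ∫ s in (0 : ℝ)..1, s * (1 - s) * w.eval s ^ 2 ∧
    ∫ s in (0 : ℝ)..1, w.eval s ^ 2 ≤ C * ∫ s in (0 : ℝ)..1, s * (1 - s) * w.eval s ^ 2 ∧
    ∫ s in (0 : ℝ)..1, (s * (1 - s) * w.eval s) ^ 2
      ≤ C * ∫ s in (0 : ℝ)..1, s * (1 - s) * w.eval s ^ 2 ∧
    ∫ s in (0 : ℝ)..1, deriv (fun s => s * (1 - s) * w.eval s) s ^ 2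
      ≤ C * ∫ s in (0 : ℝ)..1, s * (1 - s) * w.eval s ^ 2 ∧
    ∫ p in refTri, edgeBubble w p ^ 2 ≤ C * ∫ s in (0 : ℝ)..1, s * (1 - s) * w.eval s ^ 2 ∧
    ∫ p in refTri, ‖fderiv ℝ (edgeBubble w) p‖ ^ 2
      ≤ C * ∫ s in (0 : ℝ)..1, s * (1 - s) * w.eval s ^ 2 := by
  set κ : ℝ → ℝ := fun s => s * (1 - s) with hκ
  set Ψ := evalLin N (fun _ : ℝ => 1) id with hΨ
  set Ψb := evalLin N κ id with hΨb
  set Ψe := evalLin N (fun p : ℝ × ℝ => p.1 * (1 - p.1 - p.2)) Prod.fst with hΨe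
  have c1 : ∀ v, ContDiff ℝ 1 (Ψ v) := fun v => contDiff_const.mul (contDiff_eval _)
  have c2 : ∀ v, ContDiff ℝ 1 (Ψb v) := fun v => contDiff_polyMul _
  have c4 : ∀ v, ContDiff ℝ 1 (Ψe v) := fun v => contDiff_edgeBubble _
  set Ψd := fderivMul Ψb c2 with hΨd
  set Ψf := fderivMul Ψe c4 with hΨf
  have c3 : ∀ v, Continuous (Ψd v) := fun v => (c2 v).continuous_fderiv one_ne_zero
  have c5 : ∀ v, Continuous (Ψf v) := fun v => (c4 v).continuous_fderiv one_ne_zero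
  have hκc : Continuous κ := by fun_prop
  have hκ0 : ∀ p ∈ Icc (0 : ℝ) 1, 0 ≤ κ p := fun p hp =>
    mul_nonneg hp.1 (by linarith [hp.2])
  have hpos : ∀ v, v ≠ 0 → 0 < l2form (Icc (0 : ℝ) 1) κ Ψ v := fun v hv => by
    refine l2form_pos (U := Ioo (0 : ℝ) 1) isCompact_Icc isOpen_Ioo Ioo_subset_Icc_self hκc hκ0
      (fun s hs => mul_pos hs.1 (by linarith [hs.2])) (fun v => (c1 v).continuous) ?_ hv
    intro w hw
    ext1
    refine Polynomial.eq_zero_of_infinite_isRoot _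
      ((Ioo_infinite (zero_lt_one (α := ℝ))).mono fun s hs => ?_)
    simpa [hΨ, evalLin] using hw s hs
  -- The bounding form is always the weighted one on the interval; the bounded form may live on the
  -- interval or on the triangle, which is how edge polynomials control their extensions.
  have key : ∀ {X F : Type} [MeasureSpace X] [TopologicalSpace X] [OpensMeasurableSpace X]
      [IsLocallyFiniteMeasure (volume : Measure X)] [NormedAddCommGroup F] [NormedSpace ℝ F]
      (K : Set X) (_ : IsCompact K)
      (Φ : Polynomial.degreeLT ℝ (N + 1) →ₗ[ℝ] (X → F)),
      (∀ v, Continuous (Φ v)) → ∃ C : ℝ, 0 < C ∧ ∀ v,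
        l2form K (fun _ => 1) Φ v ≤ C * l2form (Icc (0 : ℝ) 1) κ Ψ v := fun K hK Φ hΦ =>
    exists_form_le (continuous_l2form isCompact_Icc hκc fun v => (c1 v).continuous)
      (continuous_l2form hK continuous_const hΦ)
      (l2form_smul _ _ _) (l2form_smul _ _ _) hpos
  obtain ⟨C1, hC1, h1⟩ := key (Icc (0 : ℝ) 1) isCompact_Icc Ψ fun v => (c1 v).continuous
  obtain ⟨C2, hC2, h2⟩ := key (Icc (0 : ℝ) 1) isCompact_Icc Ψb fun v => (c2 v).continuous
  obtain ⟨C3, hC3, h3⟩ := key (Icc (0 : ℝ) 1) isCompact_Icc Ψd c3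
  obtain ⟨C4, hC4, h4⟩ := key refTri isCompact_refTri Ψe fun v => (c4 v).continuous
  obtain ⟨C5, hC5, h5⟩ := key refTri isCompact_refTri Ψf c5
  refine ⟨C1 + C2 + C3 + C4 + C5, by positivity, fun w hw => ?_⟩
  set v : Polynomial.degreeLT ℝ (N + 1) :=
    ⟨w, Polynomial.mem_degreeLT.2 ((Polynomial.degree_le_natDegree).trans_lt
      (by exact_mod_cast Nat.lt_succ_of_le hw))⟩
  have h1 := h1 v
  have h2 := h2 v
  have h3 := h3 v
  have h4 := h4 v
  have h5 := h5 v
  have hI : ∀ g : ℝ → ℝ, ∫ s in (0 : ℝ)..1, g s = ∫ s in Icc (0 : ℝ) 1, g s := fun g => by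
    rw [intervalIntegral.integral_of_le zero_le_one, integral_Icc_eq_integral_Ioc]
  have ea : l2form (Icc (0 : ℝ) 1) κ Ψ v = ∫ s in (0 : ℝ)..1, s * (1 - s) * w.eval s ^ 2 := by
    rw [hI]; simp [l2form, hΨ, evalLin, v, hκ]
  have e1 : l2form (Icc (0 : ℝ) 1) (fun _ => 1) Ψ v = ∫ s in (0 : ℝ)..1, w.eval s ^ 2 := by
    rw [hI]; simp [l2form, hΨ, evalLin, v]
  have e2 : l2form (Icc (0 : ℝ) 1) (fun _ => 1) Ψb v =
      ∫ s in (0 : ℝ)..1, (s * (1 - s) * w.eval s) ^ 2 := by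
    rw [hI]; simp [l2form, hΨb, evalLin, v, hκ, mul_pow]
  have e3 : l2form (Icc (0 : ℝ) 1) (fun _ => 1) Ψd v =
      ∫ s in (0 : ℝ)..1, deriv (fun s => s * (1 - s) * w.eval s) s ^ 2 := by
    rw [hI]
    simp only [l2form, hΨd, fderivMul, hΨb, evalLin, v, hκ, one_mul, LinearMap.coe_mk,
      AddHom.coe_mk, id, ← norm_deriv_eq_norm_fderiv, Real.norm_eq_abs, sq_abs]
  have e4 : l2form refTri (fun _ => 1) Ψe v = ∫ p in refTri, edgeBubble w p ^ 2 := by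
    simp [l2form, hΨe, evalLin, v, edgeBubble, mul_pow]
  have e5 : l2form refTri (fun _ => 1) Ψf v =
      ∫ p in refTri, ‖fderiv ℝ (edgeBubble w) p‖ ^ 2 := by
    simp only [l2form, hΨf, fderivMul, hΨe, evalLin, v, one_mul, LinearMap.coe_mk, AddHom.coe_mk]
    rfl
  rw [ea] at h1 h2 h3 h4 h5
  rw [e1] at h1
  rw [e2] at h2
  rw [e3] at h3
  rw [e4] at h4
  rw [e5] at h5
  have hnn : 0 ≤ ∫ s in (0 : ℝ)..1, s * (1 - s) * w.eval s ^ 2 :=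
    intervalIntegral.integral_nonneg zero_le_one fun s hs => mul_nonneg (hκ0 s hs) (sq_nonneg _)
  exact ⟨hnn, h1.trans (mul_le_mul_of_nonneg_right (by linarith) hnn),
    h2.trans (mul_le_mul_of_nonneg_right (by linarith) hnn),
    h3.trans (mul_le_mul_of_nonneg_right (by linarith) hnn),
    h4.trans (mul_le_mul_of_nonneg_right (by linarith) hnn),
    h5.trans (mul_le_mul_of_nonneg_right (by linarith) hnn)⟩

/-! ### Geometry of the mesh -/

namespace Mesh

variable {D : FracturedDomain} (M : Mesh D)

/-- Twice the area of a triangle of the mesh. -/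
def area (τ : M.Tri) : ℝ := area2 (src τ) (tgt τ) (ctr τ)

theorem area_pos (τ : M.Tri) : 0 < M.area τ := by
  have h := M.ccw τ
  have : M.area τ = cross (src τ - ctr τ) (tgt τ - ctr τ) := by
    simp [area, area2, cross]; ring
  rwa [this]

theorem isCompact_tri (τ : M.Tri) : IsCompact (tri τ) := by
  have h := convexHull_eq_image (src τ) (tgt τ) (ctr τ)
  unfold tri
  rw [h]
  exact isCompact_refTri.image (continuous_aff _ _ _)

theorem convex_tri (τ : M.Tri) : Convex ℝ (tri τ) := convex_convexHull _ _

theorem measurableSet_tri (τ : M.Tri) : MeasurableSet (tri τ) := (M.isCompact_tri τ).measurableSet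

theorem mem_tri_iff (τ : M.Tri) (x : Plane) :
    x ∈ tri τ ↔ co (src τ) (tgt τ) (ctr τ) x ∈ refTri :=
  mem_convexHull_iff (M.area_pos τ).ne' x

theorem interior_tri_nonempty (τ : M.Tri) : (interior (tri τ)).Nonempty := by
  refine ⟨aff (src τ) (tgt τ) (ctr τ) (1 / 4, 1 / 4), ?_⟩
  apply mem_interior_convexHull (M.area_pos τ).ne' <;> rw [co_aff (M.area_pos τ).ne'] <;> norm_num

theorem closure_interior_tri (τ : M.Tri) : closure (interior (tri τ)) = tri τ := by
  rw [(M.convex_tri τ).closure_interior_eq_closure_of_nonempty_interior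
    (M.interior_tri_nonempty τ), (M.isCompact_tri τ).isClosed.closure_eq]

theorem interior_tri_ae (τ : M.Tri) : (interior (tri τ) : Set Plane) =ᵐ[volume] tri τ :=
  interior_ae_eq_of_null_frontier ((M.convex_tri τ).addHaar_frontier volume)

theorem src_mem_tri (τ : M.Tri) : src τ ∈ tri τ := subset_convexHull _ _ (by simp)
theorem tgt_mem_tri (τ : M.Tri) : tgt τ ∈ tri τ := subset_convexHull _ _ (by simp)
theorem ctr_mem_tri (τ : M.Tri) : ctr τ ∈ tri τ := subset_convexHull _ _ (by simp)

theorem tri_subset_elem (τ : M.Tri) : tri τ ⊆ M.elem τ.1 :=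
  subset_iUnion (fun j => tri (P := M.toPolygons) ⟨τ.1, j⟩) τ.2

theorem isCompact_elem (T : Fin M.nEl) : IsCompact (M.elem T) :=
  isCompact_iUnion fun j => M.isCompact_tri ⟨T, j⟩

theorem interior_tri_subset (τ : M.Tri) : interior (tri τ) ⊆ D.Ωb (M.sub τ.1) :=
  (interior_mono (M.tri_subset_elem τ)).trans (M.fitted τ.1)

theorem sub_subset (i : Fin 2) : D.Ωb i ⊆ D.Ω \ D.γ '' Icc 0 D.L := by
  rw [← D.sub_union]
  fin_cases i
  · exact subset_union_left
  · exact subset_union_right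

theorem disjoint_sub {i j : Fin 2} (h : i ≠ j) : Disjoint (D.Ωb i) (D.Ωb j) := by
  have := D.sub_disjoint
  fin_cases i <;> fin_cases j <;> simp at h ⊢
  · exact this
  · exact this.symm

/-- A triangle is determined by its oriented outer edge. -/
theorem eq_of_outer_eq {τ τ' : M.Tri} (h1 : src τ = src τ') (h2 : tgt τ = tgt τ') : τ = τ' := by
  by_contra hne
  have hdis := M.disjoint_tri hne
  have hA := M.area_pos τ
  have hA' := M.area_pos τ'
  -- Points just above the midpoint of the common edge. For small `ε` they are interior to both
  -- triangles, because both lie to the left of the oriented edge.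
  set φ : ℝ → Plane := fun ε => aff (src τ) (tgt τ) (ctr τ) (1 / 2, ε) with hφ
  have hφc : Continuous φ := (continuous_aff _ _ _).comp (by fun_prop)
  have hc : Continuous fun ε => (co (src τ') (tgt τ') (ctr τ') (φ ε)).1 :=
    ((continuous_co _ _ _).comp hφc).fst
  have hc2 : Continuous fun ε => (co (src τ') (tgt τ') (ctr τ') (φ ε)).1
      + (co (src τ') (tgt τ') (ctr τ') (φ ε)).2 := hc.add ((continuous_co _ _ _).comp hφc).snd
  have h0 : co (src τ') (tgt τ') (ctr τ') (φ 0) = (1 / 2, 0) := by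
    have : φ 0 = aff (src τ') (tgt τ') (ctr τ') (1 / 2, 0) := by
      simp only [hφ, aff, h1, h2]; simp
    rw [this, co_aff hA'.ne']
  have e1 : ∀ᶠ ε in nhds (0 : ℝ), 0 < (co (src τ') (tgt τ') (ctr τ') (φ ε)).1 :=
    (hc.tendsto 0).eventually (lt_mem_nhds (by rw [h0]; norm_num))
  have e2 : ∀ᶠ ε in nhds (0 : ℝ), (co (src τ') (tgt τ') (ctr τ') (φ ε)).1
      + (co (src τ') (tgt τ') (ctr τ') (φ ε)).2 < 1 :=
    (hc2.tendsto 0).eventually (gt_mem_nhds (by rw [h0]; norm_num))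
  have e3 : ∀ᶠ ε in nhds (0 : ℝ), ε < 1 / 2 := gt_mem_nhds (by norm_num)
  obtain ⟨ε, ⟨⟨k1, k2⟩, k3⟩, k4⟩ := ((((e1.and e2).and e3).filter_mono nhdsWithin_le_nhds).and
    (self_mem_nhdsWithin : Ioi (0 : ℝ) ∈ nhdsWithin 0 (Ioi 0))).exists
  have k4 : 0 < ε := k4
  have i1 : φ ε ∈ interior (tri τ) := by
    apply mem_interior_convexHull hA.ne' <;> rw [hφ, co_aff hA.ne'] <;> simp <;> linarith
  have i2 : φ ε ∈ interior (tri τ') := by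
    refine mem_interior_convexHull hA'.ne' k1 ?_ k2
    -- The second coordinate is the distance from the edge divided by the height of the triangle.
    -- The edge is common, so the heights are in the ratio of the areas.
    have : (co (src τ') (tgt τ') (ctr τ') (φ ε)).2 = ε * M.area τ / M.area τ' := by
      simp only [co, area, ← h1, ← h2]
      congr 1
      simp [hφ, aff, area2, cross]; ring
    rw [this]; positivity
  exact Set.disjoint_left.1 hdis i1 i2

theorem mem_intEdges_iff {τ τ' : M.Tri} (h : (τ, τ') ∈ M.intEdges) :
    M.sub τ.1 = M.sub τ'.1 ∧ src τ = tgt τ' ∧ tgt τ = src τ' := (M.mem_intEdges τ τ').1 (Or.inl h)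

theorem node_mem (j : Fin (M.nΓ + 2)) : M.node j ∈ Icc 0 D.L := by
  obtain ⟨hm, h0, h1, -⟩ := M.partition
  rw [mem_Icc, ← h0, ← h1]
  exact ⟨hm.monotone (Fin.zero_le _), hm.monotone (Fin.le_last _)⟩

theorem hFrac_pos (j : Fin (M.nΓ + 1)) : 0 < M.hFrac j :=
  sub_pos.2 (M.partition.1 (Fin.castSucc_lt_succ (i := j)))

theorem node_lt (j : Fin (M.nΓ + 1)) : M.node j.castSucc < M.node j.succ :=
  sub_pos.1 (M.hFrac_pos j)

theorem hFrac_le (j : Fin (M.nΓ + 1)) : M.hFrac j ≤ D.L := by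
  have h1 := (M.node_mem j.succ).2
  have h2 := (M.node_mem j.castSucc).1
  unfold hFrac; linarith

theorem edge_subset (j : Fin (M.nΓ + 1)) :
    Icc (M.node j.castSucc) (M.node j.succ) ⊆ Icc 0 D.L :=
  Icc_subset_Icc (M.node_mem _).1 (M.node_mem _).2

/-- On a fracture edge the arc is affine, with the direction `d`. -/
theorem exists_direction (j : Fin (M.nΓ + 1)) : ∃ d : Plane, ‖d‖ = 1 ∧
    (∀ s ∈ Icc (M.node j.castSucc) (M.node j.succ),
      D.γ s = D.γ (M.node j.castSucc) + (s - M.node j.castSucc) • d) ∧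
    D.γ (M.node j.succ) - D.γ (M.node j.castSucc) = M.hFrac j • d ∧
    ∀ s ∈ Ioo (M.node j.castSucc) (M.node j.succ), D.normal s = rotcw d := by
  obtain ⟨d, hd, h⟩ := M.partition.2.2.2 j
  refine ⟨d, hd, h, ?_, fun s hs => ?_⟩
  · rw [h _ ⟨(M.node_lt j).le, le_rfl⟩, add_sub_cancel_left, hFrac]
  · have : HasDerivAt (fun s => D.γ (M.node j.castSucc) + (s - M.node j.castSucc) • d) d s := by
      simpa using (((hasDerivAt_id s).sub_const (M.node j.castSucc)).smul_const d).const_add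
        (D.γ (M.node j.castSucc))
    have h2 : HasDerivAt D.γ d s := this.congr_of_eventuallyEq (by
      filter_upwards [isOpen_Ioo.mem_nhds hs] with t ht
      exact h t (Ioo_subset_Icc_self ht))
    rw [FracturedDomain.normal, h2.deriv]

theorem lineMap_frac (j : Fin (M.nΓ + 1)) {t : ℝ} (ht : t ∈ Icc (0 : ℝ) 1) :
    AffineMap.lineMap (D.γ (M.node j.castSucc)) (D.γ (M.node j.succ)) t =
      D.γ (M.node j.castSucc + M.hFrac j * t) := by
  obtain ⟨d, -, h1, h2, -⟩ := M.exists_direction j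
  have hp := M.hFrac_pos j
  have he : M.node j.succ = M.node j.castSucc + M.hFrac j := by simp [hFrac]
  rw [AffineMap.lineMap_apply, vsub_eq_sub, h2, h1 (M.node j.castSucc + M.hFrac j * t)
    ⟨by nlinarith [ht.1], by rw [he]; nlinarith [ht.2]⟩, vadd_eq_add, smul_smul, add_comm,
    add_sub_cancel_left (M.node j.castSucc), mul_comm]

theorem segment_frac_subset (j : Fin (M.nΓ + 1)) :
    segment ℝ (D.γ (M.node j.castSucc)) (D.γ (M.node j.succ)) ⊆ D.γ '' Icc 0 D.L := by
  intro x hx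
  rw [segment_eq_image_lineMap] at hx
  obtain ⟨t, ht, rfl⟩ := hx
  rw [M.lineMap_frac j ht]
  refine ⟨_, M.edge_subset j ?_, rfl⟩
  have hp := M.hFrac_pos j
  have : M.node j.succ = M.node j.castSucc + M.hFrac j := by simp [hFrac]
  exact ⟨by nlinarith [ht.1], by rw [this]; nlinarith [ht.2]⟩

theorem outer_frac_subset (i : Fin 2) (j : Fin (M.nΓ + 1)) :
    outer (M.fracTri i j) ⊆ D.γ '' Icc 0 D.L := by
  fin_cases i
  · have h := M.fracTri_zero j
    simp only [outer, Fin.zero_eta, h]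
    exact M.segment_frac_subset j
  · have h := M.fracTri_one j
    simp only [outer, Fin.mk_one, h]
    rw [segment_symm]
    exact M.segment_frac_subset j

theorem outerLen_frac (i : Fin 2) (j : Fin (M.nΓ + 1)) : outerLen (M.fracTri i j) = M.hFrac j := by
  obtain ⟨d, hd, -, h2, -⟩ := M.exists_direction j
  have key : dist (D.γ (M.node j.castSucc)) (D.γ (M.node j.succ)) = M.hFrac j := by
    rw [dist_comm, dist_eq_norm, h2, norm_smul, hd, mul_one, Real.norm_of_nonneg (M.hFrac_pos j).le]
  fin_cases i
  · simp only [outerLen, Fin.zero_eta, M.fracTri_zero j, key]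
  · simp only [outerLen, Fin.mk_one, M.fracTri_one j]
    rw [dist_comm, key]

theorem node_injective {i j : Fin (M.nΓ + 2)} (h : D.γ (M.node i) = D.γ (M.node j)) : i = j :=
  M.partition.1.injective (D.injOn (M.node_mem i) (M.node_mem j) h)

theorem fracTri_injective {i : Fin 2} {j j' : Fin (M.nΓ + 1)}
    (h : M.fracTri i j = M.fracTri i j') : j = j' := by
  fin_cases i
  · have h1 := (M.fracTri_zero j).1
    have h2 := (M.fracTri_zero j').1
    simp only [Fin.zero_eta] at h
    rw [h, h2] at h1
    exact (Fin.castSucc_injective _ (M.node_injective h1)).symm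
  · have h1 := (M.fracTri_one j).1
    have h2 := (M.fracTri_one j').1
    simp only [Fin.mk_one] at h
    rw [h, h2] at h1
    exact (Fin.succ_injective _ (M.node_injective h1)).symm

/-- A neighbour of a fracture triangle across its outer edge has the oriented edge of the opposite
fracture triangle, and therefore is that triangle. But it lies in the other subdomain, whereas the
two members of `intEdges` lie in the same one. -/
theorem fracTri_ne_of_intEdges {τ τ' : M.Tri} (h : (τ, τ') ∈ M.intEdges ∨ (τ', τ) ∈ M.intEdges)
    (i : Fin 2) (j : Fin (M.nΓ + 1)) : τ ≠ M.fracTri i j := by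
  rintro rfl
  obtain ⟨h1, h2, h3⟩ := (M.mem_intEdges _ _).1 h
  fin_cases i
  · obtain ⟨k1, k2⟩ := M.fracTri_zero j
    obtain ⟨l1, l2⟩ := M.fracTri_one j
    simp only [Fin.zero_eta] at h1 h2 h3
    have : τ' = M.fracTri 1 j := M.eq_of_outer_eq (by rw [← h3, k2, l1]) (by rw [← h2, k1, l2])
    rw [this, M.fracTri_sub, M.fracTri_sub] at h1
    simp at h1
  · obtain ⟨k1, k2⟩ := M.fracTri_zero j
    obtain ⟨l1, l2⟩ := M.fracTri_one j
    simp only [Fin.mk_one] at h1 h2 h3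
    have : τ' = M.fracTri 0 j := M.eq_of_outer_eq (by rw [← h3, l2, k1]) (by rw [← h2, l1, k2])
    rw [this, M.fracTri_sub, M.fracTri_sub] at h1
    simp at h1

theorem outer_subset_tri (τ : M.Tri) : outer τ ⊆ tri τ :=
  (M.convex_tri τ).segment_subset (M.src_mem_tri τ) (M.tgt_mem_tri τ)

theorem disjoint_interior_elem {T : Fin M.nEl} {τ : M.Tri} (h : τ.1 ≠ T) :
    Disjoint (interior (tri τ)) (M.elem T) := by
  rw [Polygons.elem, disjoint_iUnion_right]
  intro j
  have hne : τ ≠ ⟨T, j⟩ := fun h' => h (by rw [h'])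
  rw [← M.closure_interior_tri ⟨T, j⟩]
  exact (M.disjoint_tri hne).closure_right isOpen_interior

/-- An edge of a polygon contains no interior point of the polygon, which is what makes "beyond the
edge" mean "outside". Boundary and fracture edges are excluded from the open subdomain; across a
shared edge lies a triangle of another polygon, whose interior does not meet this one. -/
theorem outer_disjoint_interior_elem (τ : M.Tri) : Disjoint (outer τ) (interior (M.elem τ.1)) := by
  rw [Set.disjoint_left]
  intro x hx hxi
  have hxb := sub_subset _ (M.fitted τ.1 hxi)
  rcases M.edge_cases τ with h | ⟨i, j, rfl⟩ | ⟨τ', h⟩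
  · have := h hx
    rw [D.isOpen.frontier_eq] at this
    exact this.2 hxb.1
  · exact hxb.2 (M.outer_frac_subset i j hx)
  · obtain ⟨-, h2, h3⟩ := (M.mem_intEdges _ _).1 h
    -- A neighbour in the same polygon would share the centre as well, and then the reversed edge
    -- would contradict the counterclockwise orientation.
    by_cases hT : τ'.1 = τ.1
    · have a1 := M.ccw τ
      have a2 := M.ccw τ'
      rw [← h2, ← h3] at a2
      have hc : ctr τ' = ctr τ := by simp only [ctr, hT]
      rw [hc, cross_swap] at a2
      linarith
    · have hx' : x ∈ closure (interior (tri τ')) := by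
        rw [M.closure_interior_tri]
        apply M.outer_subset_tri
        rw [outer, ← h2, ← h3, segment_symm]
        exact hx
      obtain ⟨y, hy1, hy2⟩ := mem_closure_iff.1 hx' _ isOpen_interior hxi
      exact Set.disjoint_left.1 (M.disjoint_interior_elem hT) hy2 (interior_subset hy1)

/-- No point of a polygon from which it is star-shaped lies beyond an edge. -/
theorem co_nonneg_of_starConvex (τ : M.Tri) {y : Plane} (hy : StarConvex ℝ y (M.elem τ.1)) :
    0 ≤ (co (src τ) (tgt τ) (ctr τ) y).2 := by
  by_contra! hlt
  set A := src τ
  set B := tgt τ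
  set C := ctr τ
  have hA : area2 A B C ≠ 0 := (M.area_pos τ).ne'
  set t0 := (co A B C y).2 with ht0
  set m := aff A B C (1 / 2, 0) with hm
  have hcm : co A B C m = (1 / 2, 0) := co_aff hA _
  have hmo : m ∈ outer τ := by
    rw [outer, segment_eq_image_lineMap]
    refine ⟨1 / 2, by norm_num, ?_⟩
    simp only [hm, aff, AffineMap.lineMap_apply]
    simp [A, B, add_comm]
  refine Set.disjoint_left.1 (M.outer_disjoint_interior_elem τ) hmo ?_
  rw [mem_interior_iff_mem_nhds]
  -- The line from `y` through `z` meets the line of the edge at `y + l z • (z - y)`, whose first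
  -- coordinate is `s z`. If `y` were beyond the edge, the segments from `y` to points of the edge
  -- would fill the far side of a neighbourhood of its midpoint `m`, and the triangle fills the near
  -- side; so `m` would be interior to the polygon.
  set l : Plane → ℝ := fun z => t0 / (t0 - (co A B C z).2) with hl
  set s : Plane → ℝ := fun z =>
    (co A B C y).1 + l z * ((co A B C z).1 - (co A B C y).1) with hs
  have c1 : Continuous fun z => (co A B C z).1 := (continuous_co A B C).fst
  have c2 : Continuous fun z => (co A B C z).2 := (continuous_co A B C).snd
  have cl : ContinuousAt l m := by
    refine continuousAt_const.div (continuousAt_const.sub c2.continuousAt) ?_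
    rw [hcm]; simp only [sub_zero]; exact hlt.ne
  have hlm : l m = 1 := by simp only [hl, hcm, sub_zero]; exact div_self hlt.ne
  have cs : ContinuousAt s m := continuousAt_const.add (cl.mul (c1.continuousAt.sub continuousAt_const))
  have hsm : s m = 1 / 2 := by simp only [hs, hlm, hcm]; ring
  have e1 : ∀ᶠ z in nhds m, 0 < s z := cs.eventually (lt_mem_nhds (by rw [hsm]; norm_num))
  have e2 : ∀ᶠ z in nhds m, s z < 1 := cs.eventually (gt_mem_nhds (by rw [hsm]; norm_num))
  have e3 : ∀ᶠ z in nhds m, 0 < (co A B C z).1 :=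
    (c1.tendsto m).eventually (lt_mem_nhds (by rw [hcm]; norm_num))
  have e4 : ∀ᶠ z in nhds m, (co A B C z).1 + (co A B C z).2 < 1 :=
    ((c1.add c2).tendsto m).eventually (gt_mem_nhds (by rw [Pi.add_apply, hcm]; norm_num))
  have e5 : ∀ᶠ z in nhds m, t0 < (co A B C z).2 :=
    (c2.tendsto m).eventually (lt_mem_nhds (by rw [hcm]; exact hlt))
  filter_upwards [e1, e2, e3, e4, e5] with z z1 z2 z3 z4 z5
  by_cases hz : 0 ≤ (co A B C z).2
  · exact M.tri_subset_elem τ ((M.mem_tri_iff τ z).2 ⟨z3.le, hz, z4.le⟩)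
  push Not at hz
  set x := aff A B C (s z, 0) with hx
  have hxt : x ∈ M.elem τ.1 := by
    refine M.tri_subset_elem τ ((M.mem_tri_iff τ x).2 ?_)
    rw [hx, co_aff hA]
    exact ⟨z1.le, le_rfl, by simp only; linarith⟩
  have hd : t0 - (co A B C z).2 < 0 := by linarith
  have hlz : 0 < l z := div_pos_of_neg_of_neg hlt hd
  have hl1 : 1 ≤ l z := by
    simp only [hl]
    rw [one_le_div_of_neg hd]; linarith
  have hzeq : z = (1 - (l z)⁻¹) • y + (l z)⁻¹ • x := by
    have e0 : (co A B C z).2 = (1 - (l z)⁻¹) * t0 := by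
      simp only [hl, inv_div]
      rw [sub_mul, one_mul, div_mul_cancel₀ _ hlt.ne]
      ring
    have e1' : (co A B C z).1 = (1 - (l z)⁻¹) * (co A B C y).1 + (l z)⁻¹ * s z := by
      simp only [hs]; field_simp; ring
    have ez := aff_co hA z
    have ey := aff_co hA y
    generalize (l z)⁻¹ = κ at e0 e1' ⊢
    rw [← ez, show (1 - κ) • y = (1 - κ) • aff A B C (co A B C y) by rw [ey]]
    rw [Plane.ext_iff_coord]
    constructor <;>
    · simp only [aff, PiLp.add_apply, PiLp.smul_apply, PiLp.sub_apply, smul_eq_mul, hx, e0, e1']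
      rw [← ht0]
      ring
  rw [hzeq]
  exact hy hxt (by rw [sub_nonneg]; exact inv_le_one_of_one_le₀ hl1) (by positivity) (by ring)

/-! ### Shape regularity -/

variable {M}

theorem dist_le_diam_tri {τ : M.Tri} {x y : Plane} (hx : x ∈ tri τ) (hy : y ∈ tri τ) :
    ‖x - y‖ ≤ M.hTri τ := by
  rw [← dist_eq_norm]
  exact Metric.dist_le_diam_of_mem (M.isCompact_tri τ).isBounded hx hy

theorem hTri_le_diam (τ : M.Tri) : M.hTri τ ≤ Metric.diam (M.elem τ.1) :=
  Metric.diam_mono (M.tri_subset_elem τ) (M.isCompact_elem τ.1).isBounded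

theorem outerLen_le (τ : M.Tri) : outerLen τ ≤ M.hTri τ := by
  rw [outerLen, dist_eq_norm]; exact dist_le_diam_tri (M.src_mem_tri τ) (M.tgt_mem_tri τ)

theorem outerLen_pos (τ : M.Tri) : 0 < outerLen τ := by
  rw [outerLen, dist_pos]
  intro h
  have := M.area_pos τ
  rw [area, area2, h] at this
  simp [cross] at this

theorem hTri_pos (τ : M.Tri) : 0 < M.hTri τ := (outerLen_pos τ).trans_le (outerLen_le τ)

theorem area_le (τ : M.Tri) : M.area τ ≤ M.hTri τ ^ 2 := by
  rw [sq]
  refine (le_abs_self _).trans ((abs_cross_le _ _).trans ?_)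
  exact mul_le_mul (dist_le_diam_tri (M.tgt_mem_tri τ) (M.src_mem_tri τ))
    (dist_le_diam_tri (M.ctr_mem_tri τ) (M.src_mem_tri τ)) (norm_nonneg _) (hTri_pos τ).le

/-- Shape regularity of the triangulation. -/
theorem StarShaped.le_area {ρS ρE : ℝ} (hS : M.StarShaped ρS) (hE : M.EdgesComparable ρE)
    (hρS : 0 < ρS) (τ : M.Tri) :
    ρS * ρE * Metric.diam (M.elem τ.1) ^ 2 ≤ M.area τ := by
  set h := Metric.diam (M.elem τ.1)
  set a := tgt τ - src τ with ha
  have hh : 0 < h := (hTri_pos τ).trans_le (hTri_le_diam τ)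
  have hal : ‖a‖ = outerLen τ := by rw [outerLen, dist_comm, dist_eq_norm]
  have hap : 0 < ‖a‖ := by rw [hal]; exact outerLen_pos τ
  -- The height of the centre over the edge is at least the radius of the ball of star centres.
  -- Otherwise, for a radius `r` between the two, the point at distance `r` from the centre in the
  -- direction of the outward normal is a star centre beyond the edge.
  have key : ρS * h * ‖a‖ ≤ M.area τ := by
    by_contra! hlt
    obtain ⟨r, hr1, hr2⟩ : ∃ r, M.area τ / ‖a‖ < r ∧ r < ρS * h :=
      exists_between (by rwa [div_lt_iff₀ hap])
    have hr0 : 0 < r := (div_pos (M.area_pos τ) hap).trans hr1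
    set y := ctr τ + (r / ‖a‖) • rotcw a with hy
    have hyb : y ∈ Metric.ball (M.center τ.1) (ρS * h) := by
      rw [mem_ball_iff_norm]
      have : y - M.center τ.1 = (r / ‖a‖) • rotcw a := by simp [hy, ctr]
      rw [this, norm_smul, norm_rotcw, Real.norm_of_nonneg (by positivity), div_mul_cancel₀ _ hap.ne']
      exact hr2
    have hn := M.co_nonneg_of_starConvex τ (hS τ.1 y hyb)
    have hco : (co (src τ) (tgt τ) (ctr τ) y).2 = (M.area τ - r * ‖a‖) / M.area τ := by
      have h1 : cross a (y - src τ) = M.area τ - r * ‖a‖ := by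
        have h2 : cross a (rotcw a) = -‖a‖ ^ 2 := by
          rw [plane_norm_sq]; simp [cross]; ring
        have h3 : cross a (y - src τ) = M.area τ + (r / ‖a‖) * cross a (rotcw a) := by
          simp [area, area2, hy, cross, ha]; ring
        rw [h3, h2]; field_simp; ring
      simp only [co]
      rw [← ha, h1]; rfl
    rw [hco, le_div_iff₀ (M.area_pos τ), zero_mul] at hn
    rw [div_lt_iff₀ hap] at hr1
    linarith
  refine le_trans ?_ key
  have := hE τ
  rw [hal]
  calc ρS * ρE * h ^ 2 = ρS * h * (ρE * h) := by ring
    _ ≤ _ := mul_le_mul_of_nonneg_left this (by positivity)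

/-! ### Sums over the edges of the polygons -/

variable (M)

/-- The sum over all outer edges, in terms of the interior edges and the fracture edges. -/
theorem sum_intEdges_add_frac (Φ : M.Tri → ℝ) :
    ∃ S : Finset M.Tri, (∀ τ ∉ S, outer τ ⊆ frontier D.Ω) ∧
      (∑ e ∈ M.intEdges, (Φ e.1 + Φ e.2)) + ∑ j, (Φ (M.fracTri 0 j) + Φ (M.fracTri 1 j)) =
        ∑ τ ∈ S, Φ τ := by
  classical
  -- First and second members of the interior pairs, and the fracture triangles of either side: four
  -- disjoint sets, outside of which the outer edge lies on the boundary.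
  set I1 := M.intEdges.image Prod.fst
  set I2 := M.intEdges.image Prod.snd
  set F0 := Finset.univ.image (M.fracTri 0)
  set F1 := Finset.univ.image (M.fracTri 1)
  have m1 : ∀ τ, τ ∈ I1 ↔ ∃ τ', (τ, τ') ∈ M.intEdges := by simp [I1]
  have m2 : ∀ τ, τ ∈ I2 ↔ ∃ τ', (τ', τ) ∈ M.intEdges := by simp [I2]
  have m3 : ∀ τ, τ ∈ F0 ↔ ∃ j, M.fracTri 0 j = τ := by simp [F0]
  have m4 : ∀ τ, τ ∈ F1 ↔ ∃ j, M.fracTri 1 j = τ := by simp [F1]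
  -- A triangle has only one neighbour across its outer edge, since the neighbour is determined by
  -- the reversed edge. This gives the injectivity of both projections of `intEdges` and, with
  -- `intEdges_once`, the disjointness of their images.
  have uniq : ∀ {τ τ' τ'' : M.Tri}, ((τ, τ') ∈ M.intEdges ∨ (τ', τ) ∈ M.intEdges) →
      ((τ, τ'') ∈ M.intEdges ∨ (τ'', τ) ∈ M.intEdges) → τ' = τ'' := fun h h' => by
    obtain ⟨-, a1, a2⟩ := (M.mem_intEdges _ _).1 h
    obtain ⟨-, b1, b2⟩ := (M.mem_intEdges _ _).1 h'
    exact M.eq_of_outer_eq (by rw [← a2, ← b2]) (by rw [← a1, ← b1])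
  have d12 : Disjoint I1 I2 := Finset.disjoint_left.2 fun τ h h' => by
    obtain ⟨τ', h⟩ := (m1 τ).1 h
    obtain ⟨τ'', h'⟩ := (m2 τ).1 h'
    obtain rfl := uniq (Or.inl h) (Or.inr h')
    exact M.intEdges_once _ _ h h'
  have dF : Disjoint F0 F1 := Finset.disjoint_left.2 fun τ h h' => by
    obtain ⟨j, rfl⟩ := (m3 τ).1 h
    obtain ⟨j', h'⟩ := (m4 _).1 h'
    have a := M.fracTri_sub 0 j
    rw [← h', M.fracTri_sub] at a
    simp at a
  have dIF : Disjoint (I1 ∪ I2) (F0 ∪ F1) := Finset.disjoint_left.2 fun τ h h' => by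
    have : ∃ τ', (τ, τ') ∈ M.intEdges ∨ (τ', τ) ∈ M.intEdges := by
      rcases Finset.mem_union.1 h with h | h
      · obtain ⟨τ', h⟩ := (m1 τ).1 h; exact ⟨τ', Or.inl h⟩
      · obtain ⟨τ', h⟩ := (m2 τ).1 h; exact ⟨τ', Or.inr h⟩
    obtain ⟨τ', h⟩ := this
    rcases Finset.mem_union.1 h' with h' | h'
    · obtain ⟨j, h'⟩ := (m3 τ).1 h'; exact M.fracTri_ne_of_intEdges h _ _ h'.symm
    · obtain ⟨j, h'⟩ := (m4 τ).1 h'; exact M.fracTri_ne_of_intEdges h _ _ h'.symm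
  refine ⟨(I1 ∪ I2) ∪ (F0 ∪ F1), fun τ hτ => ?_, ?_⟩
  · rcases M.edge_cases τ with h | ⟨i, j, h⟩ | ⟨τ', h⟩
    · exact h
    · refine absurd ?_ hτ
      apply Finset.mem_union_right
      fin_cases i
      · exact Finset.mem_union_left _ ((m3 τ).2 ⟨j, h.symm⟩)
      · exact Finset.mem_union_right _ ((m4 τ).2 ⟨j, h.symm⟩)
    · refine absurd ?_ hτ
      apply Finset.mem_union_left
      rcases h with h | h
      · exact Finset.mem_union_left _ ((m1 τ).2 ⟨τ', h⟩)
      · exact Finset.mem_union_right _ ((m2 τ).2 ⟨τ', h⟩)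
  · rw [Finset.sum_union dIF, Finset.sum_union d12, Finset.sum_union dF, Finset.sum_image,
      Finset.sum_image, Finset.sum_image, Finset.sum_image, Finset.sum_add_distrib,
      Finset.sum_add_distrib]
    · exact fun j _ j' _ h => M.fracTri_injective h
    · exact fun j _ j' _ h => M.fracTri_injective h
    · rintro ⟨a, b⟩ hab ⟨a', b'⟩ hab' h
      simp only at h
      subst h
      rw [uniq (Or.inr hab) (Or.inr hab')]
    · rintro ⟨a, b⟩ hab ⟨a', b'⟩ hab' h
      simp only at h
      subst h
      rw [uniq (Or.inl hab) (Or.inl hab')]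

theorem sum_outer {Φ : M.Tri → ℝ} (h0 : ∀ τ, outer τ ⊆ frontier D.Ω → Φ τ = 0) :
    ∑ τ, Φ τ = (∑ e ∈ M.intEdges, (Φ e.1 + Φ e.2))
      + ∑ j, (Φ (M.fracTri 0 j) + Φ (M.fracTri 1 j)) := by
  obtain ⟨S, hS, h⟩ := M.sum_intEdges_add_frac Φ
  rw [h]
  exact (Finset.sum_subset (Finset.subset_univ S) fun τ _ hτ => h0 τ (hS τ hτ)).symm

theorem sum_intEdges_le {Φ : M.Tri → ℝ} (h0 : ∀ τ, 0 ≤ Φ τ) :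
    ∑ e ∈ M.intEdges, (Φ e.1 + Φ e.2) ≤ ∑ τ, Φ τ := by
  obtain ⟨S, -, h⟩ := M.sum_intEdges_add_frac Φ
  have h1 : ∑ τ ∈ S, Φ τ ≤ ∑ τ, Φ τ :=
    Finset.sum_le_sum_of_subset_of_nonneg (Finset.subset_univ S) fun τ _ _ => h0 τ
  have h2 : 0 ≤ ∑ j, (Φ (M.fracTri 0 j) + Φ (M.fracTri 1 j)) :=
    Finset.sum_nonneg fun j _ => add_nonneg (h0 _) (h0 _)
  linarith

end Mesh

/-! ### Adjacent fracture edges have comparable lengths -/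

/-- A walk that starts in `a` and moves by `f` can stop only in `b`. Closing it up by `f b = a`
makes `f` a permutation of a finite set, so the orbit of `a` returns to `a`, and it does so through
`b`. Up to then every step costs a factor `c`, and there are fewer steps than points. -/
theorem iterate_comparable {X : Type*} [Fintype X] {f : X → X} (hf : Function.Injective f) {a b : X}
    (hb : f b = a) {H : X → ℝ} (hH : ∀ x, 0 < H x) {c : ℝ} (hc : 1 ≤ c)
    (hstep : ∀ x, x ≠ b → H (f x) ≤ c * H x ∧ H x ≤ c * H (f x)) :
    H b ≤ c ^ Fintype.card X * H a ∧ H a ≤ c ^ Fintype.card X * H b := by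
  have hper : a ∈ Function.periodicPts f := by
    set σ : Equiv.Perm X := Equiv.ofBijective f (Finite.injective_iff_bijective.1 hf)
    obtain ⟨n, hn, h⟩ := isOfFinOrder_iff_pow_eq_one.1 (isOfFinOrder_of_finite σ)
    refine ⟨n, hn, ?_⟩
    have h1 : (σ ^ n) a = a := by rw [h]; rfl
    rwa [Equiv.Perm.coe_pow] at h1
  set n := Function.minimalPeriod f a with hn
  have hn0 : 0 < n := Function.minimalPeriod_pos_of_mem_periodicPts hper
  have hcp : 0 < c := by linarith
  have key : ∀ i, i < n → H (f^[i] a) ≤ c ^ i * H a ∧ H a ≤ c ^ i * H (f^[i] a) := by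
    intro i
    induction i with
    | zero => simp
    | succ i ih =>
      intro hi
      obtain ⟨h1, h2⟩ := ih (by omega)
      have hne : f^[i] a ≠ b := fun h => by
        have hp : Function.IsPeriodicPt f (i + 1) a := by
          change f^[i + 1] a = a
          rw [Function.iterate_succ_apply', h, hb]
        exact absurd (hp.minimalPeriod_le (Nat.succ_pos i)) (by omega)
      obtain ⟨h3, h4⟩ := hstep _ hne
      rw [Function.iterate_succ_apply', pow_succ]
      constructor
      · calc H (f (f^[i] a)) ≤ c * H (f^[i] a) := h3
          _ ≤ c * (c ^ i * H a) := mul_le_mul_of_nonneg_left h1 hcp.le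
          _ = c ^ i * c * H a := by ring
      · calc H a ≤ c ^ i * H (f^[i] a) := h2
          _ ≤ c ^ i * (c * H (f (f^[i] a))) := mul_le_mul_of_nonneg_left h4 (by positivity)
          _ = _ := by ring
  -- By injectivity `b` is the only preimage of `a`, hence the last point of the cycle.
  have hlast : f^[n - 1] a = b := hf (by
    rw [hb, ← Function.iterate_succ_apply' f, Nat.succ_eq_add_one, Nat.sub_add_cancel hn0]
    exact Function.iterate_minimalPeriod)
  obtain ⟨h1, h2⟩ := key (n - 1) (by omega)
  rw [hlast] at h1 h2
  have hle : c ^ (n - 1) ≤ c ^ Fintype.card X :=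
    pow_le_pow_right₀ hc ((Nat.sub_le _ _).trans Function.minimalPeriod_le_card)
  exact ⟨h1.trans (mul_le_mul_of_nonneg_right hle (hH a).le),
    h2.trans (mul_le_mul_of_nonneg_right hle (hH b).le)⟩

namespace Mesh

variable {D : FracturedDomain} (M : Mesh D)

theorem volume_real_tri (τ : M.Tri) :
    volume.real (tri τ) = M.area τ * volume.real refTri := by
  have := setIntegral_convexHull (M.area_pos τ) (fun _ => (1 : ℝ))
  simpa [tri, area] using this

theorem aedisjoint_tri {τ τ' : M.Tri} (h : τ ≠ τ') : AEDisjoint volume (tri τ) (tri τ') := by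
  refine (AEDisjoint.congr ?_ (M.interior_tri_ae τ).symm (M.interior_tri_ae τ').symm)
  exact (M.disjoint_tri h).aedisjoint

theorem volume_refTri_pos : 0 < volume.real refTri := by
  rw [measureReal_def, ENNReal.toReal_pos_iff]
  refine ⟨?_, isCompact_refTri.measure_lt_top⟩
  have hsub : Ioo (0 : ℝ) (1 / 2) ×ˢ Ioo (0 : ℝ) (1 / 2) ⊆ refTri := by
    rintro ⟨s, t⟩ ⟨⟨h1, h2⟩, h3, h4⟩
    simp only at h1 h2 h3 h4
    exact ⟨h1.le, h3.le, by simp only; linarith⟩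
  refine lt_of_lt_of_le ?_ (measure_mono hsub)
  exact (isOpen_Ioo.prod isOpen_Ioo).measure_pos volume ⟨(1 / 4, 1 / 4), by norm_num⟩

/-- The number of shape regular triangles that meet in a point is bounded. -/
theorem card_mul_le {c₀ : ℝ} (hreg : ∀ τ, c₀ * M.hTri τ ^ 2 ≤ M.area τ)
    (S : Finset M.Tri) {z : Plane} (hz : ∀ τ ∈ S, z ∈ tri τ) :
    S.card * (c₀ * volume.real refTri) ≤ volume.real (Metric.closedBall (0 : Plane) 1) := by
  rcases S.eq_empty_or_nonempty with rfl | hS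
  · simp
  obtain ⟨σ, -, hσ⟩ := S.exists_min_image M.hTri hS
  set r := M.hTri σ
  have hr : 0 < r := hTri_pos σ
  -- All triangles are shrunk towards the common point `z` to the size `r` of the smallest one. By
  -- convexity each copy stays in its triangle, so the copies are almost disjoint; they lie in the
  -- ball of radius `r` and have area at least a fixed multiple of `r ^ 2`.
  set T : M.Tri → Set Plane := fun τ => AffineMap.homothety z (r / M.hTri τ) '' tri τ with hT
  have hc0 : ∀ τ, 0 < r / M.hTri τ := fun τ => div_pos hr (hTri_pos τ)
  have hc1 : ∀ τ ∈ S, r / M.hTri τ ≤ 1 := fun τ hτ => (div_le_one (hTri_pos τ)).2 (hσ τ hτ)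
  have hsub : ∀ τ ∈ S, T τ ⊆ tri τ := by
    rintro τ hτ _ ⟨x, hx, rfl⟩
    rw [AffineMap.homothety_eq_lineMap]
    exact (M.convex_tri τ).lineMap_mem (hz τ hτ) hx ⟨(hc0 τ).le, hc1 τ hτ⟩
  have hball : ∀ τ ∈ S, T τ ⊆ Metric.closedBall z r := by
    rintro τ hτ _ ⟨x, hx, rfl⟩
    rw [mem_closedBall_iff_norm, AffineMap.homothety_apply, vsub_eq_sub, vadd_eq_add,
      add_sub_cancel_right, norm_smul, Real.norm_of_nonneg (hc0 τ).le]
    calc r / M.hTri τ * ‖x - z‖ ≤ r / M.hTri τ * M.hTri τ :=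
          mul_le_mul_of_nonneg_left (dist_le_diam_tri hx (hz τ hτ)) (hc0 τ).le
      _ = r := div_mul_cancel₀ _ (hTri_pos τ).ne'
  have hmeas : ∀ τ ∈ S, NullMeasurableSet (T τ) volume := fun τ _ =>
    (((M.isCompact_tri τ).image (AffineMap.homothety z (r / M.hTri τ)).continuous_of_finiteDimensional
      ).measurableSet).nullMeasurableSet
  have hdisj : Set.Pairwise (↑S) (Function.onFun (AEDisjoint volume) T) := fun τ hτ τ' hτ' hne =>
    (M.aedisjoint_tri hne).mono (hsub τ hτ) (hsub τ' hτ')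
  have hfr : Module.finrank ℝ Plane = 2 := by simp
  have hvol : ∀ τ ∈ S, r ^ 2 * (c₀ * volume.real refTri) ≤ volume.real (T τ) := by
    intro τ hτ
    have : volume.real (T τ) = (r / M.hTri τ) ^ 2 * volume.real (tri τ) := by
      rw [measureReal_def, hT, Measure.addHaar_image_homothety, hfr, ENNReal.toReal_mul,
        ENNReal.toReal_ofReal (abs_nonneg _), abs_of_nonneg (sq_nonneg _), measureReal_def]
    rw [this, M.volume_real_tri, div_pow, ← mul_assoc, ← mul_assoc]
    refine mul_le_mul_of_nonneg_right ?_ volume_refTri_pos.le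
    rw [div_mul_eq_mul_div, mul_div_assoc]
    refine mul_le_mul_of_nonneg_left ?_ (sq_nonneg r)
    rw [le_div_iff₀ (by have := hTri_pos τ; positivity)]
    exact hreg τ
  have hsum : volume.real (⋃ τ ∈ S, T τ) = ∑ τ ∈ S, volume.real (T τ) := by
    rw [measureReal_def, measure_biUnion_finset₀ hdisj hmeas, ENNReal.toReal_sum]
    · rfl
    · intro τ hτ
      exact ((measure_mono (hball τ hτ)).trans_lt measure_closedBall_lt_top).ne
  have h1 : volume.real (⋃ τ ∈ S, T τ) ≤ volume.real (Metric.closedBall z r) :=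
    measureReal_mono (iUnion₂_subset hball) measure_closedBall_lt_top.ne
  have h2 : volume.real (Metric.closedBall z r) =
      r ^ 2 * volume.real (Metric.closedBall (0 : Plane) 1) := by
    rw [Measure.addHaar_real_closedBall' _ _ hr.le, hfr]
  have h3 : ∑ _τ ∈ S, r ^ 2 * (c₀ * volume.real refTri) ≤ ∑ τ ∈ S, volume.real (T τ) :=
    Finset.sum_le_sum hvol
  rw [Finset.sum_const, nsmul_eq_mul] at h3
  have h4 : r ^ 2 * (S.card * (c₀ * volume.real refTri)) ≤
      r ^ 2 * volume.real (Metric.closedBall (0 : Plane) 1) := by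
    rw [← h2]; linarith
  exact le_of_mul_le_mul_left h4 (by positivity)

/-- The previous triangle of the same polygon. -/
def prev (τ : M.Tri) : M.Tri := ⟨τ.1, (finRotate _).symm τ.2⟩

theorem next_prev (τ : M.Tri) : next (M.prev τ) = τ := by
  rw [next, prev, Equiv.apply_symm_apply]

theorem tgt_prev (τ : M.Tri) : tgt (M.prev τ) = src τ := by
  rw [tgt, prev, Equiv.apply_symm_apply, src]

theorem ctr_prev (τ : M.Tri) : ctr (M.prev τ) = ctr τ := rfl

theorem prev_next (τ : M.Tri) : M.prev (next τ) = τ := by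
  rw [next, prev, Equiv.symm_apply_apply]

theorem prev_injective : Function.Injective M.prev := fun τ σ h => by
  rw [← M.next_prev τ, ← M.next_prev σ, h]

theorem outerLen_eq_of_intEdges {τ τ' : M.Tri}
    (h : (τ, τ') ∈ M.intEdges ∨ (τ', τ) ∈ M.intEdges) : outerLen τ = outerLen τ' := by
  obtain ⟨-, h1, h2⟩ := (M.mem_intEdges _ _).1 h
  rw [outerLen, outerLen, h1, h2, dist_comm]

theorem node_succ_mem_Ioo (z : Fin M.nΓ) : M.node z.succ.castSucc ∈ Ioo 0 D.L := by
  obtain ⟨hm, h0, h1, -⟩ := M.partition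
  rw [mem_Ioo]
  nth_rw 1 [← h0]
  rw [← h1]
  refine ⟨hm ?_, hm (Fin.castSucc_lt_last _)⟩
  rw [Fin.lt_def]; simp

/-- The triangles in `Ωb 0` with `src` at the node are traversed from one fracture edge to the
other. A step goes to the previous triangle of the same polygon, whose outer edge ends at the node,
and then across that edge. The polygons on both sides share an edge comparable to each of their
diameters, so a step changes the diameter by a bounded factor. The node is interior to `Ω`, so the
walk never meets the boundary and can stop only at the fracture. -/
theorem exists_hFrac_comparable {ρS ρE : ℝ} (hρS : 0 < ρS) (hρE : 0 < ρE) :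
    ∃ C : ℝ, 0 < C ∧ ∀ M : Mesh D, M.StarShaped ρS → M.EdgesComparable ρE → ∀ z : Fin M.nΓ,
      M.hFrac z.castSucc ≤ C * M.hFrac z.succ ∧ M.hFrac z.succ ≤ C * M.hFrac z.castSucc := by
  classical
  set V := volume.real (Metric.closedBall (0 : Plane) 1)
  set c := max ρE⁻¹ 1 with hc
  have hc1 : 1 ≤ c := le_max_right _ _
  have hcE : ρE⁻¹ ≤ c := le_max_left _ _
  have hcp : 0 < c := by linarith
  -- An upper bound, independent of the mesh, for the number of triangles at a point.
  set N := ⌊V / (ρS * ρE * volume.real refTri)⌋₊ with hN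
  refine ⟨c ^ N * c, by positivity, fun M hS hE z => ?_⟩
  set zp := D.γ (M.node z.succ.castSucc) with hzp
  have hzpΩ : zp ∈ D.Ω := D.inside _ (M.node_succ_mem_Ioo z)
  have hreg : ∀ τ, ρS * ρE * M.hTri τ ^ 2 ≤ M.area τ := fun τ =>
    (mul_le_mul_of_nonneg_left (pow_le_pow_left₀ (hTri_pos τ).le (hTri_le_diam τ) 2)
      (by positivity)).trans (hS.le_area hE hρS τ)
  let X := {τ : M.Tri // src τ = zp ∧ M.sub τ.1 = 0}
  let a : X := ⟨M.fracTri 0 z.succ, (M.fracTri_zero z.succ).1, M.fracTri_sub 0 _⟩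
  -- The last triangle of the walk: the one before it in its polygon has its outer edge on the
  -- fracture and ends at the node.
  let b : X := ⟨next (M.fracTri 0 z.castSucc), (M.fracTri_zero z.castSucc).2.trans (by
    rw [hzp, Fin.succ_castSucc]), M.fracTri_sub 0 _⟩
  have hex : ∀ τ : X, τ ≠ b → ∃ τ' : X,
      (M.prev τ.1, τ'.1) ∈ M.intEdges ∨ (τ'.1, M.prev τ.1) ∈ M.intEdges := by
    rintro ⟨τ, h1, h2⟩ hne
    rcases M.edge_cases (M.prev τ) with h | ⟨i, j, h⟩ | ⟨τ', h⟩
    · have : zp ∈ frontier D.Ω := h (by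
        rw [← h1, ← M.tgt_prev]; exact right_mem_segment _ _ _)
      rw [D.isOpen.frontier_eq] at this
      exact absurd hzpΩ this.2
    · exfalso
      have hi : i = 0 := by
        have h3 := M.fracTri_sub i j
        rw [← h] at h3
        exact h3.symm.trans h2
      subst hi
      have h4 := (M.fracTri_zero j).2
      rw [← h, M.tgt_prev, h1, hzp] at h4
      have h5 := M.node_injective h4
      have h6 : j = z.castSucc := by
        rw [← Fin.succ_castSucc] at h5
        exact (Fin.succ_injective _ h5).symm
      apply hne
      apply Subtype.ext
      change τ = next (M.fracTri 0 z.castSucc)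
      rw [← h6, ← h, M.next_prev]
    · obtain ⟨h3, h4, h5⟩ := (M.mem_intEdges _ _).1 h
      exact ⟨⟨τ', by rw [← h5, M.tgt_prev, h1], by rw [← h3]; exact h2⟩, h⟩
  choose! g hg using hex
  set f : X → X := fun x => if x = b then a else g x with hf
  have hfb : f b = a := by simp [hf]
  have hfx : ∀ x, x ≠ b → f x = g x := fun x hx => by simp [hf, hx]
  -- A step arrives across an interior edge, whereas the outer edge of `a` lies on the fracture. So
  -- closing the walk by `f b = a` keeps `f` injective.
  have hga : ∀ x, x ≠ b → g x ≠ a := fun x hx h => by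
    have := hg x hx
    rw [h] at this
    exact M.fracTri_ne_of_intEdges this.symm 0 z.succ rfl
  have hinj : Function.Injective f := by
    intro x y hxy
    by_cases hx : x = b <;> by_cases hy : y = b
    · rw [hx, hy]
    · rw [hx, hfb, hfx y hy] at hxy
      exact absurd hxy.symm (hga y hy)
    · rw [hy, hfb, hfx x hx] at hxy
      exact absurd hxy (hga x hx)
    · rw [hfx x hx, hfx y hy] at hxy
      obtain ⟨-, p1, p2⟩ := (M.mem_intEdges _ _).1 (hg x hx)
      obtain ⟨-, q1, q2⟩ := (M.mem_intEdges _ _).1 (hg y hy)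
      rw [← hxy] at q1 q2
      exact Subtype.ext (M.prev_injective (M.eq_of_outer_eq (by rw [p1, q1]) (by rw [p2, q2])))
  set H : X → ℝ := fun x => Metric.diam (M.elem x.1.1) with hH
  have hHo : ∀ τ : M.Tri, outerLen τ ≤ Metric.diam (M.elem τ.1) := fun τ =>
    (outerLen_le τ).trans (hTri_le_diam τ)
  have hoH : ∀ τ : M.Tri, Metric.diam (M.elem τ.1) ≤ c * outerLen τ := fun τ => by
    have h1 : Metric.diam (M.elem τ.1) ≤ ρE⁻¹ * outerLen τ := by
      rw [← div_eq_inv_mul, le_div_iff₀ hρE, mul_comm]; exact hE τ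
    exact h1.trans (mul_le_mul_of_nonneg_right hcE (outerLen_pos τ).le)
  have hHp : ∀ x, 0 < H x := fun x => (outerLen_pos x.1).trans_le (hHo x.1)
  have hstep : ∀ x, x ≠ b → H (f x) ≤ c * H x ∧ H x ≤ c * H (f x) := by
    intro x hx
    rw [hfx x hx]
    have he := M.outerLen_eq_of_intEdges (hg x hx)
    have u1 := hHo (M.prev x.1)
    have u2 := hoH (M.prev x.1)
    have u3 := hHo (g x).1
    have u4 := hoH (g x).1
    change outerLen (M.prev x.1) ≤ H x at u1
    change H x ≤ _ at u2
    change _ ≤ H (g x) at u3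
    change H (g x) ≤ _ at u4
    rw [he] at u1 u2
    exact ⟨u4.trans (mul_le_mul_of_nonneg_left u1 hcp.le),
      u2.trans (mul_le_mul_of_nonneg_left u3 hcp.le)⟩
  obtain ⟨r1, r2⟩ := iterate_comparable hinj hfb hHp hc1 hstep
  have hcard : Fintype.card X ≤ N := by
    have h1 := M.card_mul_le hreg
      (Finset.univ.filter fun τ : M.Tri => src τ = zp ∧ M.sub τ.1 = 0) (z := zp)
      (fun τ hτ => by rw [← (Finset.mem_filter.1 hτ).2.1]; exact M.src_mem_tri τ)
    rw [← Fintype.card_subtype] at h1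
    rw [hN]
    apply Nat.le_floor
    rw [le_div_iff₀ (by have := volume_refTri_pos; positivity)]
    exact h1
  have hle : c ^ Fintype.card X ≤ c ^ N := pow_le_pow_right₀ hc1 hcard
  have r1' := r1.trans (mul_le_mul_of_nonneg_right hle (hHp a).le)
  have r2' := r2.trans (mul_le_mul_of_nonneg_right hle (hHp b).le)
  have s1 := hHo (M.fracTri 0 z.succ)
  have s2 := hoH (M.fracTri 0 z.succ)
  have s3 := hHo (M.fracTri 0 z.castSucc)
  have s4 := hoH (M.fracTri 0 z.castSucc)
  rw [M.outerLen_frac] at s1 s2 s3 s4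
  change _ ≤ H a at s1
  change H a ≤ _ at s2
  change _ ≤ H b at s3
  change H b ≤ _ at s4
  rw [mul_assoc, mul_assoc]
  exact ⟨s3.trans (r1'.trans (mul_le_mul_of_nonneg_left s2 (by positivity))),
    s1.trans (r2'.trans (mul_le_mul_of_nonneg_left s4 (by positivity)))⟩

end Mesh

/-! ### Square integrable functions -/

section L2

variable {α E : Type*} [MeasurableSpace α] {μ : Measure α} [NormedAddCommGroup E]

theorem MemLp_two.integrable_norm_sq {F : α → E} (hF : MemLp F 2 μ) :
    Integrable (fun x => ‖F x‖ ^ 2) μ := hF.norm.integrable_sq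

theorem memLp_of_continuous [TopologicalSpace α] [OpensMeasurableSpace α]
    [SecondCountableTopologyEither α E] [IsLocallyFiniteMeasure μ] {K : Set α}
    (hK : IsCompact K) (hKm : MeasurableSet K) {F : α → E} (hF : Continuous F) :
    MemLp F 2 (μ.restrict K) := by
  obtain ⟨C, hC⟩ := hK.exists_bound_of_continuousOn hF.continuousOn
  have : IsFiniteMeasure (μ.restrict K) := ⟨by
    rw [Measure.restrict_apply_univ]; exact hK.measure_lt_top⟩
  exact MemLp.of_bound hF.aestronglyMeasurable C
    ((ae_restrict_iff' hKm).2 (Filter.Eventually.of_forall hC))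

variable [InnerProductSpace ℝ E]

theorem MemLp_two.integrable_inner {F G : α → E} (hF : MemLp F 2 μ) (hG : MemLp G 2 μ) :
    Integrable (fun x => inner ℝ (F x) (G x)) μ := by
  refine ((MemLp_two.integrable_norm_sq hF).add (MemLp_two.integrable_norm_sq hG)).mono'
    (hF.1.inner hG.1) (Filter.Eventually.of_forall fun x => ?_)
  have h := abs_real_inner_le_norm (F x) (G x)
  rw [Real.norm_eq_abs]
  simp only [Pi.add_apply]
  nlinarith [sq_nonneg (‖F x‖ - ‖G x‖), norm_nonneg (F x), norm_nonneg (G x)]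

theorem MemLp_two.integrable_mul {f g : α → ℝ} (hf : MemLp f 2 μ) (hg : MemLp g 2 μ) :
    Integrable (fun x => f x * g x) μ := by
  have := MemLp_two.integrable_inner hg hf
  simpa using this

/-- Young's inequality for the `L²` inner product. -/
theorem abs_integral_inner_le {F G : α → E} (hF : MemLp F 2 μ) (hG : MemLp G 2 μ) {δ : ℝ}
    (hδ : 0 < δ) :
    |∫ x, inner ℝ (F x) (G x) ∂μ| ≤ δ⁻¹ * ∫ x, ‖F x‖ ^ 2 ∂μ + δ * ∫ x, ‖G x‖ ^ 2 ∂μ := by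
  have iF := (MemLp_two.integrable_norm_sq hF).const_mul δ⁻¹
  have iG := (MemLp_two.integrable_norm_sq hG).const_mul δ
  rw [← integral_const_mul, ← integral_const_mul, ← integral_add iF iG, ← Real.norm_eq_abs]
  refine (norm_integral_le_integral_norm _).trans
    (integral_mono_of_nonneg (Filter.Eventually.of_forall fun _ => norm_nonneg _) (iF.add iG)
      (Filter.Eventually.of_forall fun x => ?_))
  have h := abs_real_inner_le_norm (F x) (G x)
  simp only [Real.norm_eq_abs]
  have h2 : 2 * (‖F x‖ * ‖G x‖) ≤ δ⁻¹ * ‖F x‖ ^ 2 + δ * ‖G x‖ ^ 2 := by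
    have h3 : δ⁻¹ * ‖F x‖ ^ 2 + δ * ‖G x‖ ^ 2 - 2 * (‖F x‖ * ‖G x‖) =
        δ⁻¹ * (‖F x‖ - δ * ‖G x‖) ^ 2 := by field_simp; ring
    have : 0 ≤ δ⁻¹ * (‖F x‖ - δ * ‖G x‖) ^ 2 := by positivity
    linarith
  have h4 : 0 ≤ ‖F x‖ * ‖G x‖ := by positivity
  linarith

theorem abs_integral_mul_le {f g : α → ℝ} (hf : MemLp f 2 μ) (hg : MemLp g 2 μ) {δ : ℝ}
    (hδ : 0 < δ) :
    |∫ x, f x * g x ∂μ| ≤ δ⁻¹ * ∫ x, f x ^ 2 ∂μ + δ * ∫ x, g x ^ 2 ∂μ := by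
  have := abs_integral_inner_le hf hg hδ
  simp only [Real.norm_eq_abs, sq_abs] at this
  simpa [mul_comm] using this

theorem MemLp_two.bdd_smul {F : α → E} (hF : MemLp F 2 μ) {c : α → ℝ} {C : ℝ}
    (hc : AEStronglyMeasurable c μ) (hb : ∀ᵐ x ∂μ, |c x| ≤ C) :
    MemLp (fun x => c x • F x) 2 μ := by
  refine MemLp.of_le_mul (c := C) hF (hc.smul hF.1) ?_
  filter_upwards [hb] with x hx
  rw [norm_smul, Real.norm_eq_abs]
  exact mul_le_mul_of_nonneg_right hx (norm_nonneg _)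

end L2

namespace Mesh

variable {D : FracturedDomain} (M : Mesh D)

theorem restrict_tri (τ : M.Tri) :
    volume.restrict (tri τ) = volume.restrict (interior (tri τ)) :=
  Measure.restrict_congr_set (M.interior_tri_ae τ).symm

theorem restrict_tri_le (τ : M.Tri) : volume.restrict (tri τ) ≤ D.bulk := by
  rw [restrict_tri]
  refine Measure.restrict_mono ((M.interior_tri_subset τ).trans ?_) le_rfl
  unfold FracturedDomain.ΩB
  generalize M.sub τ.1 = i
  fin_cases i
  · exact subset_union_left
  · exact subset_union_right

theorem ae_tri {P : Plane → Prop} (h : ∀ᵐ x ∂D.bulk, P x) (τ : M.Tri) :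
    ∀ᵐ x ∂volume.restrict (tri τ), P x :=
  Measure.absolutelyContinuous_of_le (M.restrict_tri_le τ) h

theorem memLp_tri {E : Type*} [NormedAddCommGroup E] {F : Plane → E} (h : MemLp F 2 D.bulk)
    (τ : M.Tri) : MemLp F 2 (volume.restrict (tri τ)) := h.mono_measure (M.restrict_tri_le τ)

theorem memLp_tri_of_continuous {E : Type*} [NormedAddCommGroup E] [InnerProductSpace ℝ E]
    {F : Plane → E} (h : Continuous F) (τ : M.Tri) : MemLp F 2 (volume.restrict (tri τ)) :=
  memLp_of_continuous (M.isCompact_tri τ) (M.measurableSet_tri τ) h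

end Mesh

/-! ### Darcy's law and its residual -/

/-- Darcy's law holds almost everywhere. -/
theorem IsWeakSolution.darcy_ae {D : FracturedDomain} {c : Coefficients D} {f : Plane → ℝ}
    {fΓ : ℝ → ℝ} {u : Plane → Plane} {p : BulkH1 D} {pΓ : FracH10 D}
    (h : IsWeakSolution c f fΓ u p pΓ) :
    ∀ᵐ x ∂D.bulk, (c.K x)⁻¹ • u x + p.grad x = 0 := by
  obtain ⟨a, b, ha, hab⟩ := c.K_bdd
  have hKu : MemLp (fun x => (c.K x)⁻¹ • u x) 2 D.bulk := by
    refine MemLp_two.bdd_smul (C := a⁻¹) h.u_mem c.K_meas.inv.aestronglyMeasurable ?_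
    filter_upwards [hab] with x hx
    rw [abs_of_pos (inv_pos.2 (ha.trans_le hx.1))]
    exact inv_anti₀ ha hx.1
  -- The residual itself is an admissible test function, so its squared norm vanishes.
  set v : Plane → Plane := fun x => (c.K x)⁻¹ • u x + p.grad x with hv
  have hvm : MemLp v 2 D.bulk := hKu.add p.grad_mem
  have h1 := h.darcy v hvm
  have e1 : ∀ x, (c.K x)⁻¹ * inner ℝ (u x) (v x) = inner ℝ ((c.K x)⁻¹ • u x) (v x) := fun x => by
    rw [real_inner_smul_left]
  have e2 : ∀ x, inner ℝ (v x) (p.grad x) = inner ℝ (p.grad x) (v x) := fun x =>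
    real_inner_comm _ _
  simp_rw [e1, e2] at h1
  rw [← integral_add (MemLp_two.integrable_inner hKu hvm)
    (MemLp_two.integrable_inner p.grad_mem hvm)] at h1
  have e3 : ∀ x, inner ℝ ((c.K x)⁻¹ • u x) (v x) + inner ℝ (p.grad x) (v x) = ‖v x‖ ^ 2 :=
    fun x => by rw [← inner_add_left, ← real_inner_self_eq_norm_sq]
  simp_rw [e3] at h1
  rw [integral_eq_zero_iff_of_nonneg (fun x => by positivity)
    (MemLp_two.integrable_norm_sq hvm)] at h1
  filter_upwards [h1] with x hx
  simpa using hx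

namespace Mesh

variable {D : FracturedDomain} (M : Mesh D)

/-- The residual of Darcy's law is bounded by the error. -/
theorem setIntegral_darcy_le {c : Coefficients D} {f : Plane → ℝ}
    {fΓ : ℝ → ℝ} {u : Plane → Plane} {p : BulkH1 D} {pΓ : FracH10 D}
    (h : IsWeakSolution c f fΓ u p pΓ) (uh : M.PwVec) (ph : M.PwPoly) (τ : M.Tri) :
    ∫ x in tri τ, ‖(Real.sqrt (c.K x))⁻¹ • vval (uh τ) x + Real.sqrt (c.K x) • pgrad (ph τ) x‖ ^ 2
      ≤ 2 * (∫ x in tri τ, (c.K x)⁻¹ * ‖u x - vval (uh τ) x‖ ^ 2)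
        + 2 * ∫ x in tri τ, c.K x * ‖p.grad x - pgrad (ph τ) x‖ ^ 2 := by
  obtain ⟨a, b, ha, hab⟩ := c.K_bdd
  have hKab := M.ae_tri hab τ
  have hu : MemLp (fun x => u x - vval (uh τ) x) 2 (volume.restrict (tri τ)) :=
    (M.memLp_tri h.u_mem τ).sub (M.memLp_tri_of_continuous (continuous_vval _) τ)
  have hp : MemLp (fun x => p.grad x - pgrad (ph τ) x) 2 (volume.restrict (tri τ)) :=
    (M.memLp_tri p.grad_mem τ).sub (M.memLp_tri_of_continuous (continuous_pgrad _) τ)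
  have i1 : Integrable (fun x => (c.K x)⁻¹ * ‖u x - vval (uh τ) x‖ ^ 2)
      (volume.restrict (tri τ)) := by
    refine (MemLp_two.integrable_norm_sq hu).bdd_mul (c := a⁻¹) c.K_meas.inv.aestronglyMeasurable ?_
    filter_upwards [hKab] with x hx
    rw [Real.norm_of_nonneg (inv_nonneg.2 (ha.le.trans hx.1))]
    exact inv_anti₀ ha hx.1
  have i2 : Integrable (fun x => c.K x * ‖p.grad x - pgrad (ph τ) x‖ ^ 2)
      (volume.restrict (tri τ)) := by
    refine (MemLp_two.integrable_norm_sq hp).bdd_mul (c := b) c.K_meas.aestronglyMeasurable ?_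
    filter_upwards [hKab] with x hx
    rw [Real.norm_of_nonneg (ha.le.trans hx.1)]
    exact hx.2
  rw [← integral_const_mul, ← integral_const_mul, ← integral_add (i1.const_mul 2) (i2.const_mul 2)]
  refine integral_mono_of_nonneg (Filter.Eventually.of_forall fun x => by positivity)
    ((i1.const_mul 2).add (i2.const_mul 2)) ?_
  filter_upwards [hKab, M.ae_tri h.darcy_ae τ] with x hx hd
  have hK : 0 < c.K x := ha.trans_le hx.1
  have hs : 0 < Real.sqrt (c.K x) := Real.sqrt_pos.2 hK
  have hss : Real.sqrt (c.K x) ^ 2 = c.K x := Real.sq_sqrt hK.le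
  set r := Real.sqrt (c.K x)
  rw [← hss] at hd ⊢
  have hu0 : u x = -(r ^ 2) • p.grad x := by
    have : p.grad x = -((r ^ 2)⁻¹ • u x) := by rw [add_comm] at hd; exact eq_neg_of_add_eq_zero_left hd
    rw [this, smul_neg, neg_smul, neg_neg, smul_smul, mul_inv_cancel₀ (by positivity), one_smul]
  -- The exact pair contributes zero to the residual by Darcy's law, so it may be subtracted.
  have hid : r⁻¹ • vval (uh τ) x + r • pgrad (ph τ) x =
      -(r⁻¹ • (u x - vval (uh τ) x) + r • (p.grad x - pgrad (ph τ) x)) := by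
    rw [hu0, smul_sub, smul_smul, show r⁻¹ * -(r ^ 2) = -r by field_simp, smul_sub]
    module
  rw [hid, norm_neg]
  have hn := norm_add_le (r⁻¹ • (u x - vval (uh τ) x)) (r • (p.grad x - pgrad (ph τ) x))
  rw [norm_smul, norm_smul, Real.norm_of_nonneg (inv_nonneg.2 hs.le), Real.norm_of_nonneg hs.le] at hn
  refine (pow_le_pow_left₀ (norm_nonneg _) hn 2).trans ((add_sq_le).trans (le_of_eq ?_))
  field_simp

end Mesh

/-! ### Integration by parts on the triangulation -/

theorem continuous_lineMap (p q : Plane) : Continuous fun t : ℝ => AffineMap.lineMap p q t :=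
  AffineMap.lineMap_continuous

theorem lineMap_mem_segment {p q : Plane} {t : ℝ} (ht : t ∈ uIcc (0 : ℝ) 1) :
    AffineMap.lineMap p q t ∈ segment ℝ p q := by
  rw [uIcc_of_le zero_le_one] at ht
  rw [segment_eq_image_lineMap]
  exact ⟨t, ht, rfl⟩

theorem edgeInt_congr {p q : Plane} {g g' : Plane → ℝ} (h : ∀ x ∈ segment ℝ p q, g x = g' x) :
    edgeInt p q g = edgeInt p q g' := by
  unfold edgeInt
  congr 1
  exact intervalIntegral.integral_congr fun t ht => h _ (lineMap_mem_segment ht)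

theorem flux_congr {p q : Plane} {F G : Plane → Plane}
    (h : ∀ x ∈ segment ℝ p q, inner ℝ (F x) (rotcw (q - p)) = inner ℝ (G x) (rotcw (q - p))) :
    flux F p q = flux G p q := by
  unfold flux
  exact intervalIntegral.integral_congr fun t ht => h _ (lineMap_mem_segment ht)

theorem flux_eq_zero {p q : Plane} {F : Plane → Plane} (h : ∀ x ∈ segment ℝ p q, F x = 0) :
    flux F p q = 0 := by
  rw [flux_congr (G := fun _ => 0) fun x hx => by rw [h x hx]]
  simp [flux]

theorem edgeInt_normal {p q : Plane} (h : p ≠ q) (F : Plane → Plane) :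
    edgeInt p q (fun x => inner ℝ (F x) ((dist p q)⁻¹ • rotcw (q - p))) = flux F p q := by
  unfold edgeInt flux
  rw [← intervalIntegral.integral_const_mul]
  congr 1
  ext t
  simp only [real_inner_smul_right]
  rw [mul_inv_cancel_left₀ (dist_pos.2 h).ne']

theorem flux_sub {p q : Plane} {F G : Plane → Plane} (hF : Continuous F) (hG : Continuous G) :
    flux (fun x => F x - G x) p q = flux F p q - flux G p q := by
  unfold flux
  have k : ∀ {F : Plane → Plane}, Continuous F → IntervalIntegrable
      (fun t : ℝ => inner ℝ (F (AffineMap.lineMap p q t)) (rotcw (q - p))) volume 0 1 := fun hF =>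
    ((hF.comp (continuous_lineMap p q)).inner continuous_const).intervalIntegrable _ _
  rw [← intervalIntegral.integral_sub (k hF) (k hG)]
  simp_rw [inner_sub_left]

namespace Mesh

variable {D : FracturedDomain} (M : Mesh D)

theorem setIntegral_divergence_tri (τ : M.Tri) {F : Plane → Plane} (hF : ContDiff ℝ 1 F) :
    ∫ x in tri τ, divergence F x =
      flux F (src τ) (tgt τ) + flux F (tgt τ) (ctr τ) + flux F (ctr τ) (src τ) :=
  setIntegral_divergence (M.area_pos τ) hF

theorem integrableOn_tri {g : Plane → ℝ} (hg : Continuous g) (τ : M.Tri) :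
    IntegrableOn g (tri τ) := hg.continuousOn.integrableOn_compact (M.isCompact_tri τ)

/-- Green's formula on a triangle. -/
theorem green_tri (τ : M.Tri) {q : Plane → ℝ} {F : Plane → Plane} (hq : ContDiff ℝ 1 q)
    (hF : ContDiff ℝ 1 F) :
    ∫ x in tri τ, (q x * divergence F x + inner ℝ (gradient q x) (F x)) =
      flux (fun x => q x • F x) (src τ) (tgt τ) + flux (fun x => q x • F x) (tgt τ) (ctr τ)
        + flux (fun x => q x • F x) (ctr τ) (src τ) := by
  have hqF : ContDiff ℝ 1 fun x => q x • F x := hq.smul hF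
  rw [← M.setIntegral_divergence_tri τ hqF]
  congr 1
  ext x
  rw [divergence_smul (hq.differentiable one_ne_zero x) (hF.differentiable one_ne_zero x),
    inner_gradient_left]

theorem gradient_pval (q : MvPolynomial (Fin 2) ℝ) : gradient (pval q) = pgrad q := by
  ext1 x
  refine ext_inner_right ℝ fun v => ?_
  rw [inner_gradient_left, inner_pgrad]

theorem ctr_ne_tgt (τ : M.Tri) : ctr τ ≠ tgt τ := fun h => by
  have := M.ccw τ
  rw [h] at this
  simp [cross] at this

theorem src_ne_tgt (τ : M.Tri) : src τ ≠ tgt τ := dist_pos.1 (outerLen_pos τ)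

/-- The direction of a fracture edge. -/
def dir (j : Fin (M.nΓ + 1)) : Plane := (M.exists_direction j).choose

theorem dir_eq (j : Fin (M.nΓ + 1)) :
    D.γ (M.node j.succ) - D.γ (M.node j.castSucc) = M.hFrac j • M.dir j :=
  (M.exists_direction j).choose_spec.2.2.1

/-- The line through a fracture edge, parametrised by arc length. -/
def line (j : Fin (M.nΓ + 1)) (s : ℝ) : Plane :=
  D.γ (M.node j.castSucc) + (s - M.node j.castSucc) • M.dir j

theorem γ_eq_line (j : Fin (M.nΓ + 1)) {s : ℝ} (hs : s ∈ Icc (M.node j.castSucc) (M.node j.succ)) :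
    D.γ s = M.line j s := (M.exists_direction j).choose_spec.2.1 s hs

theorem normal_eq (j : Fin (M.nΓ + 1)) {s : ℝ} (hs : s ∈ Ioo (M.node j.castSucc) (M.node j.succ)) :
    D.normal s = rotcw (M.dir j) := (M.exists_direction j).choose_spec.2.2.2 s hs

theorem continuous_line (j : Fin (M.nΓ + 1)) : Continuous (M.line j) := by
  unfold line; fun_prop

theorem node_succ (j : Fin (M.nΓ + 1)) : M.node j.succ = M.node j.castSucc + M.hFrac j := by
  simp [hFrac]

/-- The endpoints form a null set and have to be excluded: the arc may have a corner there and the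
coefficients may jump. -/
theorem intFrac_congr (j : Fin (M.nΓ + 1)) {g g' : ℝ → ℝ}
    (h : ∀ s ∈ Ioo (M.node j.castSucc) (M.node j.succ), g s = g' s) :
    M.intFrac j g = M.intFrac j g' := by
  unfold intFrac
  rw [intervalIntegral.integral_of_le (M.node_lt j).le,
    intervalIntegral.integral_of_le (M.node_lt j).le, integral_Ioc_eq_integral_Ioo,
    integral_Ioc_eq_integral_Ioo]
  exact setIntegral_congr_fun measurableSet_Ioo h

/-- Integration over a fracture edge in the reference coordinate. -/
theorem intFrac_eq (j : Fin (M.nΓ + 1)) (g : ℝ → ℝ) :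
    M.intFrac j g = M.hFrac j * ∫ t in (0 : ℝ)..1, g (M.node j.castSucc + M.hFrac j * t) := by
  have := intervalIntegral.mul_integral_comp_add_mul (f := g) (a := 0) (b := 1) (M.hFrac j)
    (M.node j.castSucc)
  rw [this, mul_zero, mul_one, add_zero, ← M.node_succ, intFrac]

theorem line_ref (j : Fin (M.nΓ + 1)) (t : ℝ) : M.line j (M.node j.castSucc + M.hFrac j * t) =
    AffineMap.lineMap (D.γ (M.node j.castSucc)) (D.γ (M.node j.succ)) t := by
  rw [line, AffineMap.lineMap_apply, vsub_eq_sub, M.dir_eq, vadd_eq_add, add_sub_cancel_left,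
    smul_smul, mul_comm, add_comm]

theorem flux_frac (j : Fin (M.nΓ + 1)) (F : Plane → Plane) :
    flux F (D.γ (M.node j.castSucc)) (D.γ (M.node j.succ)) =
      M.intFrac j fun s => inner ℝ (F (M.line j s)) (rotcw (M.dir j)) := by
  rw [M.intFrac_eq, ← intervalIntegral.integral_const_mul, flux]
  congr 1
  ext t
  rw [M.line_ref, M.dir_eq, rotcw_smul, real_inner_smul_right]

theorem trN_eq (v : M.PwVec) (i : Fin 2) (j : Fin (M.nΓ + 1)) {s : ℝ}
    (hs : s ∈ Ioo (M.node j.castSucc) (M.node j.succ)) :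
    M.trN v i j s = inner ℝ (vval (v (M.fracTri i j)) (M.line j s)) (rotcw (M.dir j)) := by
  rw [trN, M.normal_eq j hs, M.γ_eq_line j (Ioo_subset_Icc_self hs)]

/-- The identity $q_0N_0-q_1N_1=[q]\{N\}+\{q\}[N]$, integrated over the edge; both fluxes are taken
in the direction of increasing arc length. -/
theorem intFrac_jump (j : Fin (M.nΓ + 1)) (q : M.PwPoly) (v : M.PwVec) :
    flux (fun x => pval (q (M.fracTri 0 j)) x • vval (v (M.fracTri 0 j)) x)
        (D.γ (M.node j.castSucc)) (D.γ (M.node j.succ))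
      - flux (fun x => pval (q (M.fracTri 1 j)) x • vval (v (M.fracTri 1 j)) x)
        (D.γ (M.node j.castSucc)) (D.γ (M.node j.succ)) =
      M.intFrac j (fun s => M.jumpΓ q j s * M.avgN v j s)
        + M.intFrac j (fun s => M.avgΓ q j s * M.jumpN v j s) := by
  set Q : Fin 2 → ℝ → ℝ := fun i s => pval (q (M.fracTri i j)) (M.line j s) with hQ
  set N : Fin 2 → ℝ → ℝ := fun i s =>
    inner ℝ (vval (v (M.fracTri i j)) (M.line j s)) (rotcw (M.dir j)) with hN
  have cQ : ∀ i, Continuous (Q i) := fun i => (continuous_pval _).comp (M.continuous_line j)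
  have cN : ∀ i, Continuous (N i) := fun i =>
    ((continuous_vval _).comp (M.continuous_line j)).inner continuous_const
  have cQ0 := cQ 0
  have cQ1 := cQ 1
  have cN0 := cN 0
  have cN1 := cN 1
  rw [M.intFrac_congr j (g' := fun s => (Q 0 s - Q 1 s) * ((N 0 s + N 1 s) / 2)) fun s hs => by
      rw [jumpΓ, avgN, M.trN_eq v 0 j hs, M.trN_eq v 1 j hs,
        M.γ_eq_line j (Ioo_subset_Icc_self hs)],
    M.intFrac_congr j (g := fun s => M.avgΓ q j s * M.jumpN v j s)
      (g' := fun s => ((Q 0 s + Q 1 s) / 2) * (N 0 s - N 1 s)) fun s hs => by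
      rw [avgΓ, jumpN, M.trN_eq v 0 j hs, M.trN_eq v 1 j hs,
        M.γ_eq_line j (Ioo_subset_Icc_self hs)],
    M.flux_frac, M.flux_frac]
  simp_rw [real_inner_smul_left]
  unfold intFrac
  change (∫ s in _.._, Q 0 s * N 0 s) - (∫ s in _.._, Q 1 s * N 1 s) = _
  rw [← intervalIntegral.integral_sub, ← intervalIntegral.integral_add]
  · congr 1
    ext s
    ring
  all_goals
    apply Continuous.intervalIntegrable
    fun_prop

/-- The equivalence `next`. -/
def nextEquiv : M.Tri ≃ M.Tri := ⟨next, M.prev, M.prev_next, M.next_prev⟩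

/-- The two discrete bilinear forms are adjoint to each other. -/
theorem bStar_eq_b {k k' : ℕ} {q : M.PwPoly} {v : M.PwVec} (hq : M.InS k q) (hv : M.InV k' v) :
    M.bStar q v = M.b v q := by
  set F : M.Tri → Plane → Plane := fun τ x => pval (q τ) x • vval (v τ) x with hF
  have cF : ∀ τ, ContDiff ℝ 1 (F τ) := fun τ => (contDiff_pval _).smul (contDiff_vval _)
  have hgreen : ∀ τ, (∫ x in tri τ, pval (q τ) x * vdiv (v τ) x)
      + ∫ x in tri τ, inner ℝ (vval (v τ) x) (pgrad (q τ) x) =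
      flux (F τ) (src τ) (tgt τ) + (flux (F τ) (tgt τ) (ctr τ) + flux (F τ) (ctr τ) (src τ)) := by
    intro τ
    have := M.green_tri τ (contDiff_pval (q τ)) (contDiff_vval (v τ))
    have i1 : IntegrableOn (fun x => pval (q τ) x * vdiv (v τ) x) (tri τ) :=
      M.integrableOn_tri ((continuous_pval _).mul (continuous_vdiv _)) τ
    have i2 : IntegrableOn (fun x => inner ℝ (vval (v τ) x) (pgrad (q τ) x)) (tri τ) :=
      M.integrableOn_tri ((continuous_vval _).inner (continuous_pgrad _)) τ
    rw [← add_assoc, ← this, ← integral_add i1 i2]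
    congr 1
    ext x
    rw [gradient_pval, divergence_vval, real_inner_comm]
  -- Each edge at the centre is seen once from `τ` and once, reversed, from `next τ`. After
  -- reindexing, the continuity of the normal component of `v` leaves the jump of `q` alone.
  have hinner : ∑ τ, (flux (F τ) (tgt τ) (ctr τ) + flux (F τ) (ctr τ) (src τ)) =
      ∑ τ : M.Tri, edgeInt (ctr τ) (tgt τ)
        (fun x => inner ℝ (vval (v τ) x) (innerNormal τ) * M.jumpP q τ x) := by
    rw [Finset.sum_add_distrib, ← Equiv.sum_comp M.nextEquiv (fun τ => flux (F τ) (ctr τ) (src τ)),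
      ← Finset.sum_add_distrib]
    refine Finset.sum_congr rfl fun τ _ => ?_
    change flux (F τ) (tgt τ) (ctr τ) + flux (F (next τ)) (ctr τ) (tgt τ) = _
    have hn : innerNormal τ = -((dist (ctr τ) (tgt τ))⁻¹ • rotcw (tgt τ - ctr τ)) := by
      rw [innerNormal, innerLen, ← smul_neg]
      congr 1
      rw [Plane.ext_iff_coord]; simp
    have h1 : flux (F (next τ)) (ctr τ) (tgt τ) =
        flux (fun x => pval (q (next τ)) x • vval (v τ) x) (ctr τ) (tgt τ) := by
      rw [← edgeInt_normal (M.ctr_ne_tgt τ), ← edgeInt_normal (M.ctr_ne_tgt τ)]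
      refine edgeInt_congr fun x hx => ?_
      have := hv.2 τ x hx
      rw [hn, inner_neg_right, inner_neg_right, neg_inj] at this
      simp only [hF]
      rw [real_inner_smul_left, real_inner_smul_left, this]
    rw [h1, flux_swap, neg_add_eq_sub, ← flux_sub, ← edgeInt_normal (M.ctr_ne_tgt τ)]
    · refine edgeInt_congr fun x _ => ?_
      simp only [hF]
      rw [← sub_smul, real_inner_smul_left, hn, inner_neg_right, jumpP]
      ring
    · exact ((contDiff_pval (q (next τ))).smul (contDiff_vval (v τ)) (n := 0)).continuous
    · exact (cF τ).continuous
  -- On the polygon edges the roles are exchanged: `q` is continuous across interior edges and zero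
  -- on the boundary, so the normal jump of `v` remains, together with the two-sided traces on the
  -- fracture.
  have houter : ∑ τ, flux (F τ) (src τ) (tgt τ) =
      (∑ e ∈ M.intEdges, edgeInt (src e.1) (tgt e.1) (fun x => pval (q e.1) x * M.jumpE v e x))
      + ∑ j, (M.intFrac j (fun s => M.jumpΓ q j s * M.avgN v j s)
        + M.intFrac j (fun s => M.avgΓ q j s * M.jumpN v j s)) := by
    rw [M.sum_outer]
    · congr 1
      · refine Finset.sum_congr rfl fun e he => ?_
        obtain ⟨-, h2, h3⟩ := M.mem_intEdges_iff (τ := e.1) (τ' := e.2) he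
        rw [← h2, ← h3, flux_swap (F e.2), ← sub_eq_add_neg, ← flux_sub (cF _).continuous
          (cF _).continuous, ← edgeInt_normal (M.src_ne_tgt e.1)]
        refine edgeInt_congr fun x hx => ?_
        simp only [hF]
        rw [hq.2.1 e he x hx, ← smul_sub, real_inner_smul_left, inner_sub_left]
        rfl
      · refine Finset.sum_congr rfl fun j _ => ?_
        rw [← M.intFrac_jump, (M.fracTri_zero j).1, (M.fracTri_zero j).2, (M.fracTri_one j).1,
          (M.fracTri_one j).2, flux_swap (F (M.fracTri 1 j)), ← sub_eq_add_neg]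
    · intro τ hτ
      refine flux_eq_zero fun x hx => ?_
      simp only [hF]
      rw [hq.2.2 τ hτ x hx, zero_smul]
  have hsum := Finset.sum_congr (rfl : (Finset.univ : Finset M.Tri) = Finset.univ)
    fun τ _ => hgreen τ
  rw [Finset.sum_add_distrib, Finset.sum_add_distrib, hinner, houter, Finset.sum_add_distrib] at hsum
  unfold bStar b
  linarith

end Mesh

/-! ### The jumps of the discrete pressure -/

/-- The polynomial `J` on the line through `c` with direction `e`, extended to the plane as a
function of the affine form with gradient `l`. -/
def ridge (c e l : Plane) (J : MvPolynomial (Fin 2) ℝ) : MvPolynomial (Fin 2) ℝ :=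
  MvPolynomial.bind₁ (fun i => MvPolynomial.C (c i - e i * inner ℝ l c)
    + MvPolynomial.C (e i * l 0) * MvPolynomial.X 0
    + MvPolynomial.C (e i * l 1) * MvPolynomial.X 1) J

theorem pval_ridge (c e l : Plane) (J : MvPolynomial (Fin 2) ℝ) (x : Plane) :
    pval (ridge c e l J) x = pval J (c + inner ℝ l (x - c) • e) := by
  unfold pval ridge
  rw [← MvPolynomial.coe_aeval_eq_eval, RingHom.coe_coe, MvPolynomial.aeval_bind₁,
    ← MvPolynomial.coe_aeval_eq_eval, RingHom.coe_coe]
  congr 2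
  ext i
  simp [plane_inner]; ring

theorem totalDegree_ridge_le (c e l : Plane) (J : MvPolynomial (Fin 2) ℝ) :
    (ridge c e l J).totalDegree ≤ J.totalDegree :=
  totalDegree_bind_le _ (fun _ => totalDegree_affine_le _ _ _) J

/-- A function of one barycentric coordinate is integrated against the length `1 - s` of a slice,
which is at most one. In this way the norm of a ridge polynomial on the triangle is bounded by its
norm on a side. -/
theorem integral_refTri_fst_le {g : ℝ → ℝ} (hg : Continuous g) (h0 : ∀ s, 0 ≤ g s) :
    ∫ p in refTri, g p.1 ≤ ∫ s in (0 : ℝ)..1, g s := by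
  rw [setIntegral_refTri (g := fun p => g p.1) (by fun_prop)]
  simp only [intervalIntegral.integral_const, sub_zero, smul_eq_mul]
  refine intervalIntegral.integral_mono_on zero_le_one
    (Continuous.intervalIntegrable (by fun_prop) _ _) (hg.intervalIntegrable _ _) fun s hs => ?_
  nlinarith [h0 s, hs.1]

theorem integral_refTri_third_le {g : ℝ → ℝ} (hg : Continuous g) (h0 : ∀ s, 0 ≤ g s) :
    ∫ p in refTri, g (1 - p.1 - p.2) ≤ ∫ s in (0 : ℝ)..1, g s := by
  rw [setIntegral_refTri (g := fun p => g (1 - p.1 - p.2)) (by fun_prop)]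
  have h : ∀ s : ℝ, ∫ t in (0 : ℝ)..(1 - s), g (1 - s - t) = ∫ t in (0 : ℝ)..(1 - s), g t :=
    fun s => by
      simp
  simp_rw [h]
  have hc : Continuous fun s : ℝ => ∫ t in (0 : ℝ)..(1 - s), g t :=
    (intervalIntegral.continuous_primitive (fun a b => hg.intervalIntegrable a b) 0).comp
      (continuous_const.sub continuous_id)
  calc ∫ s in (0 : ℝ)..1, ∫ t in (0 : ℝ)..(1 - s), g t
      ≤ ∫ _s in (0 : ℝ)..1, ∫ t in (0 : ℝ)..1, g t := by
        refine intervalIntegral.integral_mono_on zero_le_one (hc.intervalIntegrable _ _)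
          (continuous_const.intervalIntegrable _ _) fun s hs => ?_
        exact intervalIntegral.integral_mono_interval le_rfl (by linarith [hs.2])
          (by linarith [hs.1]) (Filter.Eventually.of_forall h0) (hg.intervalIntegrable _ _)
    _ = _ := by simp

namespace Mesh

variable {D : FracturedDomain} (M : Mesh D)

/-- A discrete field whose normal component on the edges in `F_p` is the jump of `q` divided by
the length. -/
def jumpField (q : M.PwPoly) : M.PwVec := fun τ i =>
  (-(M.area τ)⁻¹ * (src τ - ctr τ) i) •
      ridge (ctr τ) (tgt τ - ctr τ) (-(M.area τ)⁻¹ • rotcw (src τ - ctr τ)) (q τ - q (next τ))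
    + ((M.area τ)⁻¹ * (tgt τ - ctr τ) i) •
      ridge (ctr τ) (src τ - ctr τ) ((M.area τ)⁻¹ • rotcw (tgt τ - ctr τ)) (q (M.prev τ) - q τ)

theorem vval_jumpField (q : M.PwPoly) (τ : M.Tri) (x : Plane) :
    vval (M.jumpField q τ) x =
      (-(M.area τ)⁻¹ * pval (ridge (ctr τ) (tgt τ - ctr τ)
        (-(M.area τ)⁻¹ • rotcw (src τ - ctr τ)) (q τ - q (next τ))) x) • (src τ - ctr τ)
      + ((M.area τ)⁻¹ * pval (ridge (ctr τ) (src τ - ctr τ)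
        ((M.area τ)⁻¹ • rotcw (tgt τ - ctr τ)) (q (M.prev τ) - q τ)) x) • (tgt τ - ctr τ) := by
  rw [Plane.ext_iff_coord]
  simp only [vval, jumpField, pval_add, pval_smul, PiLp.add_apply, PiLp.smul_apply, smul_eq_mul,
    PiLp.toLp_apply, Matrix.cons_val_zero, Matrix.cons_val_one]
  constructor <;> ring

theorem area_eq_cross (τ : M.Tri) : M.area τ = cross (src τ - ctr τ) (tgt τ - ctr τ) := by
  simp [area, area2, cross]; ring

/-- On this side the second summand of the field is parallel to the edge and has no flux. In the
first one, the linear form of the ridge is the parameter of the edge, so the ridge reproduces the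
jump, and the factor with the area normalises the flux of the constant direction. -/
theorem cross_tgt_jumpField (q : M.PwPoly) (τ : M.Tri) (t : ℝ) :
    cross (vval (M.jumpField q τ) (AffineMap.lineMap (ctr τ) (tgt τ) t)) (ctr τ - tgt τ) =
      M.jumpP q τ (AffineMap.lineMap (ctr τ) (tgt τ) t) := by
  have hA := (M.area_pos τ).ne'
  set x : Plane := AffineMap.lineMap (ctr τ) (tgt τ) t with hx
  have hxc : x - ctr τ = t • (tgt τ - ctr τ) := by
    rw [hx, AffineMap.lineMap_apply, vsub_eq_sub, vadd_eq_add, add_sub_cancel_right]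
  have hi : inner ℝ (-(M.area τ)⁻¹ • rotcw (src τ - ctr τ)) (x - ctr τ) = t := by
    rw [hxc, real_inner_smul_right, real_inner_smul_left, real_inner_comm, inner_rotcw, cross_swap,
      ← M.area_eq_cross]
    field_simp
  rw [vval_jumpField, pval_ridge, hi, ← hxc, add_sub_cancel, jumpP, ← pval_sub, cross_add_left,
    cross_smul_left, cross_smul_left]
  have e1 : cross (src τ - ctr τ) (ctr τ - tgt τ) = -M.area τ := by
    rw [M.area_eq_cross]; simp [cross]; ring
  have e2 : cross (tgt τ - ctr τ) (ctr τ - tgt τ) = 0 := by simp [cross]; ring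
  rw [e1, e2]
  field_simp
  ring

theorem cross_src_jumpField (q : M.PwPoly) (τ : M.Tri) (t : ℝ) :
    cross (vval (M.jumpField q τ) (AffineMap.lineMap (ctr τ) (src τ) t)) (ctr τ - src τ) =
      M.jumpP q (M.prev τ) (AffineMap.lineMap (ctr τ) (src τ) t) := by
  have hA := (M.area_pos τ).ne'
  set x : Plane := AffineMap.lineMap (ctr τ) (src τ) t with hx
  have hxc : x - ctr τ = t • (src τ - ctr τ) := by
    rw [hx, AffineMap.lineMap_apply, vsub_eq_sub, vadd_eq_add, add_sub_cancel_right]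
  have hi : inner ℝ ((M.area τ)⁻¹ • rotcw (tgt τ - ctr τ)) (x - ctr τ) = t := by
    rw [hxc, real_inner_smul_right, real_inner_smul_left, real_inner_comm, inner_rotcw,
      ← M.area_eq_cross]
    field_simp
  rw [vval_jumpField, pval_ridge, pval_ridge, hi, ← hxc, add_sub_cancel, jumpP, ← pval_sub,
    cross_add_left, cross_smul_left, cross_smul_left, M.next_prev]
  have e1 : cross (tgt τ - ctr τ) (ctr τ - src τ) = M.area τ := by
    rw [M.area_eq_cross]; simp [cross]; ring
  have e2 : cross (src τ - ctr τ) (ctr τ - src τ) = 0 := by simp [cross]; ring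
  rw [e1, e2]
  field_simp
  ring

theorem inner_innerNormal_jumpField (q : M.PwPoly) (τ : M.Tri) {x : Plane}
    (hx : x ∈ Polygons.inner τ) :
    inner ℝ (vval (M.jumpField q τ) x) (innerNormal τ) = (innerLen τ)⁻¹ * M.jumpP q τ x := by
  rw [Polygons.inner, segment_eq_image_lineMap] at hx
  obtain ⟨t, -, rfl⟩ := hx
  rw [innerNormal, real_inner_smul_right, inner_rotcw, cross_tgt_jumpField]

/-- The field is a sum of constant vectors times ridges of differences of `q`, so no degree is lost.
On the edge shared by `τ` and `next τ`, the second summand of `next τ` carries the same jump as the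
first summand of `τ`. -/
theorem inV_jumpField {k : ℕ} {q : M.PwPoly} (hq : ∀ τ, (q τ).totalDegree ≤ k) :
    M.InV k (M.jumpField q) := by
  have hsub : ∀ τ σ, (q τ - q σ).totalDegree ≤ k := fun τ σ =>
    (MvPolynomial.totalDegree_sub _ _).trans (max_le (hq τ) (hq σ))
  refine ⟨fun τ i => ?_, fun τ x hx => ?_⟩
  · refine (MvPolynomial.totalDegree_add _ _).trans (max_le ?_ ?_) <;>
      exact (MvPolynomial.totalDegree_smul_le _ _).trans
        ((totalDegree_ridge_le _ _ _ _).trans (hsub _ _))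
  · rw [M.inner_innerNormal_jumpField q τ hx]
    rw [Polygons.inner, segment_eq_image_lineMap] at hx
    obtain ⟨t, -, rfl⟩ := hx
    have := M.cross_src_jumpField q (next τ) t
    rw [M.prev_next] at this
    rw [innerNormal, real_inner_smul_right, inner_rotcw]
    congr 1
    exact this.symm

/-- The scaled squared norm of the jump on an edge in `F_p`. -/
theorem innerLen_edgeInt (q : M.PwPoly) (τ : M.Tri) :
    (innerLen τ)⁻¹ * edgeInt (ctr τ) (tgt τ) (fun x => M.jumpP q τ x ^ 2) =
      ∫ t in (0 : ℝ)..1, M.jumpP q τ (AffineMap.lineMap (ctr τ) (tgt τ) t) ^ 2 := by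
  rw [edgeInt, innerLen, inv_mul_cancel_left₀ (dist_pos.2 (M.ctr_ne_tgt τ)).ne']

theorem continuous_jumpP (q : M.PwPoly) (τ : M.Tri) : Continuous (M.jumpP q τ) :=
  (continuous_pval _).sub (continuous_pval _)

theorem setIntegral_tri (τ : M.Tri) (f : Plane → ℝ) :
    ∫ x in tri τ, f x = M.area τ * ∫ p in refTri, f (aff (src τ) (tgt τ) (ctr τ) p) :=
  setIntegral_convexHull (M.area_pos τ) f

/-- In reference coordinates the two ridges depend on the barycentric coordinates of `tgt` and `src`
only. The field is at most $h_\tau/|\tau|$ times the jumps, up to a fixed factor in the area, and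
$h_\tau^2/|\tau|$ is bounded by shape regularity; hence no power of $h_\tau$ survives. -/
theorem norm_jumpField_le {ρ : ℝ} (hρ : 0 < ρ) (q : M.PwPoly) (τ : M.Tri)
    (hreg : ρ * M.hTri τ ^ 2 ≤ M.area τ) :
    ∫ x in tri τ, ‖vval (M.jumpField q τ) x‖ ^ 2 ≤ 2 * ρ⁻¹ *
      ((∫ t in (0 : ℝ)..1, M.jumpP q τ (AffineMap.lineMap (ctr τ) (tgt τ) t) ^ 2)
      + ∫ t in (0 : ℝ)..1, M.jumpP q (M.prev τ)
          (AffineMap.lineMap (ctr (M.prev τ)) (tgt (M.prev τ)) t) ^ 2) := by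
  have hA := M.area_pos τ
  have hh := hTri_pos τ
  set g1 : ℝ → ℝ := fun t => M.jumpP q τ (AffineMap.lineMap (ctr τ) (tgt τ) t) ^ 2 with hg1
  set g2 : ℝ → ℝ := fun t =>
    M.jumpP q (M.prev τ) (AffineMap.lineMap (ctr (M.prev τ)) (tgt (M.prev τ)) t) ^ 2 with hg2
  have c1 : Continuous g1 := ((M.continuous_jumpP q τ).comp (continuous_lineMap _ _)).pow 2
  have c2 : Continuous g2 := ((M.continuous_jumpP q _).comp (continuous_lineMap _ _)).pow 2
  have hpt : ∀ p : ℝ × ℝ, ‖vval (M.jumpField q τ) (aff (src τ) (tgt τ) (ctr τ) p)‖ ^ 2 ≤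
      2 * ((M.area τ)⁻¹ * M.hTri τ) ^ 2 * (g1 p.1 + g2 (1 - p.1 - p.2)) := by
    intro p
    set x := aff (src τ) (tgt τ) (ctr τ) p with hx
    have hxc : x - ctr τ = (1 - p.1 - p.2) • (src τ - ctr τ) + p.1 • (tgt τ - ctr τ) := by
      rw [hx, aff]; module
    have i1 : inner ℝ (-(M.area τ)⁻¹ • rotcw (src τ - ctr τ)) (x - ctr τ) = p.1 := by
      rw [hxc, real_inner_smul_left, real_inner_comm, inner_rotcw, cross_add_left, cross_smul_left,
        cross_smul_left, cross_swap (tgt τ - ctr τ), ← M.area_eq_cross,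
        show cross (src τ - ctr τ) (src τ - ctr τ) = 0 by simp [cross]; ring]
      field_simp; ring
    have i2 : inner ℝ ((M.area τ)⁻¹ • rotcw (tgt τ - ctr τ)) (x - ctr τ) = 1 - p.1 - p.2 := by
      rw [hxc, real_inner_smul_left, real_inner_comm, inner_rotcw, cross_add_left, cross_smul_left,
        cross_smul_left, ← M.area_eq_cross,
        show cross (tgt τ - ctr τ) (tgt τ - ctr τ) = 0 by simp [cross]; ring]
      field_simp; ring
    rw [vval_jumpField, pval_ridge, pval_ridge, i1, i2]
    have l1 : ctr τ + p.1 • (tgt τ - ctr τ) = AffineMap.lineMap (ctr τ) (tgt τ) p.1 := by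
      rw [AffineMap.lineMap_apply, vsub_eq_sub, vadd_eq_add, add_comm]
    have l2 : ctr τ + (1 - p.1 - p.2) • (src τ - ctr τ) =
        AffineMap.lineMap (ctr (M.prev τ)) (tgt (M.prev τ)) (1 - p.1 - p.2) := by
      rw [AffineMap.lineMap_apply, vsub_eq_sub, vadd_eq_add, add_comm, M.tgt_prev, M.ctr_prev]
    rw [l1, l2]
    have hj1 : pval (q τ - q (next τ)) (AffineMap.lineMap (ctr τ) (tgt τ) p.1) ^ 2 = g1 p.1 := by
      rw [hg1, pval_sub]; rfl
    have hj2 : pval (q (M.prev τ) - q τ) (AffineMap.lineMap (ctr (M.prev τ)) (tgt (M.prev τ))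
        (1 - p.1 - p.2)) ^ 2 = g2 (1 - p.1 - p.2) := by
      simp only [hg2]
      rw [pval_sub, jumpP, M.next_prev]
    set y1 := pval (q τ - q (next τ)) (AffineMap.lineMap (ctr τ) (tgt τ) p.1)
    set y2 := pval (q (M.prev τ) - q τ) (AffineMap.lineMap (ctr (M.prev τ)) (tgt (M.prev τ))
        (1 - p.1 - p.2))
    rw [← hj1, ← hj2]
    have n1 : ‖src τ - ctr τ‖ ≤ M.hTri τ := dist_le_diam_tri (M.src_mem_tri τ) (M.ctr_mem_tri τ)
    have n2 : ‖tgt τ - ctr τ‖ ≤ M.hTri τ := dist_le_diam_tri (M.tgt_mem_tri τ) (M.ctr_mem_tri τ)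
    have hia : 0 < (M.area τ)⁻¹ := inv_pos.2 hA
    have t1 : ‖(-(M.area τ)⁻¹ * y1) • (src τ - ctr τ)‖ ≤ (M.area τ)⁻¹ * M.hTri τ * |y1| := by
      rw [norm_smul, Real.norm_eq_abs, abs_mul, abs_neg, abs_of_pos hia]
      calc _ ≤ (M.area τ)⁻¹ * |y1| * M.hTri τ := mul_le_mul_of_nonneg_left n1 (by positivity)
        _ = _ := by ring
    have t2 : ‖((M.area τ)⁻¹ * y2) • (tgt τ - ctr τ)‖ ≤ (M.area τ)⁻¹ * M.hTri τ * |y2| := by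
      rw [norm_smul, Real.norm_eq_abs, abs_mul, abs_of_pos hia]
      calc _ ≤ (M.area τ)⁻¹ * |y2| * M.hTri τ := mul_le_mul_of_nonneg_left n2 (by positivity)
        _ = _ := by ring
    refine (pow_le_pow_left₀ (norm_nonneg _) ((norm_add_le _ _).trans (add_le_add t1 t2)) 2).trans ?_
    refine add_sq_le.trans (le_of_eq ?_)
    rw [mul_pow, mul_pow _ (|y2|), sq_abs, sq_abs]
    ring
  have cv : Continuous fun p => ‖vval (M.jumpField q τ) (aff (src τ) (tgt τ) (ctr τ) p)‖ ^ 2 :=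
    (((continuous_vval _).comp (continuous_aff _ _ _)).norm).pow 2
  have cg : Continuous fun p : ℝ × ℝ => g1 p.1 + g2 (1 - p.1 - p.2) :=
    (c1.comp continuous_fst).add (c2.comp (by fun_prop))
  have hint : ∫ p in refTri, ‖vval (M.jumpField q τ) (aff (src τ) (tgt τ) (ctr τ) p)‖ ^ 2 ≤
      2 * ((M.area τ)⁻¹ * M.hTri τ) ^ 2 *
        ((∫ t in (0 : ℝ)..1, g1 t) + ∫ t in (0 : ℝ)..1, g2 t) := by
    calc _ ≤ ∫ p in refTri, 2 * ((M.area τ)⁻¹ * M.hTri τ) ^ 2 * (g1 p.1 + g2 (1 - p.1 - p.2)) :=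
          setIntegral_mono (cv.continuousOn.integrableOn_compact isCompact_refTri)
            ((cg.const_mul _).continuousOn.integrableOn_compact isCompact_refTri) hpt
      _ ≤ _ := by
        have j1 : IntegrableOn (fun p : ℝ × ℝ => g1 p.1) refTri :=
          (c1.comp continuous_fst).continuousOn.integrableOn_compact isCompact_refTri
        have j2 : IntegrableOn (fun p : ℝ × ℝ => g2 (1 - p.1 - p.2)) refTri :=
          (c2.comp (g := g2) (f := fun p : ℝ × ℝ => 1 - p.1 - p.2)
            (by fun_prop)).continuousOn.integrableOn_compact isCompact_refTri
        rw [integral_const_mul, integral_add j1 j2]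
        refine mul_le_mul_of_nonneg_left (add_le_add ?_ ?_) (by positivity)
        · exact integral_refTri_fst_le c1 fun s => sq_nonneg _
        · exact integral_refTri_third_le c2 fun s => sq_nonneg _
  rw [M.setIntegral_tri]
  have hG : 0 ≤ (∫ t in (0 : ℝ)..1, g1 t) + ∫ t in (0 : ℝ)..1, g2 t :=
    add_nonneg (intervalIntegral.integral_nonneg zero_le_one fun t _ => sq_nonneg _)
      (intervalIntegral.integral_nonneg zero_le_one fun t _ => sq_nonneg _)
  refine (mul_le_mul_of_nonneg_left hint hA.le).trans ?_
  rw [← mul_assoc]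
  refine mul_le_mul_of_nonneg_right ?_ hG
  have : M.area τ * (2 * ((M.area τ)⁻¹ * M.hTri τ) ^ 2) = 2 * (M.hTri τ ^ 2 / M.area τ) := by
    field_simp
  rw [this]
  refine mul_le_mul_of_nonneg_left ?_ zero_le_two
  rw [div_le_iff₀ hA, ← div_eq_inv_mul, le_div_iff₀ hρ, mul_comm]
  exact hreg

/-- The jumps of the discrete pressure are bounded by the residual of Darcy's law. -/
theorem sum_jumpP_le {c : Coefficients D} {a b : ℝ} (ha : 0 < a)
    (hab : ∀ᵐ x ∂D.bulk, a ≤ c.K x ∧ c.K x ≤ b) {ρ : ℝ} (hρ : 0 < ρ)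
    (hreg : ∀ τ, ρ * M.hTri τ ^ 2 ≤ M.area τ) {k : ℕ} {f : Plane → ℝ} {fΓ : ℝ → ℝ} {uh : M.PwVec}
    {ph : M.PwPoly} {wh : M.PwFrac} (h : M.IsDiscreteSolution c k f fΓ uh ph wh) :
    ∑ τ : M.Tri, (innerLen τ)⁻¹ * edgeInt (ctr τ) (tgt τ) (fun x => M.jumpP ph τ x ^ 2) ≤
      16 * (a⁻¹ * ρ⁻¹) * ∑ τ : M.Tri, ∫ x in tri τ,
        ‖(Real.sqrt (c.K x))⁻¹ • vval (uh τ) x + Real.sqrt (c.K x) • pgrad (ph τ) x‖ ^ 2 := by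
  set v := M.jumpField ph with hv
  have hvV : M.InV k v := M.inV_jumpField h.ph_mem.1
  simp_rw [M.innerLen_edgeInt]
  set X : M.Tri → ℝ := fun τ =>
    ∫ t in (0 : ℝ)..1, M.jumpP ph τ (AffineMap.lineMap (ctr τ) (tgt τ) t) ^ 2 with hX
  set R : M.Tri → Plane → Plane := fun τ x =>
    (Real.sqrt (c.K x))⁻¹ • vval (uh τ) x + Real.sqrt (c.K x) • pgrad (ph τ) x with hR
  have hedge : ∀ τ : M.Tri, edgeInt (ctr τ) (tgt τ)
      (fun x => inner ℝ (vval (v τ) x) (innerNormal τ) * M.jumpP ph τ x) = X τ := by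
    intro τ
    simp only [hX]
    rw [← M.innerLen_edgeInt, edgeInt_congr (g' := fun x => (innerLen τ)⁻¹ * M.jumpP ph τ x ^ 2)
      fun x hx => by rw [hv, M.inner_innerNormal_jumpField ph τ hx]; ring]
    simp only [edgeInt, intervalIntegral.integral_const_mul]
    ring
  have hKp : ∀ τ : M.Tri, ∀ᵐ x ∂volume.restrict (tri τ), a ≤ c.K x ∧ c.K x ≤ b := M.ae_tri hab
  have hsm : Measurable fun x => Real.sqrt (c.K x) := c.K_meas.sqrt
  have hia : ∀ τ : M.Tri, ∀ᵐ x ∂volume.restrict (tri τ), |(Real.sqrt (c.K x))⁻¹| ≤ (Real.sqrt a)⁻¹ := by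
    intro τ
    filter_upwards [hKp τ] with x hx
    rw [abs_of_nonneg (by positivity)]
    exact inv_anti₀ (Real.sqrt_pos.2 ha) (Real.sqrt_le_sqrt hx.1)
  have hib : ∀ τ : M.Tri, ∀ᵐ x ∂volume.restrict (tri τ), |Real.sqrt (c.K x)| ≤ Real.sqrt b := by
    intro τ
    filter_upwards [hKp τ] with x hx
    rw [abs_of_nonneg (by positivity)]
    exact Real.sqrt_le_sqrt hx.2
  have mR : ∀ τ : M.Tri, MemLp (R τ) 2 (volume.restrict (tri τ)) := fun τ =>
    (MemLp_two.bdd_smul (M.memLp_tri_of_continuous (continuous_vval _) τ)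
      hsm.inv.aestronglyMeasurable (hia τ)).add
    (MemLp_two.bdd_smul (M.memLp_tri_of_continuous (continuous_pgrad _) τ)
      hsm.aestronglyMeasurable (hib τ))
  have mv : ∀ τ : M.Tri, MemLp (fun x => (Real.sqrt (c.K x))⁻¹ • vval (v τ) x) 2
      (volume.restrict (tri τ)) := fun τ =>
    MemLp_two.bdd_smul (M.memLp_tri_of_continuous (continuous_vval _) τ)
      hsm.inv.aestronglyMeasurable (hia τ)
  have hKi : ∀ τ : M.Tri, ∀ᵐ x ∂volume.restrict (tri τ), |(c.K x)⁻¹| ≤ a⁻¹ := by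
    intro τ
    filter_upwards [hKp τ] with x hx
    rw [abs_of_pos (inv_pos.2 (ha.trans_le hx.1))]
    exact inv_anti₀ ha hx.1
  -- With $R=K^{-1/2}u_h+K^{1/2}\nabla p_h$ the two volume terms of the discrete Darcy law combine
  -- to $R\cdot K^{-1/2}v$.
  have hid : ∀ τ : M.Tri, (∫ x in tri τ, (c.K x)⁻¹ * inner ℝ (vval (uh τ) x) (vval (v τ) x))
      + ∫ x in tri τ, inner ℝ (vval (v τ) x) (pgrad (ph τ) x) =
      ∫ x in tri τ, inner ℝ (R τ x) ((Real.sqrt (c.K x))⁻¹ • vval (v τ) x) := by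
    intro τ
    have i1 : Integrable (fun x => (c.K x)⁻¹ * inner ℝ (vval (uh τ) x) (vval (v τ) x))
        (volume.restrict (tri τ)) := by
      have := MemLp_two.integrable_inner (MemLp_two.bdd_smul
        (M.memLp_tri_of_continuous (continuous_vval (uh τ)) τ)
        c.K_meas.inv.aestronglyMeasurable (hKi τ))
        (M.memLp_tri_of_continuous (continuous_vval (v τ)) τ)
      simpa only [Pi.inv_apply, real_inner_smul_left] using this
    rw [← integral_add i1 (M.integrableOn_tri ((continuous_vval _).inner (continuous_pgrad _)) τ)]
    refine integral_congr_ae ?_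
    filter_upwards [hKp τ] with x hx
    have hK : 0 < c.K x := ha.trans_le hx.1
    have hs : 0 < Real.sqrt (c.K x) := Real.sqrt_pos.2 hK
    have hss : Real.sqrt (c.K x) ^ 2 = c.K x := Real.sq_sqrt hK.le
    simp only [hR]
    rw [inner_add_left, real_inner_smul_left, real_inner_smul_left, real_inner_smul_right,
      real_inner_smul_right, real_inner_comm (pgrad (ph τ) x) (vval (v τ) x)]
    nth_rw 1 [← hss]
    field_simp
  -- Replacing `bStar` by its adjoint turns the edge terms of the discrete Darcy law into the sum of
  -- the scaled squared jumps, by the choice of `v`.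
  have hd := h.darcy v hvV
  rw [M.bStar_eq_b h.ph_mem hvV, Mesh.b] at hd
  simp_rw [hedge] at hd
  have hXR : ∑ τ, X τ = ∑ τ, ∫ x in tri τ, inner ℝ (R τ x) ((Real.sqrt (c.K x))⁻¹ • vval (v τ) x) := by
    simp_rw [← hid]
    rw [Finset.sum_add_distrib]
    linarith
  have hvnorm : ∀ τ : M.Tri, ∫ x in tri τ, ‖(Real.sqrt (c.K x))⁻¹ • vval (v τ) x‖ ^ 2 ≤
      a⁻¹ * (2 * ρ⁻¹ * (X τ + X (M.prev τ))) := by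
    intro τ
    refine le_trans ?_ (mul_le_mul_of_nonneg_left (M.norm_jumpField_le hρ ph τ (hreg τ))
      (inv_nonneg.2 ha.le))
    rw [← integral_const_mul]
    refine integral_mono_of_nonneg (Filter.Eventually.of_forall fun x => by positivity)
      ((M.integrableOn_tri ((continuous_vval _).norm.pow 2) τ).const_mul _) ?_
    filter_upwards [hKp τ] with x hx
    rw [norm_smul, mul_pow, norm_inv, inv_pow, Real.norm_eq_abs, sq_abs,
      Real.sq_sqrt (ha.le.trans hx.1)]
    exact mul_le_mul_of_nonneg_right (inv_anti₀ ha hx.1) (sq_nonneg _)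
  -- Chosen so that the norm of the test field costs a quarter of the jumps. Every jump occurs for
  -- two triangles, `τ` and the one with `prev τ`, so one half of the sum is absorbed.
  set δ : ℝ := a * ρ / 8 with hδ
  have hδ0 : 0 < δ := by positivity
  have hbound : ∑ τ, X τ ≤ ∑ τ, (δ⁻¹ * (∫ x in tri τ, ‖R τ x‖ ^ 2)
      + δ * (a⁻¹ * (2 * ρ⁻¹ * (X τ + X (M.prev τ))))) := by
    rw [hXR]
    refine Finset.sum_le_sum fun τ _ => ?_
    refine (le_abs_self _).trans ((abs_integral_inner_le (mR τ) (mv τ) hδ0).trans ?_)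
    exact add_le_add le_rfl (mul_le_mul_of_nonneg_left (hvnorm τ) hδ0.le)
  have hprev : ∑ τ, X (M.prev τ) = ∑ τ, X τ := Equiv.sum_comp M.nextEquiv.symm X
  have hc : δ * (a⁻¹ * (2 * ρ⁻¹)) = 1 / 4 := by rw [hδ]; field_simp; norm_num
  have hrw : ∀ τ, δ * (a⁻¹ * (2 * ρ⁻¹ * (X τ + X (M.prev τ)))) = 1 / 4 * X τ + 1 / 4 * X (M.prev τ) :=
    fun τ => by rw [← hc]; ring
  simp_rw [hrw] at hbound
  rw [Finset.sum_add_distrib, Finset.sum_add_distrib, ← Finset.mul_sum, ← Finset.mul_sum,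
    ← Finset.mul_sum, hprev] at hbound
  have hδi : 16 * (a⁻¹ * ρ⁻¹) = 2 * δ⁻¹ := by rw [hδ]; field_simp; norm_num
  rw [hδi]
  linarith

end Mesh

/-! ### Test functions supported on triangles -/

namespace Mesh

variable {D : FracturedDomain} (M : Mesh D)

theorem setIntegral_indicator_tri (τ : M.Tri) {U : Set Plane} (hU : interior (tri τ) ⊆ U)
    (g : Plane → ℝ) : ∫ x in U, (tri τ).indicator g x = ∫ x in tri τ, g x := by
  rw [setIntegral_indicator (M.measurableSet_tri τ)]
  refine setIntegral_congr_set ?_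
  have h : (U ∩ tri τ : Set Plane) =ᵐ[volume] (U ∩ interior (tri τ) : Set Plane) :=
    (ae_eq_refl U).inter (M.interior_tri_ae τ).symm
  rw [inter_eq_self_of_subset_right hU] at h
  exact h.trans (M.interior_tri_ae τ)

theorem setIntegral_indicator_tri_eq_zero (τ : M.Tri) {U : Set Plane}
    (hU : Disjoint U (interior (tri τ))) (g : Plane → ℝ) :
    ∫ x in U, (tri τ).indicator g x = 0 := by
  rw [setIntegral_indicator (M.measurableSet_tri τ)]
  have h : (U ∩ tri τ : Set Plane) =ᵐ[volume] (U ∩ interior (tri τ) : Set Plane) :=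
    (ae_eq_refl U).inter (M.interior_tri_ae τ).symm
  rw [hU.inter_eq] at h
  rw [setIntegral_congr_set h, setIntegral_empty]

theorem interior_tri_subset_ΩB (τ : M.Tri) : interior (tri τ) ⊆ D.ΩB := by
  refine (M.interior_tri_subset τ).trans ?_
  unfold FracturedDomain.ΩB
  generalize M.sub τ.1 = i
  fin_cases i
  · exact subset_union_left
  · exact subset_union_right

/-- The function that is `q τ` on the triangles `τ ∈ s` and zero elsewhere. -/
def triSum {E : Type*} [AddCommMonoid E] (s : Finset M.Tri) (q : M.Tri → Plane → E) (x : Plane) : E :=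
  ∑ τ ∈ s, (tri τ).indicator (q τ) x

theorem memLp_triSum {E : Type*} [NormedAddCommGroup E] [InnerProductSpace ℝ E] (s : Finset M.Tri)
    {q : M.Tri → Plane → E} (hq : ∀ τ, Continuous (q τ)) : MemLp (M.triSum s q) 2 D.bulk := by
  refine memLp_finsetSum s fun τ _ => ?_
  rw [memLp_indicator_iff_restrict (M.measurableSet_tri τ)]
  exact (M.memLp_tri_of_continuous (hq τ) τ).mono_measure
    (Measure.restrict_mono le_rfl Measure.restrict_le_self)

theorem integral_inner_triSum {E : Type*} [NormedAddCommGroup E] [InnerProductSpace ℝ E]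
    (s : Finset M.Tri) {q : M.Tri → Plane → E} (hq : ∀ τ, Continuous (q τ)) {F : Plane → E}
    (hF : MemLp F 2 D.bulk) :
    ∫ x, inner ℝ (F x) (M.triSum s q x) ∂D.bulk = ∑ τ ∈ s, ∫ x in tri τ, inner ℝ (F x) (q τ x) := by
  have h : ∀ x, inner ℝ (F x) (M.triSum s q x) =
      ∑ τ ∈ s, (tri τ).indicator (fun x => inner ℝ (F x) (q τ x)) x := by
    intro x
    rw [triSum, inner_sum]
    refine Finset.sum_congr rfl fun τ _ => ?_
    by_cases hx : x ∈ tri τ <;> simp [hx]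
  simp_rw [h]
  rw [integral_finsetSum]
  · exact Finset.sum_congr rfl fun τ _ =>
      M.setIntegral_indicator_tri τ (M.interior_tri_subset_ΩB τ) _
  · intro τ _
    rw [integrable_indicator_iff (M.measurableSet_tri τ)]
    refine MemLp_two.integrable_inner (hF.mono_measure Measure.restrict_le_self) ?_
    exact (M.memLp_tri_of_continuous (hq τ) τ).mono_measure
      (Measure.restrict_mono le_rfl Measure.restrict_le_self)

/-- The three boundary fluxes of `F` out of a triangle. -/
def bdryFlux (τ : M.Tri) (F : Plane → Plane) : ℝ :=
  flux F (src τ) (tgt τ) + flux F (tgt τ) (ctr τ) + flux F (ctr τ) (src τ)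

theorem continuous_gradient {q : Plane → ℝ} (hq : ContDiff ℝ 1 q) : Continuous (gradient q) :=
  (InnerProductSpace.toDual ℝ Plane).symm.continuous.comp (hq.continuous_fderiv one_ne_zero)

/-- Compatible functions on triangles of one subdomain form an element of `U` with zero traces. -/
theorem exists_bulkH1 {s : Finset M.Tri} {i : Fin 2} (hs : ∀ τ ∈ s, M.sub τ.1 = i)
    {q : M.Tri → Plane → ℝ} (hq : ∀ τ, ContDiff ℝ 1 (q τ))
    (hflux : ∀ φ : Plane → Plane, ContDiff ℝ 1 φ →
      ∑ τ ∈ s, M.bdryFlux τ (fun x => q τ x • φ x) = 0) :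
    ∃ Q : BulkH1 D, Q.val = M.triSum s q ∧ Q.grad = M.triSum s (fun τ => gradient (q τ)) ∧
      Q.tr = 0 := by
  have key : ∀ j (φ : Plane → Plane), ContDiff ℝ ∞ φ →
      ∫ x in D.Ωb j, (M.triSum s q x * divergence φ x
        + inner ℝ (M.triSum s (fun τ => gradient (q τ)) x) (φ x)) = 0 := by
    intro j φ hφ
    have hφ1 : ContDiff ℝ 1 φ := hφ.of_le (by exact_mod_cast le_top)
    have h : ∀ x, M.triSum s q x * divergence φ x
        + inner ℝ (M.triSum s (fun τ => gradient (q τ)) x) (φ x) =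
        ∑ τ ∈ s, (tri τ).indicator
          (fun x => q τ x * divergence φ x + inner ℝ (gradient (q τ) x) (φ x)) x := by
      intro x
      rw [triSum, triSum, Finset.sum_mul, sum_inner, ← Finset.sum_add_distrib]
      refine Finset.sum_congr rfl fun τ _ => ?_
      by_cases hx : x ∈ tri τ <;> simp [hx]
    simp_rw [h]
    rw [integral_finsetSum]
    -- On the subdomain of the triangles, Green's formula on each of them leaves the boundary
    -- fluxes, which cancel by assumption. On the other subdomain the functions vanish almost
    -- everywhere.
    · by_cases hj : i = j
      · rw [← hflux φ hφ1]
        refine Finset.sum_congr rfl fun τ hτ => ?_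
        rw [M.setIntegral_indicator_tri τ, M.green_tri τ (hq τ) hφ1, bdryFlux]
        rw [← hj, ← hs τ hτ]
        exact M.interior_tri_subset τ
      · refine Finset.sum_eq_zero fun τ hτ => M.setIntegral_indicator_tri_eq_zero τ ?_ _
        refine Disjoint.mono_right (M.interior_tri_subset τ) ?_
        rw [hs τ hτ]
        exact disjoint_sub (Ne.symm hj)
    · intro τ _
      refine Integrable.mono_measure ?_ Measure.restrict_le_self
      rw [integrable_indicator_iff (M.measurableSet_tri τ)]
      exact M.integrableOn_tri (((hq τ).continuous.mul (continuous_divergence hφ1)).add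
        ((continuous_gradient (hq τ)).inner hφ1.continuous)) τ
  exact ⟨{  val := M.triSum s q
            grad := M.triSum s (fun τ => gradient (q τ))
            tr := 0
            val_mem := M.memLp_triSum s fun τ => (hq τ).continuous
            grad_mem := M.memLp_triSum s fun τ => continuous_gradient (hq τ)
            tr_mem := fun _ => MemLp.zero
            green_zero := fun φ hφ => by rw [key 0 φ hφ]; simp
            green_one := fun φ hφ => by rw [key 1 φ hφ]; simp }, rfl, rfl, rfl⟩

/-- The residual of the bulk balance for a test function supported on triangles. -/
theorem sum_residual {c : Coefficients D} {f : Plane → ℝ} {fΓ : ℝ → ℝ} {u : Plane → Plane}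
    {p : BulkH1 D} {pΓ : FracH10 D} (h : IsWeakSolution c f fΓ u p pΓ) (hf : MemLp f 2 D.bulk)
    (uh : M.PwVec) {s : Finset M.Tri} {i : Fin 2} (hs : ∀ τ ∈ s, M.sub τ.1 = i)
    {q : M.Tri → Plane → ℝ} (hq : ∀ τ, ContDiff ℝ 1 (q τ))
    (hflux : ∀ φ : Plane → Plane, ContDiff ℝ 1 φ →
      ∑ τ ∈ s, M.bdryFlux τ (fun x => q τ x • φ x) = 0) :
    ∑ τ ∈ s, M.bdryFlux τ (fun x => q τ x • vval (uh τ) x) =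
      -∑ τ ∈ s, ((∫ x in tri τ, (f x - vdiv (uh τ) x) * q τ x)
        + ∫ x in tri τ, inner ℝ (u x - vval (uh τ) x) (gradient (q τ) x)) := by
  obtain ⟨Q, hv, hg, ht⟩ := M.exists_bulkH1 hs hq hflux
  have hb := h.balance Q
  -- The test function has zero traces, so the interface terms drop out and only the bulk equation
  -- is tested.
  have ha : Q.avg = 0 := by ext; simp [BulkH1.avg, ht]
  have hj : Q.jump = 0 := by ext; simp [BulkH1.jump, ht]
  simp only [ha, hj, Pi.zero_apply, mul_zero, intervalIntegral.integral_zero, zero_add] at hb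
  rw [hv, hg, M.integral_inner_triSum s (fun τ => continuous_gradient (hq τ)) h.u_mem] at hb
  have hfv := M.integral_inner_triSum s (fun τ => (hq τ).continuous) hf
  simp only [RCLike.inner_apply, conj_trivial] at hfv
  have hmul : ∫ x, f x * M.triSum s q x ∂D.bulk = ∑ τ ∈ s, ∫ x in tri τ, f x * q τ x := by
    simpa only [mul_comm] using hfv
  rw [hmul] at hb
  have hτ : ∀ τ : M.Tri, M.bdryFlux τ (fun x => q τ x • vval (uh τ) x) =
      -((∫ x in tri τ, (f x - vdiv (uh τ) x) * q τ x)
        + ∫ x in tri τ, inner ℝ (u x - vval (uh τ) x) (gradient (q τ) x))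
      + ((∫ x in tri τ, f x * q τ x) + ∫ x in tri τ, inner ℝ (u x) (gradient (q τ) x)) := by
    intro τ
    have mq := M.memLp_tri_of_continuous (hq τ).continuous τ
    have mg := M.memLp_tri_of_continuous (continuous_gradient (hq τ)) τ
    have mf := M.memLp_tri hf τ
    have mu := M.memLp_tri h.u_mem τ
    have md := M.memLp_tri_of_continuous (continuous_vdiv (uh τ)) τ
    have mv := M.memLp_tri_of_continuous (continuous_vval (uh τ)) τ
    have e1 : ∫ x in tri τ, (f x - vdiv (uh τ) x) * q τ x =
        (∫ x in tri τ, f x * q τ x) - ∫ x in tri τ, vdiv (uh τ) x * q τ x := by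
      rw [← integral_sub (MemLp_two.integrable_mul mf mq) (MemLp_two.integrable_mul md mq)]
      simp_rw [sub_mul]
    have e2 : ∫ x in tri τ, inner ℝ (u x - vval (uh τ) x) (gradient (q τ) x) =
        (∫ x in tri τ, inner ℝ (u x) (gradient (q τ) x))
          - ∫ x in tri τ, inner ℝ (vval (uh τ) x) (gradient (q τ) x) := by
      rw [← integral_sub (MemLp_two.integrable_inner mu mg) (MemLp_two.integrable_inner mv mg)]
      simp_rw [inner_sub_left]
    -- Integration by parts of the discrete flux produces its divergence, which joins with `f` to
    -- form the residual.
    have e3 : M.bdryFlux τ (fun x => q τ x • vval (uh τ) x) =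
        (∫ x in tri τ, vdiv (uh τ) x * q τ x)
          + ∫ x in tri τ, inner ℝ (vval (uh τ) x) (gradient (q τ) x) := by
      rw [bdryFlux, ← M.green_tri τ (hq τ) (contDiff_vval _),
        ← integral_add (MemLp_two.integrable_mul md mq) (MemLp_two.integrable_inner mv mg)]
      congr 1
      ext x
      rw [divergence_vval, real_inner_comm, mul_comm]
    rw [e1, e2, e3]
    ring
  rw [Finset.sum_congr rfl fun τ _ => hτ τ, Finset.sum_add_distrib, Finset.sum_add_distrib,
    Finset.sum_neg_distrib]
  linarith

/-! ### Functions in the reference coordinates of a triangle -/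

/-- The function `Φ` of the reference coordinates. -/
def lift (τ : M.Tri) (Φ : ℝ × ℝ → ℝ) (x : Plane) : ℝ := Φ (co (src τ) (tgt τ) (ctr τ) x)

theorem contDiff_lift (τ : M.Tri) {Φ : ℝ × ℝ → ℝ} (hΦ : ContDiff ℝ 1 Φ) :
    ContDiff ℝ 1 (M.lift τ Φ) := hΦ.comp (contDiff_co _ _ _)

theorem lift_aff (τ : M.Tri) (Φ : ℝ × ℝ → ℝ) (p : ℝ × ℝ) :
    M.lift τ Φ (aff (src τ) (tgt τ) (ctr τ) p) = Φ p := by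
  rw [lift, co_aff (M.area_pos τ).ne']

theorem lift_outer (τ : M.Tri) (Φ : ℝ × ℝ → ℝ) (t : ℝ) :
    M.lift τ Φ (AffineMap.lineMap (src τ) (tgt τ) t) = Φ (t, 0) := by
  rw [← M.lift_aff τ Φ (t, 0), aff, AffineMap.lineMap_apply]
  congr 1
  simp [add_comm]

theorem lift_tgt_ctr (τ : M.Tri) (Φ : ℝ × ℝ → ℝ) (t : ℝ) :
    M.lift τ Φ (AffineMap.lineMap (tgt τ) (ctr τ) t) = Φ (1 - t, t) := by
  rw [← M.lift_aff τ Φ (1 - t, t), aff, AffineMap.lineMap_apply, vsub_eq_sub, vadd_eq_add]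
  congr 1
  module

theorem lift_ctr_src (τ : M.Tri) (Φ : ℝ × ℝ → ℝ) (t : ℝ) :
    M.lift τ Φ (AffineMap.lineMap (ctr τ) (src τ) t) = Φ (0, 1 - t) := by
  rw [← M.lift_aff τ Φ (0, 1 - t), aff, AffineMap.lineMap_apply, vsub_eq_sub, vadd_eq_add]
  congr 1
  module

theorem bdryFlux_lift (τ : M.Tri) {Φ : ℝ × ℝ → ℝ} (h1 : ∀ t, Φ (1 - t, t) = 0)
    (h2 : ∀ t, Φ (0, t) = 0) (F : Plane → Plane) :
    M.bdryFlux τ (fun x => M.lift τ Φ x • F x) =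
      flux (fun x => M.lift τ Φ x • F x) (src τ) (tgt τ) := by
  have e1 : flux (fun x => M.lift τ Φ x • F x) (tgt τ) (ctr τ) = 0 := by
    simp [flux, lift_tgt_ctr, h1]
  have e2 : flux (fun x => M.lift τ Φ x • F x) (ctr τ) (src τ) = 0 := by
    simp [flux, lift_ctr_src, h2]
  rw [bdryFlux, e1, e2, add_zero, add_zero]

theorem setIntegral_lift_sq (τ : M.Tri) (Φ : ℝ × ℝ → ℝ) :
    ∫ x in tri τ, M.lift τ Φ x ^ 2 = M.area τ * ∫ p in refTri, Φ p ^ 2 := by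
  simp_rw [M.setIntegral_tri, lift_aff]

/-- The gradients of the coordinates are rotated sides divided by twice the area, hence of size at
most $h_\tau/|\tau|$ up to a fixed factor. Shape regularity turns this into a multiple of
$h_\tau^{-1}$. -/
theorem lipschitzWith_co {ρ : ℝ} (hρ : 0 < ρ) (τ : M.Tri) (hreg : ρ * M.hTri τ ^ 2 ≤ M.area τ) :
    LipschitzWith (Real.toNNReal (ρ * M.hTri τ)⁻¹) (co (src τ) (tgt τ) (ctr τ)) := by
  have hh := hTri_pos τ
  have hA := M.area_pos τ
  refine LipschitzWith.of_dist_le_mul fun x y => ?_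
  rw [Real.coe_toNNReal _ (by positivity), dist_eq_norm, dist_eq_norm]
  have h1 : ‖ctr τ - src τ‖ ≤ M.hTri τ := dist_le_diam_tri (M.ctr_mem_tri τ) (M.src_mem_tri τ)
  have h2 : ‖tgt τ - src τ‖ ≤ M.hTri τ := dist_le_diam_tri (M.tgt_mem_tri τ) (M.src_mem_tri τ)
  have hd : M.hTri τ / M.area τ ≤ (ρ * M.hTri τ)⁻¹ := by
    rw [div_le_iff₀ hA, ← div_eq_inv_mul, le_div_iff₀ (by positivity)]
    linarith
  have e : co (src τ) (tgt τ) (ctr τ) x - co (src τ) (tgt τ) (ctr τ) y =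
      (cross (x - y) (ctr τ - src τ) / M.area τ, cross (tgt τ - src τ) (x - y) / M.area τ) := by
    unfold co
    ext <;> simp only [Prod.fst_sub, Prod.snd_sub] <;> rw [← sub_div] <;>
      change _ / M.area τ = _ <;> congr 1 <;> simp [cross] <;> ring
  rw [e, Prod.norm_mk, Real.norm_eq_abs, Real.norm_eq_abs, abs_div, abs_div, abs_of_pos hA]
  refine le_trans ?_ (mul_le_mul_of_nonneg_right hd (norm_nonneg _))
  rw [div_mul_eq_mul_div]
  refine max_le (div_le_div_of_nonneg_right ((abs_cross_le _ _).trans ?_) hA.le)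
    (div_le_div_of_nonneg_right ((abs_cross_le _ _).trans ?_) hA.le)
  · rw [mul_comm]
    exact mul_le_mul_of_nonneg_right h1 (norm_nonneg _)
  · exact mul_le_mul_of_nonneg_right h2 (norm_nonneg _)

/-- Chain rule: a derivative in the plane costs one factor from the Lipschitz constant of the
coordinates, which is compensated by the weight $h_\tau^2$. -/
theorem setIntegral_gradient_lift_le {ρ : ℝ} (hρ : 0 < ρ) (τ : M.Tri)
    (hreg : ρ * M.hTri τ ^ 2 ≤ M.area τ) {Φ : ℝ × ℝ → ℝ} (hΦ : ContDiff ℝ 1 Φ) :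
    M.hTri τ ^ 2 * ∫ x in tri τ, ‖gradient (M.lift τ Φ) x‖ ^ 2 ≤
      (ρ⁻¹) ^ 2 * (M.area τ * ∫ p in refTri, ‖fderiv ℝ Φ p‖ ^ 2) := by
  have hh := hTri_pos τ
  have hA := M.area_pos τ
  have hpt : ∀ p, ‖gradient (M.lift τ Φ) (aff (src τ) (tgt τ) (ctr τ) p)‖ ^ 2 ≤
      ((ρ * M.hTri τ)⁻¹) ^ 2 * ‖fderiv ℝ Φ p‖ ^ 2 := by
    intro p
    rw [← mul_pow]
    refine pow_le_pow_left₀ (norm_nonneg _) ?_ 2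
    have hc : DifferentiableAt ℝ (co (src τ) (tgt τ) (ctr τ)) (aff (src τ) (tgt τ) (ctr τ) p) :=
      ((contDiff_co _ _ _ (n := 1)).differentiable one_ne_zero) _
    have : ‖gradient (M.lift τ Φ) (aff (src τ) (tgt τ) (ctr τ) p)‖ =
        ‖fderiv ℝ (M.lift τ Φ) (aff (src τ) (tgt τ) (ctr τ) p)‖ := by
      rw [gradient, LinearIsometryEquiv.norm_map]
    rw [this, show M.lift τ Φ = Φ ∘ co (src τ) (tgt τ) (ctr τ) from rfl,
      fderiv_comp _ ((hΦ.differentiable one_ne_zero) _) hc, co_aff (M.area_pos τ).ne', mul_comm]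
    refine (ContinuousLinearMap.opNorm_comp_le _ _).trans
      (mul_le_mul_of_nonneg_left ?_ (norm_nonneg _))
    have := norm_fderiv_le_of_lipschitz ℝ (M.lipschitzWith_co hρ τ hreg)
      (x₀ := aff (src τ) (tgt τ) (ctr τ) p)
    rwa [Real.coe_toNNReal _ (by positivity)] at this
  have cf : Continuous fun p => ‖fderiv ℝ Φ p‖ ^ 2 := (hΦ.continuous_fderiv one_ne_zero).norm.pow 2
  have cg : Continuous fun p => ‖gradient (M.lift τ Φ) (aff (src τ) (tgt τ) (ctr τ) p)‖ ^ 2 :=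
    (((continuous_gradient (M.contDiff_lift τ hΦ)).comp (continuous_aff _ _ _)).norm).pow 2
  rw [M.setIntegral_tri]
  have := setIntegral_mono (cg.continuousOn.integrableOn_compact isCompact_refTri (μ := volume))
    ((cf.const_mul _).continuousOn.integrableOn_compact isCompact_refTri) hpt
  rw [integral_const_mul] at this
  calc _ ≤ M.hTri τ ^ 2 * (M.area τ * (((ρ * M.hTri τ)⁻¹) ^ 2 * ∫ p in refTri, ‖fderiv ℝ Φ p‖ ^ 2)) := by
        gcongr
    _ = _ := by rw [mul_inv, mul_pow]; field_simp

/-- Weighted bound for the residual of the balance tested with a lifted function. -/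
theorem abs_residual_le {ρ : ℝ} (hρ : 0 < ρ) (τ : M.Tri) (hreg : ρ * M.hTri τ ^ 2 ≤ M.area τ)
    {r : Plane → ℝ} {e : Plane → Plane} (hr : MemLp r 2 (volume.restrict (tri τ)))
    (he : MemLp e 2 (volume.restrict (tri τ))) {Φ : ℝ × ℝ → ℝ} (hΦ : ContDiff ℝ 1 Φ) {Y : ℝ}
    (h1 : ∫ p in refTri, Φ p ^ 2 ≤ Y) (h2 : ∫ p in refTri, ‖fderiv ℝ Φ p‖ ^ 2 ≤ Y) {δ : ℝ}
    (hδ : 0 < δ) :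
    |∫ x in tri τ, r x * M.lift τ Φ x| + |∫ x in tri τ, inner ℝ (e x) (gradient (M.lift τ Φ) x)| ≤
      δ⁻¹ * ((∫ x in tri τ, r x ^ 2) + (M.hTri τ ^ 2)⁻¹ * ∫ x in tri τ, ‖e x‖ ^ 2)
      + δ * ((1 + ρ⁻¹ ^ 2) * (M.area τ * Y)) := by
  have hh := hTri_pos τ
  have hA := M.area_pos τ
  have a1 := abs_integral_mul_le hr (M.memLp_tri_of_continuous (M.contDiff_lift τ hΦ).continuous τ) hδ
  -- The Young parameter carries $h_\tau^2$ because the gradient of the lifted function is of size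
  -- $h_\tau^{-1}$; both terms then scale like the area.
  have a2 := abs_integral_inner_le he (M.memLp_tri_of_continuous
    (continuous_gradient (M.contDiff_lift τ hΦ)) τ) (mul_pos hδ (pow_pos hh 2))
  rw [M.setIntegral_lift_sq] at a1
  have b1 : δ * (M.area τ * ∫ p in refTri, Φ p ^ 2) ≤ δ * (M.area τ * Y) := by gcongr
  have b2 : δ * M.hTri τ ^ 2 * ∫ x in tri τ, ‖gradient (M.lift τ Φ) x‖ ^ 2 ≤
      δ * (ρ⁻¹ ^ 2 * (M.area τ * Y)) := by
    rw [mul_assoc]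
    refine mul_le_mul_of_nonneg_left ((M.setIntegral_gradient_lift_le hρ τ hreg hΦ).trans ?_) hδ.le
    gcongr
  rw [mul_inv] at a2
  calc _ ≤ (δ⁻¹ * (∫ x in tri τ, r x ^ 2) + δ * (M.area τ * Y))
      + (δ⁻¹ * (M.hTri τ ^ 2)⁻¹ * (∫ x in tri τ, ‖e x‖ ^ 2) + δ * (ρ⁻¹ ^ 2 * (M.area τ * Y))) :=
        add_le_add (a1.trans (by linarith)) (a2.trans (by linarith))
    _ = _ := by ring

end Mesh

/-! ### The bulk residual and the jumps of the discrete flux -/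

theorem totalDegree_pderiv_le (i : Fin 2) (q : MvPolynomial (Fin 2) ℝ) :
    (MvPolynomial.pderiv i q).totalDegree ≤ q.totalDegree := by
  refine Finset.sup_le fun d hd => ?_
  rw [MvPolynomial.mem_support_iff, MvPolynomial.coeff_pderiv] at hd
  have h := MvPolynomial.le_totalDegree (MvPolynomial.mem_support_iff.2 (left_ne_zero_of_mul hd))
  refine le_trans ?_ h
  rw [Finsupp.sum_add_index' (fun _ => rfl) (fun _ _ _ => rfl)]
  exact Nat.le_add_right _ _

namespace Mesh

variable {D : FracturedDomain} (M : Mesh D)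

theorem memLp_residual {f : Plane → ℝ} (hf : MemLp f 2 D.bulk) (uh : M.PwVec) (τ : M.Tri) :
    MemLp (fun x => f x - vdiv (uh τ) x) 2 (volume.restrict (tri τ)) :=
  (M.memLp_tri hf τ).sub (M.memLp_tri_of_continuous (continuous_vdiv (uh τ)) τ)

theorem memLp_error {u : Plane → Plane} (hu : MemLp u 2 D.bulk) (uh : M.PwVec) (τ : M.Tri) :
    MemLp (fun x => u x - vval (uh τ) x) 2 (volume.restrict (tri τ)) :=
  (M.memLp_tri hu τ).sub (M.memLp_tri_of_continuous (continuous_vval (uh τ)) τ)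

end Mesh

/-- Local efficiency of the bulk residual. -/
theorem exists_bulkResidual_le (D : FracturedDomain) (N : ℕ) {ρ : ℝ} (hρ : 0 < ρ) :
    ∃ C : ℝ, 0 < C ∧ ∀ (M : Mesh D) (c : Coefficients D) (f : Plane → ℝ) (fΓ : ℝ → ℝ)
      (u : Plane → Plane) (p : BulkH1 D) (pΓ : FracH10 D), IsWeakSolution c f fΓ u p pΓ →
      MemLp f 2 D.bulk → ∀ (uh : M.PwVec) (fh : M.PwPoly) (τ : M.Tri),
      (∀ i, (uh τ i).totalDegree ≤ N) → (fh τ).totalDegree ≤ N → ρ * M.hTri τ ^ 2 ≤ M.area τ →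
      M.hTri τ ^ 2 * ∫ x in tri τ, (f x - vdiv (uh τ) x) ^ 2 ≤
        C * ((∫ x in tri τ, ‖u x - vval (uh τ) x‖ ^ 2)
          + M.hTri τ ^ 2 * ∫ x in tri τ, (f x - pval (fh τ) x) ^ 2) := by
  obtain ⟨B, hB, hb⟩ := exists_bubble_bound N
  set B' := B * (1 + ρ⁻¹ ^ 2) with hB'
  have hB'0 : 0 < B' := by positivity
  refine ⟨8 * B * B' + 2, by positivity, ?_⟩
  intro M c f fΓ u p pΓ h hf uh fh τ huh hfh hreg
  have hh := Mesh.hTri_pos τ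
  have hA := M.area_pos τ
  -- The polynomial part of the residual; what remains of `f` is oscillation.
  set w : MvPolynomial (Fin 2) ℝ :=
    fh τ - (MvPolynomial.pderiv 0 (uh τ 0) + MvPolynomial.pderiv 1 (uh τ 1)) with hw
  have hwN : w.totalDegree ≤ N := by
    refine (MvPolynomial.totalDegree_sub _ _).trans (max_le hfh ?_)
    exact (MvPolynomial.totalDegree_add _ _).trans
      (max_le ((totalDegree_pderiv_le _ _).trans (huh 0)) ((totalDegree_pderiv_le _ _).trans (huh 1)))
  have hwv : ∀ x, pval w x = pval (fh τ) x - vdiv (uh τ) x := fun x => by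
    rw [hw, pval_sub, pval_add, vdiv]
  set W := pullback (src τ) (tgt τ) (ctr τ) w with hW
  obtain ⟨ha0, hb1, hb2, hb3⟩ := hb W ((totalDegree_pullback_le _ _ _ _).trans hwN)
  set a := ∫ p in refTri, bubble p * rval W p ^ 2 with ha
  set Φ : ℝ × ℝ → ℝ := fun p => bubble p * rval W p with hΦ
  have cΦ : ContDiff ℝ 1 Φ := contDiff_bubble.mul (contDiff_rval _)
  -- The bubble vanishes on all three sides, so its product with any field has no boundary flux.
  -- This makes the test function admissible and removes the left side of the residual identity.
  have hbd : ∀ F : Plane → Plane, M.bdryFlux τ (fun x => M.lift τ Φ x • F x) = 0 := by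
    intro F
    rw [M.bdryFlux_lift τ (fun t => by simp [hΦ, bubble]) (fun t => by simp [hΦ, bubble])]
    simp [flux, Mesh.lift_outer, hΦ, bubble]
  have hres := M.sum_residual h hf uh (s := {τ}) (i := M.sub τ.1) (fun σ hσ => by
      rw [Finset.mem_singleton.1 hσ]) (q := fun _ => M.lift τ Φ) (fun _ => M.contDiff_lift τ cΦ)
    (fun φ _ => by rw [Finset.sum_singleton, hbd])
  rw [Finset.sum_singleton, Finset.sum_singleton, hbd] at hres
  have mf : MemLp (fun x => f x - pval (fh τ) x) 2 (volume.restrict (tri τ)) :=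
    (M.memLp_tri hf τ).sub (M.memLp_tri_of_continuous (continuous_pval _) τ)
  have mw : MemLp (pval w) 2 (volume.restrict (tri τ)) :=
    M.memLp_tri_of_continuous (continuous_pval _) τ
  have ml := M.memLp_tri_of_continuous (M.contDiff_lift τ cΦ).continuous τ
  -- The polynomial part of the residual against its bubble is the weighted norm `a`, scaled by the
  -- area.
  have hsplit : ∫ x in tri τ, (f x - vdiv (uh τ) x) * M.lift τ Φ x =
      (∫ x in tri τ, (f x - pval (fh τ) x) * M.lift τ Φ x) + M.area τ * a := by
    have : M.area τ * a = ∫ x in tri τ, pval w x * M.lift τ Φ x := by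
      rw [M.setIntegral_tri, ha]
      congr 2
      ext p
      rw [M.lift_aff, ← rval_pullback]
      simp only [hΦ, hW]
      ring
    rw [this, ← integral_add (MemLp_two.integrable_mul mf ml) (MemLp_two.integrable_mul mw ml)]
    congr 1
    ext x
    rw [hwv]
    ring
  set r2 := ∫ x in tri τ, (f x - pval (fh τ) x) ^ 2 with hr2
  set e2 := ∫ x in tri τ, ‖u x - vval (uh τ) x‖ ^ 2 with he2
  -- With this parameter the test function costs half of `M.area τ * a`, which is absorbed.
  have hδ : 0 < (2 * B')⁻¹ := by positivity
  have hy := M.abs_residual_le hρ τ hreg mf (M.memLp_error h.u_mem uh τ) cΦ hb2 hb3 hδ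
  rw [inv_inv] at hy
  have hAa : 0 ≤ M.area τ * a := mul_nonneg hA.le ha0
  have hδY : (2 * B')⁻¹ * ((1 + ρ⁻¹ ^ 2) * (M.area τ * (B * a))) = M.area τ * a / 2 := by
    rw [hB']; field_simp
  rw [hδY] at hy
  have hX : M.area τ * a ≤ 4 * B' * (r2 + (M.hTri τ ^ 2)⁻¹ * e2) := by
    have t1 := neg_abs_le (∫ x in tri τ, (f x - pval (fh τ) x) * M.lift τ Φ x)
    have t2 := neg_abs_le (∫ x in tri τ, inner ℝ (u x - vval (uh τ) x) (gradient (M.lift τ Φ) x))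
    linarith
  have hw2 : ∫ x in tri τ, pval w x ^ 2 ≤ B * (M.area τ * a) := by
    rw [M.setIntegral_tri]
    calc _ = M.area τ * ∫ p in refTri, rval W p ^ 2 := by simp_rw [hW, rval_pullback]
      _ ≤ M.area τ * (B * a) := by gcongr
      _ = _ := by ring
  have hsq : ∫ x in tri τ, (f x - vdiv (uh τ) x) ^ 2 ≤ 2 * r2 + 2 * ∫ x in tri τ, pval w x ^ 2 := by
    have i1 := mf.integrable_sq.const_mul 2
    have i2 := mw.integrable_sq.const_mul 2
    rw [hr2, ← integral_const_mul, ← integral_const_mul, ← integral_add i1 i2]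
    refine integral_mono (M.memLp_residual hf uh τ).integrable_sq (i1.add i2) fun x => ?_
    simp only [hwv]
    nlinarith [sq_nonneg ((f x - pval (fh τ) x) - (pval (fh τ) x - vdiv (uh τ) x))]
  have hr0 : 0 ≤ r2 := integral_nonneg fun x => sq_nonneg _
  have he0 : 0 ≤ e2 := integral_nonneg fun x => sq_nonneg _
  have hfin : ∫ x in tri τ, (f x - vdiv (uh τ) x) ^ 2 ≤
      2 * r2 + 8 * B * B' * (r2 + (M.hTri τ ^ 2)⁻¹ * e2) := by
    have := mul_le_mul_of_nonneg_left hX hB.le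
    nlinarith
  calc _ ≤ M.hTri τ ^ 2 * (2 * r2 + 8 * B * B' * (r2 + (M.hTri τ ^ 2)⁻¹ * e2)) := by gcongr
    _ = (8 * B * B' + 2) * (M.hTri τ ^ 2 * r2) + 8 * B * B' * e2 := by field_simp; ring
    _ ≤ _ := by nlinarith

namespace Mesh

variable {D : FracturedDomain} (M : Mesh D)

/-- The flux of the edge bubble functions on the two triangles at a primal edge. -/
theorem bdryFlux_edgeBubble {τ τ' : M.Tri} (h1 : src τ = tgt τ') (h2 : tgt τ = src τ')
    (w : Polynomial ℝ) {F G : Plane → Plane} (hF : Continuous F) (hG : Continuous G) :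
    M.bdryFlux τ (fun x => M.lift τ (edgeBubble w) x • F x)
      + M.bdryFlux τ' (fun x => M.lift τ' (edgeBubble (w.comp (1 - Polynomial.X))) x • G x) =
    ∫ t in (0 : ℝ)..1, t * (1 - t) * w.eval t *
      inner ℝ (F (AffineMap.lineMap (src τ) (tgt τ) t) - G (AffineMap.lineMap (src τ) (tgt τ) t))
        (rotcw (tgt τ - src τ)) := by
  rw [M.bdryFlux_lift τ (fun t => by simp [edgeBubble]) (fun t => by simp [edgeBubble]),
    M.bdryFlux_lift τ' (fun t => by simp [edgeBubble]) (fun t => by simp [edgeBubble]),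
    ← h1, ← h2, flux_swap _ (tgt τ), ← sub_eq_add_neg]
  -- The neighbour traverses the edge backwards; the substitution of `1 - X` makes the two bubbles
  -- agree there, so the combined function is continuous.
  have hl : ∀ t : ℝ, M.lift τ' (edgeBubble (w.comp (1 - Polynomial.X)))
      (AffineMap.lineMap (src τ) (tgt τ) t) = t * (1 - t) * w.eval t := by
    intro t
    rw [← AffineMap.lineMap_apply_one_sub, h1, h2, M.lift_outer]
    simp only [edgeBubble, Polynomial.eval_comp, Polynomial.eval_sub, Polynomial.eval_one,
      Polynomial.eval_X, sub_zero, sub_sub_cancel]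
    ring
  have cw : Continuous fun t => w.eval t := w.continuous
  have cF := hF.comp (continuous_lineMap (src τ) (tgt τ))
  have cG := hG.comp (continuous_lineMap (src τ) (tgt τ))
  unfold flux
  rw [← intervalIntegral.integral_sub]
  · congr 1
    ext t
    beta_reduce
    rw [hl, M.lift_outer, inner_sub_left, real_inner_smul_left, real_inner_smul_left, edgeBubble]
    ring
  · simp_rw [M.lift_outer, real_inner_smul_left, edgeBubble]
    exact Continuous.intervalIntegrable
      (Continuous.mul (by fun_prop) (cF.inner continuous_const)) _ _
  · simp_rw [hl, real_inner_smul_left]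
    exact Continuous.intervalIntegrable
      (Continuous.mul (by fun_prop) (cG.inner continuous_const)) _ _

/-- The jump of the normal component as a polynomial. -/
def jumpPoly (v : M.PwVec) (e : M.Tri × M.Tri) : MvPolynomial (Fin 2) ℝ :=
  outerNormal e.1 0 • (v e.1 0 - v e.2 0) + outerNormal e.1 1 • (v e.1 1 - v e.2 1)

theorem pval_jumpPoly (v : M.PwVec) (e : M.Tri × M.Tri) (x : Plane) :
    pval (M.jumpPoly v e) x = M.jumpE v e x := by
  rw [jumpPoly, pval_add, pval_smul, pval_smul, pval_sub, pval_sub, jumpE, plane_inner, plane_inner]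
  simp [vval]
  ring

theorem totalDegree_jumpPoly_le {k : ℕ} {v : M.PwVec} (hv : ∀ τ i, (v τ i).totalDegree ≤ k)
    (e : M.Tri × M.Tri) : (M.jumpPoly v e).totalDegree ≤ k := by
  refine (MvPolynomial.totalDegree_add _ _).trans (max_le ?_ ?_) <;>
    exact (MvPolynomial.totalDegree_smul_le _ _).trans
      ((MvPolynomial.totalDegree_sub _ _).trans (max_le (hv _ _) (hv _ _)))

end Mesh

/-- Local efficiency of the jump of the normal component on a primal edge. -/
theorem exists_jumpE_le (D : FracturedDomain) (N : ℕ) {ρ : ℝ} (hρ : 0 < ρ) :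
    ∃ C : ℝ, 0 < C ∧ ∀ (M : Mesh D) (c : Coefficients D) (f : Plane → ℝ) (fΓ : ℝ → ℝ)
      (u : Plane → Plane) (p : BulkH1 D) (pΓ : FracH10 D), IsWeakSolution c f fΓ u p pΓ →
      MemLp f 2 D.bulk → ∀ uh : M.PwVec, (∀ τ i, (uh τ i).totalDegree ≤ N) →
      (∀ τ, ρ * M.hTri τ ^ 2 ≤ M.area τ) → ∀ e ∈ M.intEdges,
      outerLen e.1 * edgeInt (src e.1) (tgt e.1) (fun x => M.jumpE uh e x ^ 2) ≤
        C * (((∫ x in tri e.1, ‖u x - vval (uh e.1) x‖ ^ 2)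
            + M.hTri e.1 ^ 2 * ∫ x in tri e.1, (f x - vdiv (uh e.1) x) ^ 2)
          + ((∫ x in tri e.2, ‖u x - vval (uh e.2) x‖ ^ 2)
            + M.hTri e.2 ^ 2 * ∫ x in tri e.2, (f x - vdiv (uh e.2) x) ^ 2)) := by
  obtain ⟨B, hB, hb⟩ := exists_edgeBubble_bound N
  set B' := B * (1 + ρ⁻¹ ^ 2) with hB'
  have hB'0 : 0 < B' := by positivity
  refine ⟨8 * B * B', by positivity, ?_⟩
  rintro M c f fΓ u p pΓ h hf uh huh hreg ⟨τ, τ'⟩ he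
  obtain ⟨hsub, h1, h2⟩ := M.mem_intEdges_iff he
  simp only
  have hne : τ' ≠ τ := fun h' => M.src_ne_tgt τ (by rw [h1, h'])
  set l := outerLen τ with hl
  have hl0 : 0 < l := Mesh.outerLen_pos τ
  -- The normal jump as a polynomial on the unit interval. Both factors of the test function are
  -- built from it, and the flux of the test function across the edge is the weighted norm `l * a`.
  set w := onLine (src τ) (tgt τ - src τ) (M.jumpPoly uh (τ, τ')) with hw
  have hwN : w.natDegree ≤ N := natDegree_onLine_le _ _ (M.totalDegree_jumpPoly_le huh _)
  set w' := w.comp (1 - Polynomial.X) with hw'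
  have hwN' : w'.natDegree ≤ N := by
    refine Polynomial.natDegree_comp_le.trans ((Nat.mul_le_mul_left _ ?_).trans
      ((mul_one _).le.trans hwN))
    exact (Polynomial.natDegree_sub_le _ _).trans (by simp)
  have hwe : ∀ t : ℝ, w.eval t = M.jumpE uh (τ, τ') (AffineMap.lineMap (src τ) (tgt τ) t) := by
    intro t
    rw [hw, eval_onLine, M.pval_jumpPoly, AffineMap.lineMap_apply, vsub_eq_sub, vadd_eq_add,
      add_comm]
  obtain ⟨ha0, b1, -, -, b4, b5⟩ := hb w hwN
  obtain ⟨-, -, -, -, b4', b5'⟩ := hb w' hwN'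
  set a := ∫ s in (0 : ℝ)..1, s * (1 - s) * w.eval s ^ 2 with ha
  have haa : ∫ s in (0 : ℝ)..1, s * (1 - s) * w'.eval s ^ 2 = a := by
    have := intervalIntegral.integral_comp_sub_left (a := 0) (b := 1)
      (fun s => s * (1 - s) * w.eval s ^ 2) 1
    rw [sub_self, sub_zero] at this
    rw [ha, ← this]
    congr 1
    ext s
    simp only [hw', Polynomial.eval_comp, Polynomial.eval_sub, Polynomial.eval_one,
      Polynomial.eval_X]
    ring
  rw [haa] at b4' b5'
  set Φ : M.Tri → ℝ × ℝ → ℝ := fun σ => if σ = τ then edgeBubble w else edgeBubble w' with hΦ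
  have hΦ1 : Φ τ = edgeBubble w := if_pos rfl
  have hΦ2 : Φ τ' = edgeBubble w' := if_neg hne
  have cΦ : ∀ σ, ContDiff ℝ 1 (Φ σ) := by
    intro σ
    simp only [hΦ]
    split_ifs <;> exact contDiff_edgeBubble _
  have hres := M.sum_residual h hf uh (s := {τ, τ'}) (i := M.sub τ.1) (fun σ hσ => by
      rcases Finset.mem_insert.1 hσ with rfl | hσ
      · rfl
      · rw [Finset.mem_singleton.1 hσ, hsub]) (q := fun σ => M.lift σ (Φ σ))
    (fun σ => M.contDiff_lift σ (cΦ σ))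
    (fun φ hφ => by
      rw [Finset.sum_pair hne.symm, hΦ1, hΦ2,
        M.bdryFlux_edgeBubble h1 h2 w hφ.continuous hφ.continuous]
      simp)
  rw [Finset.sum_pair hne.symm, Finset.sum_pair hne.symm, hΦ1, hΦ2,
    M.bdryFlux_edgeBubble h1 h2 w (continuous_vval _) (continuous_vval _)] at hres
  have hla : ∫ t in (0 : ℝ)..1, t * (1 - t) * w.eval t *
      inner ℝ (vval (uh τ) (AffineMap.lineMap (src τ) (tgt τ) t)
        - vval (uh τ') (AffineMap.lineMap (src τ) (tgt τ) t)) (rotcw (tgt τ - src τ)) = l * a := by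
    rw [ha, ← intervalIntegral.integral_const_mul]
    congr 1
    ext t
    have : inner ℝ (vval (uh τ) (AffineMap.lineMap (src τ) (tgt τ) t)
        - vval (uh τ') (AffineMap.lineMap (src τ) (tgt τ) t)) (rotcw (tgt τ - src τ)) =
        l * w.eval t := by
      rw [hwe, Mesh.jumpE, ← inner_sub_left, outerNormal, real_inner_smul_right, ← hl,
        mul_inv_cancel_left₀ hl0.ne']
    rw [this]
    ring
  rw [hla] at hres
  have hR : ∀ σ : M.Tri, (∫ p in refTri, Φ σ p ^ 2 ≤ B * a) →
      (∫ p in refTri, ‖fderiv ℝ (Φ σ) p‖ ^ 2 ≤ B * a) →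
      |∫ x in tri σ, (f x - vdiv (uh σ) x) * M.lift σ (Φ σ) x|
        + |∫ x in tri σ, inner ℝ (u x - vval (uh σ) x) (gradient (M.lift σ (Φ σ)) x)| ≤
      4 * B' * l⁻¹ * ((∫ x in tri σ, ‖u x - vval (uh σ) x‖ ^ 2)
        + M.hTri σ ^ 2 * ∫ x in tri σ, (f x - vdiv (uh σ) x) ^ 2) + l * a / 4 := by
    intro σ k1 k2
    have hh := Mesh.hTri_pos σ
    -- Each of the two triangles costs `l * a / 4`, by the upper bound of the area, so half of `l *
    -- a` is absorbed. The factor `l⁻¹` in the other term cancels against the weight of the jump,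
    -- and no comparison of `l` with the diameters is needed.
    have hδ : 0 < l * (4 * B' * M.hTri σ ^ 2)⁻¹ := by positivity
    refine (M.abs_residual_le hρ σ (hreg σ) (M.memLp_residual hf uh σ)
      (M.memLp_error h.u_mem uh σ) (cΦ σ) k1 k2 hδ).trans ?_
    refine add_le_add (le_of_eq (by field_simp; ring)) ?_
    have : l * (4 * B' * M.hTri σ ^ 2)⁻¹ * ((1 + ρ⁻¹ ^ 2) * (M.area σ * (B * a))) =
        l * a / 4 * (M.area σ / M.hTri σ ^ 2) := by
      rw [hB']; field_simp
    rw [this]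
    refine mul_le_of_le_one_right (by positivity) ?_
    rw [div_le_one (by positivity)]
    exact M.area_le σ
  have r1 := hR τ (by rwa [hΦ1]) (by rwa [hΦ1])
  have r2 := hR τ' (by rwa [hΦ2]) (by rwa [hΦ2])
  rw [hΦ1] at r1
  rw [hΦ2] at r2
  set E1 := (∫ x in tri τ, ‖u x - vval (uh τ) x‖ ^ 2)
    + M.hTri τ ^ 2 * ∫ x in tri τ, (f x - vdiv (uh τ) x) ^ 2
  set E2 := (∫ x in tri τ', ‖u x - vval (uh τ') x‖ ^ 2)
    + M.hTri τ' ^ 2 * ∫ x in tri τ', (f x - vdiv (uh τ') x) ^ 2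
  have hX : l * a ≤ 8 * B' * l⁻¹ * (E1 + E2) := by
    have t1 := neg_abs_le (∫ x in tri τ, (f x - vdiv (uh τ) x) * M.lift τ (edgeBubble w) x)
    have t2 := neg_abs_le
      (∫ x in tri τ, inner ℝ (u x - vval (uh τ) x) (gradient (M.lift τ (edgeBubble w)) x))
    have t3 := neg_abs_le (∫ x in tri τ', (f x - vdiv (uh τ') x) * M.lift τ' (edgeBubble w') x)
    have t4 := neg_abs_le
      (∫ x in tri τ', inner ℝ (u x - vval (uh τ') x) (gradient (M.lift τ' (edgeBubble w')) x))
    linarith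
  have hJ : edgeInt (src τ) (tgt τ) (fun x => M.jumpE uh (τ, τ') x ^ 2) =
      l * ∫ s in (0 : ℝ)..1, w.eval s ^ 2 := by
    rw [edgeInt]
    simp_rw [hwe]
    rfl
  rw [hJ]
  calc l * (l * ∫ s in (0 : ℝ)..1, w.eval s ^ 2) ≤ l * (l * (B * a)) := by gcongr
    _ = B * l * (l * a) := by ring
    _ ≤ B * l * (8 * B' * l⁻¹ * (E1 + E2)) := by gcongr
    _ = _ := by field_simp

/-! ### The fracture -/

theorem Coefficients.KΓ_bdd {D : FracturedDomain} (c : Coefficients D) :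
    ∃ a b : ℝ, 0 < a ∧ ∀ᵐ s ∂D.frac, a ≤ c.KΓ s ∧ c.KΓ s ≤ b := by
  obtain ⟨a, b, ha, h⟩ := c.κt_bdd
  obtain ⟨a', b', ha', h'⟩ := c.ℓ_bdd
  refine ⟨a * a', b * b', by positivity, ?_⟩
  filter_upwards [h, h'] with s hs hs'
  have := ha.trans_le hs.1
  have := ha'.trans_le hs'.1
  exact ⟨mul_le_mul hs.1 hs'.1 ha'.le (by positivity),
    mul_le_mul hs.2 hs'.2 (by positivity) (by linarith [hs.2])⟩

theorem Coefficients.ηΓ_bdd {D : FracturedDomain} (c : Coefficients D) :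
    ∃ a : ℝ, 0 < a ∧ ∀ᵐ s ∂D.frac, a ≤ c.ηΓ s := by
  obtain ⟨a, b, ha, h⟩ := c.κn_bdd
  obtain ⟨a', b', ha', h'⟩ := c.ℓ_bdd
  -- The upper bound `b` is not assumed positive, so the denominator is made positive by hand.
  refine ⟨a' / max b 1, by positivity, ?_⟩
  filter_upwards [h, h'] with s hs hs'
  have := ha.trans_le hs.1
  exact div_le_div₀ (ha'.le.trans hs'.1) hs'.1 this (hs.2.trans (le_max_left _ _))

theorem Coefficients.αΓ_bdd {D : FracturedDomain} (c : Coefficients D) :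
    ∃ a : ℝ, 0 < a ∧ ∀ᵐ s ∂D.frac, a ≤ c.αΓ s := by
  obtain ⟨a, ha, h⟩ := c.ηΓ_bdd
  have hξ : 0 < c.ξ / 2 - 1 / 4 := by linarith [c.ξ_gt]
  refine ⟨a * (c.ξ / 2 - 1 / 4), by positivity, ?_⟩
  filter_upwards [h] with s hs
  exact mul_le_mul_of_nonneg_right hs hξ.le

theorem Coefficients.measurable_ηΓ {D : FracturedDomain} (c : Coefficients D) : Measurable c.ηΓ :=
  c.ℓ_meas.div c.κn_meas

theorem Coefficients.measurable_αΓ {D : FracturedDomain} (c : Coefficients D) : Measurable c.αΓ :=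
  c.measurable_ηΓ.mul_const _

theorem Coefficients.measurable_KΓ {D : FracturedDomain} (c : Coefficients D) : Measurable c.KΓ :=
  c.κt_meas.mul c.ℓ_meas

theorem ae_abs_inv_le {α : Type*} [MeasurableSpace α] {μ : Measure α} {κ : α → ℝ} {a : ℝ}
    (ha : 0 < a) (h : ∀ᵐ s ∂μ, a ≤ κ s) : ∀ᵐ s ∂μ, |(κ s)⁻¹| ≤ a⁻¹ := by
  filter_upwards [h] with s hs
  rw [abs_of_pos (inv_pos.2 (ha.trans_le hs))]
  exact inv_anti₀ ha hs

theorem ae_abs_le {α : Type*} [MeasurableSpace α] {μ : Measure α} {κ : α → ℝ} {a b : ℝ}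
    (ha : 0 < a) (h : ∀ᵐ s ∂μ, a ≤ κ s ∧ κ s ≤ b) : ∀ᵐ s ∂μ, |κ s| ≤ b := by
  filter_upwards [h] with s hs
  rw [abs_of_pos (ha.trans_le hs.1)]
  exact hs.2

theorem FracturedDomain.integral_frac (D : FracturedDomain) (g : ℝ → ℝ) :
    ∫ s in (0 : ℝ)..D.L, g s = ∫ s, g s ∂D.frac := by
  rw [intervalIntegral.integral_of_le D.L_pos.le, FracturedDomain.frac, integral_Icc_eq_integral_Ioc]

theorem FracturedDomain.intervalIntegrable (D : FracturedDomain) {g : ℝ → ℝ}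
    (hg : Integrable g D.frac) {s t : ℝ} (hs : s ∈ Icc 0 D.L) (ht : t ∈ Icc 0 D.L) :
    IntervalIntegrable g volume s t := by
  have h : IntervalIntegrable g volume 0 D.L :=
    (intervalIntegrable_iff_integrableOn_Icc_of_le D.L_pos.le).2 hg
  refine h.mono_set ?_
  rw [uIcc_of_le D.L_pos.le]
  exact uIcc_subset_Icc hs ht

instance (D : FracturedDomain) : IsFiniteMeasure D.frac :=
  inferInstanceAs (IsFiniteMeasure (volume.restrict (Icc 0 D.L)))

theorem FracH10.integrable_der {D : FracturedDomain} (q : FracH10 D) : Integrable q.der D.frac :=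
  q.der_mem.integrable one_le_two

theorem FracH10.continuousOn {D : FracturedDomain} (q : FracH10 D) :
    ContinuousOn q.val (Icc 0 D.L) := by
  refine ContinuousOn.congr ?_ q.val_eq
  have := intervalIntegral.continuousOn_primitive_interval (a := 0) (b := D.L) (f := q.der)
    (μ := volume) (by rw [uIcc_of_le D.L_pos.le]; exact q.integrable_der)
  rwa [uIcc_of_le D.L_pos.le] at this

theorem FracH10.memLp {D : FracturedDomain} (q : FracH10 D) : MemLp q.val 2 D.frac := by
  obtain ⟨C, hC⟩ := isCompact_Icc.exists_bound_of_continuousOn q.continuousOn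
  refine MemLp.of_bound (q.continuousOn.aestronglyMeasurable measurableSet_Icc) C ?_
  exact (ae_restrict_iff' measurableSet_Icc).2 (Filter.Eventually.of_forall hC)

theorem BulkH1.memLp_avg {D : FracturedDomain} (q : BulkH1 D) : MemLp q.avg 2 D.frac := by
  have := ((q.tr_mem 0).add (q.tr_mem 1)).const_mul (2⁻¹ : ℝ)
  refine this.ae_eq (Filter.Eventually.of_forall fun s => ?_)
  simp [BulkH1.avg]; ring

theorem BulkH1.memLp_jump {D : FracturedDomain} (q : BulkH1 D) : MemLp q.jump 2 D.frac :=
  (q.tr_mem 0).sub (q.tr_mem 1)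

/-! ### Normal traces of the exact flux -/

section NormalTraces

variable {D : FracturedDomain} (c : Coefficients D) (p : BulkH1 D) (pΓ : FracH10 D)

/-- The jump of the normal flux across the fracture. -/
def fluxJump (s : ℝ) : ℝ := (c.αΓ s)⁻¹ * (p.avg s - pΓ.val s)

/-- The average of the normal flux on the fracture. -/
def fluxAvg (s : ℝ) : ℝ := (c.ηΓ s)⁻¹ * p.jump s

/-- The normal fluxes from the two sides of the fracture. -/
def normalFlux (i : Fin 2) (s : ℝ) : ℝ :=
  fluxAvg c p s + (if i = 0 then 1 / 2 else -(1 / 2)) * fluxJump c p pΓ s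

theorem memLp_fluxJump : MemLp (fluxJump c p pΓ) 2 D.frac := by
  obtain ⟨a, ha, h⟩ := c.αΓ_bdd
  exact MemLp_two.bdd_smul (p.memLp_avg.sub pΓ.memLp) c.measurable_αΓ.inv.aestronglyMeasurable
    (ae_abs_inv_le ha h)

theorem memLp_fluxAvg : MemLp (fluxAvg c p) 2 D.frac := by
  obtain ⟨a, ha, h⟩ := c.ηΓ_bdd
  exact MemLp_two.bdd_smul p.memLp_jump c.measurable_ηΓ.inv.aestronglyMeasurable
    (ae_abs_inv_le ha h)

theorem normalFlux_sub (s : ℝ) :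
    normalFlux c p pΓ 0 s - normalFlux c p pΓ 1 s = fluxJump c p pΓ s := by
  simp [normalFlux]; ring

theorem normalFlux_add (s : ℝ) :
    (normalFlux c p pΓ 0 s + normalFlux c p pΓ 1 s) / 2 = fluxAvg c p s := by
  simp [normalFlux]; ring

/-- The interface terms of the balance are the flux jump against the mean of `q` plus the mean flux
against the jump of `q`, which is `g 0 * q.tr 0 - g 1 * q.tr 1` for one-sided fluxes with this jump
and this mean. The weak divergence is `f`. -/
theorem IsWeakSolution.hasNormalTraces {c : Coefficients D} {p : BulkH1 D} {pΓ : FracH10 D}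
    {f : Plane → ℝ} {fΓ : ℝ → ℝ} {u : Plane → Plane} (h : IsWeakSolution c f fΓ u p pΓ)
    (hf : MemLp f 2 D.bulk) : HasNormalTraces D u (normalFlux c p pΓ) := by
  refine ⟨fun i => (memLp_fluxAvg c p).add ((memLp_fluxJump c p pΓ).const_mul _), f, hf,
    fun q => ?_⟩
  have hb := h.balance q
  rw [integral_add (MemLp_two.integrable_inner h.u_mem q.grad_mem)
    (MemLp_two.integrable_mul hf q.val_mem), ← hb, add_sub_cancel]
  have i1 := MemLp_two.integrable_mul (memLp_fluxJump c p pΓ) q.memLp_avg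
  have i2 := MemLp_two.integrable_mul (memLp_fluxAvg c p) q.memLp_jump
  simp_rw [D.integral_frac]
  change (∫ s, fluxJump c p pΓ s * q.avg s ∂D.frac) + (∫ s, fluxAvg c p s * q.jump s ∂D.frac) = _
  rw [← integral_add i1 i2]
  congr 1
  ext s
  simp only [normalFlux, BulkH1.avg, BulkH1.jump, if_true, Fin.one_eq_zero_iff, OfNat.ofNat_ne_one,
    if_false]
  ring

end NormalTraces

/-! ### Fracture edges and conforming piecewise polynomials -/

namespace Mesh

variable {D : FracturedDomain} (M : Mesh D)

/-- Length on a fracture edge. -/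
def edge (j : Fin (M.nΓ + 1)) : Measure ℝ :=
  volume.restrict (Ioo (M.node j.castSucc) (M.node j.succ))

instance (j : Fin (M.nΓ + 1)) : IsFiniteMeasure (M.edge j) :=
  inferInstanceAs (IsFiniteMeasure (volume.restrict (Ioo _ _)))

theorem intFrac_eq_integral (j : Fin (M.nΓ + 1)) (g : ℝ → ℝ) :
    M.intFrac j g = ∫ s, g s ∂M.edge j := by
  rw [intFrac, intervalIntegral.integral_of_le (M.node_lt j).le, integral_Ioc_eq_integral_Ioo, edge]

theorem edge_le (j : Fin (M.nΓ + 1)) : M.edge j ≤ D.frac :=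
  Measure.restrict_mono (fun s (hs : s ∈ Ioo _ _) =>
    (⟨(M.node_mem _).1.trans hs.1.le, hs.2.le.trans (M.node_mem _).2⟩ : s ∈ Icc _ _)) le_rfl

theorem ae_edge {P : ℝ → Prop} (j : Fin (M.nΓ + 1))
    (h : ∀ s ∈ Ioo (M.node j.castSucc) (M.node j.succ), P s) : ∀ᵐ s ∂M.edge j, P s :=
  (ae_restrict_iff' measurableSet_Ioo).2 (Filter.Eventually.of_forall h)

theorem ae_edge_of_ae {P : ℝ → Prop} (j : Fin (M.nΓ + 1)) (h : ∀ᵐ s ∂D.frac, P s) :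
    ∀ᵐ s ∂M.edge j, P s := Measure.absolutelyContinuous_of_le (M.edge_le j) h

theorem memLp_edge {g : ℝ → ℝ} (h : MemLp g 2 D.frac) (j : Fin (M.nΓ + 1)) :
    MemLp g 2 (M.edge j) := h.mono_measure (M.edge_le j)

theorem memLp_edge_of_eq (j : Fin (M.nΓ + 1)) {g g' : ℝ → ℝ} (hg : Continuous g)
    (h : ∀ s ∈ Ioo (M.node j.castSucc) (M.node j.succ), g' s = g s) : MemLp g' 2 (M.edge j) := by
  have : MemLp g 2 (M.edge j) := (memLp_of_continuous isCompact_Icc measurableSet_Icc hg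
    (μ := volume) (K := Icc (M.node j.castSucc) (M.node j.succ))).mono_measure
      (Measure.restrict_mono Ioo_subset_Icc_self le_rfl)
  exact this.ae_eq (M.ae_edge j fun s hs => (h s hs).symm)

theorem memLp_edge_eval (j : Fin (M.nΓ + 1)) (w : Polynomial ℝ) :
    MemLp (fun s => w.eval s) 2 (M.edge j) := M.memLp_edge_of_eq j w.continuous fun _ _ => rfl

/-- An edge has positive length, so an almost everywhere bound holds at some of its points and hence
for a constant value. -/
theorem ae_edge_neBot (j : Fin (M.nΓ + 1)) : (ae (M.edge j)).NeBot := by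
  rw [ae_neBot, edge, Ne, Measure.restrict_eq_zero, Real.volume_Ioo, ENNReal.ofReal_eq_zero, not_le,
    sub_pos]
  exact M.node_lt j

theorem sum_intFrac_eq {g : ℝ → ℝ} (hg : Integrable g D.frac) :
    ∑ j, M.intFrac j g = ∫ s in (0 : ℝ)..D.L, g s := by
  obtain ⟨-, h0, h1, -⟩ := M.partition
  set G : Fin (M.nΓ + 2) → ℝ := fun j => ∫ s in (0 : ℝ)..(M.node j), g s with hG
  have hz : (0 : ℝ) ∈ Icc 0 D.L := ⟨le_rfl, D.L_pos.le⟩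
  have e : ∀ j : Fin (M.nΓ + 1), M.intFrac j g = G j.succ - G j.castSucc := fun j => by
    rw [hG, intFrac, intervalIntegral.integral_interval_sub_left
      (D.intervalIntegrable hg hz (M.node_mem _)) (D.intervalIntegrable hg hz (M.node_mem _))]
  have hs := (Fin.sum_univ_succ G).symm.trans (Fin.sum_univ_castSucc G)
  simp_rw [e, Finset.sum_sub_distrib]
  have hl : G (Fin.last (M.nΓ + 1)) = ∫ s in (0 : ℝ)..D.L, g s := by rw [hG, ← h1]
  have hf : G 0 = 0 := by simp [hG, h0]
  rw [← hl]
  linarith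

/-- Continuous at the nodes and zero at the two ends. -/
def Conforming (r : M.PwFrac) : Prop :=
  (∀ z : Fin M.nΓ, (r z.castSucc).eval (M.node z.succ.castSucc)
    = (r z.succ).eval (M.node z.succ.castSucc)) ∧
  (r 0).eval 0 = 0 ∧ (r (Fin.last M.nΓ)).eval D.L = 0

/-- Conforming piecewise polynomials belong to `H¹₀(Γ)`. -/
theorem exists_fracH10 {r : M.PwFrac} (hr : M.Conforming r) : ∃ Q : FracH10 D,
    ∀ j, ∀ s ∈ Ioo (M.node j.castSucc) (M.node j.succ),
      Q.val s = (r j).eval s ∧ Q.der s = (r j).derivative.eval s := by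
  obtain ⟨hm, h0, h1, -⟩ := M.partition
  obtain ⟨hc, hr0, hrL⟩ := hr
  -- The piecewise derivative, with value zero at the nodes. Its primitive is the required function,
  -- once it is shown to agree with the polynomials on every edge.
  set d : ℝ → ℝ := fun s => ∑ j, (Ioo (M.node j.castSucc) (M.node j.succ)).indicator
    (fun s => (r j).derivative.eval s) s with hd
  have hdj : ∀ j, ∀ s ∈ Ioo (M.node j.castSucc) (M.node j.succ), d s = (r j).derivative.eval s := by
    intro j s hs
    simp only [hd]
    rw [Finset.sum_eq_single j, indicator_of_mem hs]
    · intro i _ hij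
      refine indicator_of_notMem (fun hi => ?_) _
      rcases lt_or_gt_of_ne hij with h | h
      · have : M.node i.succ ≤ M.node j.castSucc := hm.monotone (Fin.succ_le_castSucc_iff.2 h)
        linarith [hi.2, hs.1]
      · have : M.node j.succ ≤ M.node i.castSucc := hm.monotone (Fin.succ_le_castSucc_iff.2 h)
        linarith [hi.1, hs.2]
    · simp
  have hdm : MemLp d 2 D.frac := by
    refine memLp_finsetSum _ fun j _ => ?_
    rw [memLp_indicator_iff_restrict measurableSet_Ioo]
    exact (M.memLp_edge_eval j (r j).derivative).mono_measure
      (Measure.restrict_mono le_rfl Measure.restrict_le_self)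
  have hdi := hdm.integrable one_le_two
  have hz : (0 : ℝ) ∈ Icc 0 D.L := ⟨le_rfl, D.L_pos.le⟩
  have hmem : ∀ j : Fin (M.nΓ + 1), ∀ s ∈ Icc (M.node j.castSucc) (M.node j.succ), s ∈ Icc 0 D.L :=
    fun j s hs => ⟨(M.node_mem _).1.trans hs.1, hs.2.trans (M.node_mem _).2⟩
  have step : ∀ j : Fin (M.nΓ + 1), ∀ s ∈ Icc (M.node j.castSucc) (M.node j.succ),
      ∫ t in (0 : ℝ)..s, d t = (∫ t in (0 : ℝ)..(M.node j.castSucc), d t)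
        + ((r j).eval s - (r j).eval (M.node j.castSucc)) := by
    intro j s hs
    rw [← intervalIntegral.integral_add_adjacent_intervals
      (D.intervalIntegrable hdi hz (M.node_mem _))
      (D.intervalIntegrable hdi (M.node_mem j.castSucc) (hmem j s hs))]
    congr 1
    rw [← intervalIntegral.integral_eq_sub_of_hasDerivAt (f := fun s => (r j).eval s)
      (f' := fun s => (r j).derivative.eval s) (fun x _ => (r j).hasDerivAt x)
      ((r j).derivative.continuous.intervalIntegrable _ _),
      intervalIntegral.integral_of_le hs.1, intervalIntegral.integral_of_le hs.1,
      integral_Ioc_eq_integral_Ioo, integral_Ioc_eq_integral_Ioo]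
    exact setIntegral_congr_fun measurableSet_Ioo fun x hx => hdj j x ⟨hx.1, hx.2.trans_le hs.2⟩
  -- Induction along the arc: the zero value at the first end starts it, and continuity at the nodes
  -- passes from one edge to the next.
  have hnode : ∀ j : Fin (M.nΓ + 1),
      ∫ t in (0 : ℝ)..(M.node j.castSucc), d t = (r j).eval (M.node j.castSucc) := by
    intro j
    induction j using Fin.induction with
    | zero => simp [h0, hr0]
    | succ z ih =>
      have := step z.castSucc (M.node z.castSucc.succ) ⟨(M.node_lt _).le, le_rfl⟩
      rw [ih, add_sub_cancel] at this
      rw [← hc z]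
      exact this
  have hval : ∀ j : Fin (M.nΓ + 1), ∀ s ∈ Icc (M.node j.castSucc) (M.node j.succ),
      ∫ t in (0 : ℝ)..s, d t = (r j).eval s := fun j s hs => by
    rw [step j s hs, hnode, add_sub_cancel]
  refine ⟨⟨fun s => ∫ t in (0 : ℝ)..s, d t, d, hdm, fun _ _ => rfl, ?_⟩,
    fun j s hs => ⟨hval j s (Ioo_subset_Icc_self hs), hdj j s hs⟩⟩
  have := hval (Fin.last M.nΓ) (M.node (Fin.last M.nΓ).succ) ⟨(M.node_lt _).le, le_rfl⟩
  rw [Fin.succ_last, h1] at this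
  rw [this, hrL]

end Mesh

/-! ### Residuals on the fracture -/

namespace Mesh

variable {D : FracturedDomain} (M : Mesh D)

/-- The trace of a polynomial on a fracture edge, as a polynomial in arc length. -/
def tracePoly (j : Fin (M.nΓ + 1)) (w : MvPolynomial (Fin 2) ℝ) : Polynomial ℝ :=
  onLine (D.γ (M.node j.castSucc) - M.node j.castSucc • M.dir j) (M.dir j) w

theorem eval_tracePoly (j : Fin (M.nΓ + 1)) (w : MvPolynomial (Fin 2) ℝ) (s : ℝ) :
    (M.tracePoly j w).eval s = pval w (M.line j s) := by
  rw [tracePoly, eval_onLine, line]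
  congr 1
  module

/-- The normal component of a field on a fracture edge, as a polynomial in arc length. -/
def trNPoly (v : M.PwVec) (i : Fin 2) (j : Fin (M.nΓ + 1)) : Polynomial ℝ :=
  M.tracePoly j (rotcw (M.dir j) 0 • v (M.fracTri i j) 0 + rotcw (M.dir j) 1 • v (M.fracTri i j) 1)

theorem trN_eq_eval (v : M.PwVec) (i : Fin 2) (j : Fin (M.nΓ + 1)) {s : ℝ}
    (hs : s ∈ Ioo (M.node j.castSucc) (M.node j.succ)) : M.trN v i j s = (M.trNPoly v i j).eval s := by
  rw [M.trN_eq v i j hs, trNPoly, eval_tracePoly, pval_add, pval_smul, pval_smul, plane_inner]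
  simp [vval]
  ring

theorem natDegree_trNPoly_le {k : ℕ} {v : M.PwVec} (hv : ∀ τ i, (v τ i).totalDegree ≤ k) (i : Fin 2)
    (j : Fin (M.nΓ + 1)) : (M.trNPoly v i j).natDegree ≤ k := by
  refine natDegree_onLine_le _ _ ((MvPolynomial.totalDegree_add _ _).trans (max_le ?_ ?_)) <;>
    exact (MvPolynomial.totalDegree_smul_le _ _).trans (hv _ _)

theorem jumpN_eq_eval (v : M.PwVec) (j : Fin (M.nΓ + 1)) {s : ℝ}
    (hs : s ∈ Ioo (M.node j.castSucc) (M.node j.succ)) :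
    M.jumpN v j s = (M.trNPoly v 0 j - M.trNPoly v 1 j).eval s := by
  rw [jumpN, M.trN_eq_eval v 0 j hs, M.trN_eq_eval v 1 j hs, Polynomial.eval_sub]

theorem memLp_jumpN (v : M.PwVec) (j : Fin (M.nΓ + 1)) : MemLp (M.jumpN v j) 2 (M.edge j) :=
  M.memLp_edge_of_eq j (Polynomial.continuous _) fun _ hs => M.jumpN_eq_eval v j hs

theorem memLp_avgN (v : M.PwVec) (j : Fin (M.nΓ + 1)) : MemLp (M.avgN v j) 2 (M.edge j) :=
  M.memLp_edge_of_eq j (g := fun s => ((M.trNPoly v 0 j).eval s + (M.trNPoly v 1 j).eval s) / 2)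
    (by fun_prop) fun s hs => by rw [avgN, M.trN_eq_eval v 0 j hs, M.trN_eq_eval v 1 j hs]

theorem pval_γ (w : MvPolynomial (Fin 2) ℝ) (j : Fin (M.nΓ + 1)) {s : ℝ}
    (hs : s ∈ Ioo (M.node j.castSucc) (M.node j.succ)) :
    pval w (D.γ s) = (M.tracePoly j w).eval s := by
  rw [eval_tracePoly, M.γ_eq_line j (Ioo_subset_Icc_self hs)]

theorem memLp_jumpΓ (q : M.PwPoly) (j : Fin (M.nΓ + 1)) : MemLp (M.jumpΓ q j) 2 (M.edge j) :=
  M.memLp_edge_of_eq j (g := fun s => (M.tracePoly j (q (M.fracTri 0 j))).eval s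
    - (M.tracePoly j (q (M.fracTri 1 j))).eval s) (by fun_prop) fun s hs => by
      rw [jumpΓ, M.pval_γ _ j hs, M.pval_γ _ j hs]

theorem memLp_avgΓ (q : M.PwPoly) (j : Fin (M.nΓ + 1)) : MemLp (M.avgΓ q j) 2 (M.edge j) :=
  M.memLp_edge_of_eq j (g := fun s => ((M.tracePoly j (q (M.fracTri 0 j))).eval s
    + (M.tracePoly j (q (M.fracTri 1 j))).eval s) / 2) (by fun_prop) fun s hs => by
      rw [avgΓ, M.pval_γ _ j hs, M.pval_γ _ j hs]

theorem mid_mem (j : Fin (M.nΓ + 1)) : (M.node j.castSucc + M.node j.succ) / 2 ∈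
    Ioo (M.node j.castSucc) (M.node j.succ) := by
  have := M.node_lt j
  constructor <;> linarith

variable {c : Coefficients D}

theorem Resolves.KΓ_eq {M : Mesh D} (h : M.Resolves c) (j : Fin (M.nΓ + 1)) {s : ℝ}
    (hs : s ∈ Ioo (M.node j.castSucc) (M.node j.succ)) : c.KΓ s = M.KΓe c j := by
  obtain ⟨⟨a, ha⟩, -, ⟨b, hb⟩⟩ := h.2 j
  rw [KΓe, Coefficients.KΓ, Coefficients.KΓ, ha s hs, hb s hs, ha _ (M.mid_mem j),
    hb _ (M.mid_mem j)]

/-- The coefficient is bounded only almost everywhere, but it is constant on the open edge, so its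
value at the midpoint obeys the bounds. -/
theorem Resolves.KΓe_bdd {M : Mesh D} (h : M.Resolves c) {a b : ℝ}
    (hab : ∀ᵐ s ∂D.frac, a ≤ c.KΓ s ∧ c.KΓ s ≤ b) (j : Fin (M.nΓ + 1)) :
    a ≤ M.KΓe c j ∧ M.KΓe c j ≤ b := by
  have := M.ae_edge_neBot j
  obtain ⟨s, h1, h2⟩ := ((M.ae_edge_of_ae j hab).and (M.ae_edge j fun s hs => h.KΓ_eq j hs)).exists
  rwa [h2] at h1

theorem Resolves.ℓ_eq {M : Mesh D} (h : M.Resolves c) (j : Fin (M.nΓ + 1)) : ∃ l : ℝ,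
    ∀ s ∈ Ioo (M.node j.castSucc) (M.node j.succ), c.ℓ s = l := (h.2 j).2.2

variable (c)

/-- The residual on a fracture edge. -/
def fracResidual (fΓ : ℝ → ℝ) (uh : M.PwVec) (wh : M.PwFrac) (j : Fin (M.nΓ + 1)) (s : ℝ) : ℝ :=
  c.ℓ s * fΓ s + M.KΓe c j * (wh j).derivative.derivative.eval s + M.jumpN uh j s

theorem memLp_source {fΓ : ℝ → ℝ} (hf : MemLp fΓ 2 D.frac) :
    MemLp (fun s => c.ℓ s * fΓ s) 2 D.frac := by
  obtain ⟨a, b, ha, h⟩ := c.ℓ_bdd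
  exact MemLp_two.bdd_smul hf c.ℓ_meas.aestronglyMeasurable (ae_abs_le ha h)

theorem memLp_fracResidual {fΓ : ℝ → ℝ} (hf : MemLp fΓ 2 D.frac) (uh : M.PwVec) (wh : M.PwFrac)
    (j : Fin (M.nΓ + 1)) : MemLp (M.fracResidual c fΓ uh wh j) 2 (M.edge j) :=
  ((M.memLp_edge (memLp_source c hf) j).add
    ((M.memLp_edge_eval j (wh j).derivative.derivative).const_mul _)).add (M.memLp_jumpN uh j)

theorem memLp_der_sub (pΓ : FracH10 D) (wh : M.PwFrac) (j : Fin (M.nΓ + 1)) :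
    MemLp (fun s => pΓ.der s - (wh j).derivative.eval s) 2 (M.edge j) :=
  (M.memLp_edge pΓ.der_mem j).sub (M.memLp_edge_eval j _)

theorem memLp_fluxJump_sub (p : BulkH1 D) (pΓ : FracH10 D) (uh : M.PwVec) (j : Fin (M.nΓ + 1)) :
    MemLp (fun s => fluxJump c p pΓ s - M.jumpN uh j s) 2 (M.edge j) :=
  (M.memLp_edge (memLp_fluxJump c p pΓ) j).sub (M.memLp_jumpN uh j)

variable {c}

/-- The residual of the fracture equation for conforming piecewise polynomials. -/
theorem sum_fracResidual {f : Plane → ℝ} {fΓ : ℝ → ℝ} {u : Plane → Plane} {p : BulkH1 D}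
    {pΓ : FracH10 D} (h : IsWeakSolution c f fΓ u p pΓ) (hf : MemLp fΓ 2 D.frac)
    (hres : M.Resolves c) (uh : M.PwVec) (wh : M.PwFrac) {r : M.PwFrac} (hr : M.Conforming r) :
    ∑ j, ((∫ s, M.fracResidual c fΓ uh wh j s * (r j).eval s ∂M.edge j)
      - (∫ s, M.KΓe c j * (pΓ.der s - (wh j).derivative.eval s) * (r j).derivative.eval s ∂M.edge j)
      + (∫ s, (fluxJump c p pΓ s - M.jumpN uh j s) * (r j).eval s ∂M.edge j)
      - M.KΓe c j * ((wh j).derivative.eval (M.node j.succ) * (r j).eval (M.node j.succ)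
        - (wh j).derivative.eval (M.node j.castSucc) * (r j).eval (M.node j.castSucc))) = 0 := by
  obtain ⟨Q, hQ⟩ := M.exists_fracH10 hr
  obtain ⟨a, b, ha, hab⟩ := c.KΓ_bdd
  have mK : MemLp (fun s => c.KΓ s * pΓ.der s) 2 D.frac :=
    MemLp_two.bdd_smul pΓ.der_mem c.measurable_KΓ.aestronglyMeasurable (ae_abs_le ha hab)
  have mF := memLp_fluxJump c p pΓ
  have mS := memLp_source c hf
  have hw := h.fracture Q
  change _ - (∫ s in (0 : ℝ)..D.L, fluxJump c p pΓ s * Q.val s) = _ at hw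
  rw [← M.sum_intFrac_eq (MemLp_two.integrable_mul mK Q.der_mem),
    ← M.sum_intFrac_eq (MemLp_two.integrable_mul mF Q.memLp),
    ← M.sum_intFrac_eq (MemLp_two.integrable_mul mS Q.memLp)] at hw
  -- The jump of the discrete normal flux is added to the residual and subtracted from the flux
  -- error. The exact interface law identifies the coupling term of the fracture equation with the
  -- jump of the exact flux.
  have hj : ∀ j, (∫ s, M.fracResidual c fΓ uh wh j s * (r j).eval s ∂M.edge j)
      - (∫ s, M.KΓe c j * (pΓ.der s - (wh j).derivative.eval s) * (r j).derivative.eval s ∂M.edge j)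
      + (∫ s, (fluxJump c p pΓ s - M.jumpN uh j s) * (r j).eval s ∂M.edge j)
      - M.KΓe c j * ((wh j).derivative.eval (M.node j.succ) * (r j).eval (M.node j.succ)
        - (wh j).derivative.eval (M.node j.castSucc) * (r j).eval (M.node j.castSucc)) =
      M.intFrac j (fun s => c.ℓ s * fΓ s * Q.val s)
        - M.intFrac j (fun s => c.KΓ s * pΓ.der s * Q.der s)
        + M.intFrac j (fun s => fluxJump c p pΓ s * Q.val s) := by
    intro j
    rw [M.intFrac_congr j (g := fun s => c.ℓ s * fΓ s * Q.val s)
        (g' := fun s => c.ℓ s * fΓ s * (r j).eval s) fun s hs => by rw [(hQ j s hs).1],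
      M.intFrac_congr j (g := fun s => c.KΓ s * pΓ.der s * Q.der s)
        (g' := fun s => c.KΓ s * pΓ.der s * (r j).derivative.eval s) fun s hs => by
          rw [(hQ j s hs).2],
      M.intFrac_congr j (g := fun s => fluxJump c p pΓ s * Q.val s)
        (g' := fun s => fluxJump c p pΓ s * (r j).eval s) fun s hs => by rw [(hQ j s hs).1]]
    -- Integration by parts on one edge. The endpoint terms are kept, since at a common node they
    -- add up to the vertex residual.
    have hparts : (wh j).derivative.eval (M.node j.succ) * (r j).eval (M.node j.succ)
        - (wh j).derivative.eval (M.node j.castSucc) * (r j).eval (M.node j.castSucc) =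
        (∫ s, (wh j).derivative.derivative.eval s * (r j).eval s ∂M.edge j)
          + ∫ s, (wh j).derivative.eval s * (r j).derivative.eval s ∂M.edge j := by
      rw [← M.intFrac_eq_integral, ← M.intFrac_eq_integral, intFrac, intFrac,
        ← intervalIntegral.integral_add (Continuous.intervalIntegrable (by fun_prop) _ _)
          (Continuous.intervalIntegrable (by fun_prop) _ _),
        ← Polynomial.eval_mul, ← Polynomial.eval_mul]
      rw [← intervalIntegral.integral_eq_sub_of_hasDerivAt
        (f := fun s => ((wh j).derivative * r j).eval s)
        (f' := fun s => ((wh j).derivative * r j).derivative.eval s)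
        (fun x _ => Polynomial.hasDerivAt _ x)
        ((Polynomial.continuous _).intervalIntegrable _ _)]
      simp [Polynomial.derivative_mul]
    simp only [M.intFrac_eq_integral]
    have mr := M.memLp_edge_eval j (r j)
    have mr' := M.memLp_edge_eval j (r j).derivative
    have mw' := M.memLp_edge_eval j (wh j).derivative
    have mw'' := M.memLp_edge_eval j (wh j).derivative.derivative
    have mJ := M.memLp_jumpN uh j
    have e1 : ∫ s, M.fracResidual c fΓ uh wh j s * (r j).eval s ∂M.edge j =
        (∫ s, c.ℓ s * fΓ s * (r j).eval s ∂M.edge j)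
        + M.KΓe c j * (∫ s, (wh j).derivative.derivative.eval s * (r j).eval s ∂M.edge j)
        + ∫ s, M.jumpN uh j s * (r j).eval s ∂M.edge j := by
      have i1 := MemLp_two.integrable_mul (M.memLp_edge mS j) mr
      have i2 := (MemLp_two.integrable_mul mw'' mr).const_mul (M.KΓe c j)
      have i3 := MemLp_two.integrable_mul mJ mr
      have i12 : Integrable (fun s => c.ℓ s * fΓ s * (r j).eval s + M.KΓe c j *
          ((wh j).derivative.derivative.eval s * (r j).eval s)) (M.edge j) := i1.add i2
      rw [← integral_const_mul, ← integral_add i1 i2, ← integral_add i12 i3]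
      congr 1
      ext s
      simp only [fracResidual]
      ring
    have e2 : ∫ s, M.KΓe c j * (pΓ.der s - (wh j).derivative.eval s) * (r j).derivative.eval s
        ∂M.edge j = (∫ s, c.KΓ s * pΓ.der s * (r j).derivative.eval s ∂M.edge j)
        - M.KΓe c j * ∫ s, (wh j).derivative.eval s * (r j).derivative.eval s ∂M.edge j := by
      have i1 := MemLp_two.integrable_mul (M.memLp_edge mK j) mr'
      have i2 := (MemLp_two.integrable_mul mw' mr').const_mul (M.KΓe c j)
      rw [← integral_const_mul, ← integral_sub i1 i2]
      refine integral_congr_ae (M.ae_edge j fun s hs => ?_)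
      simp only [hres.KΓ_eq j hs]
      ring
    have e3 : ∫ s, (fluxJump c p pΓ s - M.jumpN uh j s) * (r j).eval s ∂M.edge j =
        (∫ s, fluxJump c p pΓ s * (r j).eval s ∂M.edge j)
        - ∫ s, M.jumpN uh j s * (r j).eval s ∂M.edge j := by
      rw [← integral_sub (MemLp_two.integrable_mul (M.memLp_edge mF j) mr)
        (MemLp_two.integrable_mul mJ mr)]
      simp_rw [sub_mul]
    rw [hparts, e1, e2, e3]
    ring
  rw [Finset.sum_congr rfl fun j _ => hj j, Finset.sum_add_distrib, Finset.sum_sub_distrib]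
  linarith

/-- The weighted error of the tangential flux. -/
theorem integral_flux_sq_le (hres : M.Resolves c) {a b : ℝ} (ha : 0 < a)
    (hab : ∀ᵐ s ∂D.frac, a ≤ c.KΓ s ∧ c.KΓ s ≤ b) (pΓ : FracH10 D) (wh : M.PwFrac)
    (j : Fin (M.nΓ + 1)) :
    ∫ s, (M.KΓe c j * (pΓ.der s - (wh j).derivative.eval s)) ^ 2 ∂M.edge j ≤
      b * ∫ s, c.KΓ s * (pΓ.der s - (wh j).derivative.eval s) ^ 2 ∂M.edge j := by
  obtain ⟨h1, h2⟩ := hres.KΓe_bdd hab j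
  have e : ∫ s, c.KΓ s * (pΓ.der s - (wh j).derivative.eval s) ^ 2 ∂M.edge j =
      M.KΓe c j * ∫ s, (pΓ.der s - (wh j).derivative.eval s) ^ 2 ∂M.edge j := by
    rw [← integral_const_mul]
    refine integral_congr_ae (M.ae_edge j fun s hs => ?_)
    simp only [hres.KΓ_eq j hs]
  rw [e]
  simp_rw [mul_pow]
  rw [integral_const_mul, sq, mul_assoc]
  have : 0 ≤ ∫ s, (pΓ.der s - (wh j).derivative.eval s) ^ 2 ∂M.edge j :=
    integral_nonneg fun s => sq_nonneg _
  have hK : 0 ≤ M.KΓe c j := ha.le.trans h1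
  exact mul_le_mul_of_nonneg_right h2 (mul_nonneg hK this)

end Mesh

/-! ### Efficiency of the fracture terms -/

set_option maxHeartbeats 800000 in
/-- Local efficiency of the residual on a fracture edge. -/
theorem exists_fracResidual_le {D : FracturedDomain} (c : Coefficients D) (N : ℕ) :
    ∃ C : ℝ, 0 < C ∧ ∀ (M : Mesh D), M.Resolves c → ∀ (f : Plane → ℝ) (fΓ : ℝ → ℝ)
      (u : Plane → Plane) (p : BulkH1 D) (pΓ : FracH10 D), IsWeakSolution c f fΓ u p pΓ →
      MemLp fΓ 2 D.frac → ∀ (uh : M.PwVec) (wh fΓh : M.PwFrac),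
      (∀ τ i, (uh τ i).totalDegree ≤ N) → (∀ j, (wh j).natDegree ≤ N) →
      (∀ j, (fΓh j).natDegree ≤ N) → ∀ j,
      M.hFrac j ^ 2 * ∫ s, M.fracResidual c fΓ uh wh j s ^ 2 ∂M.edge j ≤
        C * ((∫ s, c.KΓ s * (pΓ.der s - (wh j).derivative.eval s) ^ 2 ∂M.edge j)
          + (∫ s, (fluxJump c p pΓ s - M.jumpN uh j s) ^ 2 ∂M.edge j)
          + M.hFrac j ^ 2 * ∫ s, (c.ℓ s * ((fΓh j).eval s - fΓ s)) ^ 2 ∂M.edge j) := by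
  obtain ⟨B, hB, hb⟩ := exists_edgeBubble_bound N
  obtain ⟨a₀, b₀, ha₀, hab₀⟩ := c.KΓ_bdd
  refine ⟨24 * B ^ 2 * (|b₀| + D.L ^ 2 + 1) + 2, by positivity, ?_⟩
  intro M hres f fΓ u p pΓ h hf uh wh fΓh huh hwh hfh j
  obtain ⟨l, hl⟩ := hres.ℓ_eq j
  have hh := M.hFrac_pos j
  have hL := M.hFrac_le j
  set η := M.hFrac j with hη
  set s₀ := M.node j.castSucc with hs₀
  have hs₁ : M.node j.succ = s₀ + η := M.node_succ j
  -- The residual with the source replaced by its approximation; it is a polynomial because the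
  -- coefficients are constant on the edge.
  set w : Polynomial ℝ := Polynomial.C l * fΓh j
    + Polynomial.C (M.KΓe c j) * (wh j).derivative.derivative
    + (M.trNPoly uh 0 j - M.trNPoly uh 1 j) with hw
  have hwN : w.natDegree ≤ N := by
    refine (Polynomial.natDegree_add_le _ _).trans (max_le
      ((Polynomial.natDegree_add_le _ _).trans (max_le ?_ ?_)) ?_)
    · exact (Polynomial.natDegree_C_mul_le _ _).trans (hfh j)
    · refine (Polynomial.natDegree_C_mul_le _ _).trans ?_
      have h1 := Polynomial.natDegree_derivative_le (wh j)
      have h2 := Polynomial.natDegree_derivative_le (wh j).derivative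
      have h3 := hwh j
      omega
    · exact (Polynomial.natDegree_sub_le _ _).trans
        (max_le (M.natDegree_trNPoly_le huh 0 j) (M.natDegree_trNPoly_le huh 1 j))
  set W := w.comp (Polynomial.C s₀ + Polynomial.C η * Polynomial.X) with hW
  have hWe : ∀ t, W.eval t = w.eval (s₀ + η * t) := fun t => by simp [hW]
  have hWN : W.natDegree ≤ N := by
    refine Polynomial.natDegree_comp_le.trans ((Nat.mul_le_mul_left _ ?_).trans
      ((mul_one _).le.trans hwN))
    rw [add_comm]
    exact Polynomial.natDegree_linear_le
  obtain ⟨ha0, hb1, hb2, hb3, -, -⟩ := hb W hWN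
  set a := ∫ s in (0 : ℝ)..1, s * (1 - s) * W.eval s ^ 2 with ha
  -- The bubble of the edge times the residual, as a polynomial in arc length. Since it vanishes at
  -- both ends, its extension by zero is conforming, and no vertex terms appear.
  set q : Polynomial ℝ := Polynomial.C η⁻¹ * (Polynomial.X - Polynomial.C s₀)
    * (Polynomial.C η⁻¹ * (Polynomial.C (s₀ + η) - Polynomial.X)) * w with hq
  have hqe : ∀ t, q.eval (s₀ + η * t) = t * (1 - t) * W.eval t := fun t => by
    rw [hWe]
    simp only [hq, Polynomial.eval_mul, Polynomial.eval_C, Polynomial.eval_sub, Polynomial.eval_X]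
    field_simp
    ring
  have hqd : ∀ t, η * q.derivative.eval (s₀ + η * t) =
      deriv (fun t => t * (1 - t) * W.eval t) t := fun t => by
    have h1 : HasDerivAt (fun t : ℝ => s₀ + η * t) η t := by
      simpa using ((hasDerivAt_id t).const_mul η).const_add s₀
    have h2 := (q.hasDerivAt (s₀ + η * t)).comp t h1
    have h3 : (fun t => t * (1 - t) * W.eval t) = (fun x => q.eval x) ∘ fun t => s₀ + η * t :=
      funext fun t => (hqe t).symm
    rw [h3, h2.deriv, mul_comm]
  set r : M.PwFrac := fun i => if i = j then q else 0 with hr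
  have hrj : r j = q := if_pos rfl
  have hri : ∀ i, i ≠ j → r i = 0 := fun i hi => if_neg hi
  have hr0 : ∀ i, (r i).eval (M.node i.castSucc) = 0 ∧ (r i).eval (M.node i.succ) = 0 := by
    intro i
    by_cases hi : i = j
    · rw [hi, hrj, ← hs₀, hs₁]
      simp [hq]
    · simp [hri i hi]
  have hrc : M.Conforming r := by
    obtain ⟨-, h0, h1, -⟩ := M.partition
    refine ⟨fun z => ?_, ?_, ?_⟩
    · rw [(hr0 z.succ).1]
      exact (hr0 z.castSucc).2
    · have := (hr0 0).1
      rwa [Fin.castSucc_zero, h0] at this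
    · have := (hr0 (Fin.last _)).2
      rwa [Fin.succ_last, h1] at this
  have hsum := M.sum_fracResidual h hf hres uh wh hrc
  rw [Finset.sum_eq_single j (fun i _ hi => by simp [hri i hi]) (by simp), (hr0 j).1, (hr0 j).2,
    hrj] at hsum
  simp only [mul_zero, sub_zero] at hsum
  have mR := M.memLp_fracResidual c hf uh wh j
  have mE := M.memLp_fluxJump_sub c p pΓ uh j
  have mD := (M.memLp_der_sub pΓ wh j).const_mul (M.KΓe c j)
  have mq := M.memLp_edge_eval j q
  have mq' := M.memLp_edge_eval j q.derivative
  have mw := M.memLp_edge_eval j w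
  have mO : MemLp (fun s => c.ℓ s * ((fΓh j).eval s - fΓ s)) 2 (M.edge j) := by
    have := ((M.memLp_edge_eval j (fΓh j)).const_mul l).sub (M.memLp_edge (Mesh.memLp_source c hf) j)
    refine this.ae_eq (M.ae_edge j fun s hs => ?_)
    simp only [Pi.sub_apply, hl s hs]
    ring
  have hRw : ∀ s ∈ Ioo (M.node j.castSucc) (M.node j.succ),
      w.eval s = M.fracResidual c fΓ uh wh j s + c.ℓ s * ((fΓh j).eval s - fΓ s) := by
    intro s hs
    rw [Mesh.fracResidual, M.jumpN_eq_eval uh j hs, hl s hs, hw]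
    simp only [Polynomial.eval_add, Polynomial.eval_mul, Polynomial.eval_C]
    ring
  have hwq : ∫ s, w.eval s * q.eval s ∂M.edge j =
      (∫ s, M.fracResidual c fΓ uh wh j s * q.eval s ∂M.edge j)
        + ∫ s, c.ℓ s * ((fΓh j).eval s - fΓ s) * q.eval s ∂M.edge j := by
    rw [← integral_add (MemLp_two.integrable_mul mR mq) (MemLp_two.integrable_mul mO mq)]
    refine integral_congr_ae (M.ae_edge j fun s hs => ?_)
    simp only [hRw s hs]
    ring
  have href : ∀ g : ℝ → ℝ, ∫ s, g s ∂M.edge j = η * ∫ t in (0 : ℝ)..1, g (s₀ + η * t) := fun g => by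
    rw [← M.intFrac_eq_integral, M.intFrac_eq]
  have e1 : ∫ s, w.eval s * q.eval s ∂M.edge j = η * a := by
    rw [href, ha]
    congr 2
    ext t
    rw [hqe, hWe]
    ring
  have e2 : ∫ s, q.eval s ^ 2 ∂M.edge j ≤ η * (B * a) := by
    rw [href]
    simp_rw [hqe]
    gcongr
  have e3 : ∫ s, q.derivative.eval s ^ 2 ∂M.edge j ≤ η⁻¹ * (B * a) := by
    rw [href]
    have : ∀ t, q.derivative.eval (s₀ + η * t) ^ 2 =
        η⁻¹ ^ 2 * deriv (fun t => t * (1 - t) * W.eval t) t ^ 2 := fun t => by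
      rw [← hqd]
      field_simp
    simp_rw [this]
    rw [intervalIntegral.integral_const_mul, ← mul_assoc]
    have : η * η⁻¹ ^ 2 = η⁻¹ := by field_simp
    rw [this]
    gcongr
  have e4 : ∫ s, w.eval s ^ 2 ∂M.edge j ≤ B * (η * a) := by
    rw [href]
    simp_rw [← hWe]
    calc _ ≤ η * (B * a) := by gcongr
      _ = _ := by ring
  -- Three error terms, each with a share `η * a / 6` to be absorbed; together they take one half.
  have hδ : 0 < (6 * B)⁻¹ := by positivity
  have hδ' : 0 < (6 * B)⁻¹ * η ^ 2 := by positivity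
  have y1 := abs_integral_mul_le mD mq' hδ'
  have y2 := abs_integral_mul_le mE mq hδ
  have y3 := abs_integral_mul_le mO mq hδ
  have z1 : (6 * B)⁻¹ * η ^ 2 * ∫ s, q.derivative.eval s ^ 2 ∂M.edge j ≤ η * a / 6 := by
    calc _ ≤ (6 * B)⁻¹ * η ^ 2 * (η⁻¹ * (B * a)) := by gcongr
      _ = _ := by field_simp
  have z2 : (6 * B)⁻¹ * ∫ s, q.eval s ^ 2 ∂M.edge j ≤ η * a / 6 := by
    calc _ ≤ (6 * B)⁻¹ * (η * (B * a)) := by gcongr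
      _ = _ := by field_simp
  have hKE := M.integral_flux_sq_le hres ha₀ hab₀ pΓ wh j
  set EK := ∫ s, c.KΓ s * (pΓ.der s - (wh j).derivative.eval s) ^ 2 ∂M.edge j with hEK
  set EJ := ∫ s, (fluxJump c p pΓ s - M.jumpN uh j s) ^ 2 ∂M.edge j with hEJ
  set O := ∫ s, (c.ℓ s * ((fΓh j).eval s - fΓ s)) ^ 2 ∂M.edge j with hO
  have hEK0 : 0 ≤ EK := integral_nonneg_of_ae (by
    filter_upwards [M.ae_edge_of_ae j hab₀] with s hs
    exact mul_nonneg (ha₀.le.trans hs.1) (sq_nonneg _))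
  have hEJ0 : 0 ≤ EJ := integral_nonneg fun s => sq_nonneg _
  have hO0 : 0 ≤ O := integral_nonneg fun s => sq_nonneg _
  have y1' : |∫ s, M.KΓe c j * (pΓ.der s - (wh j).derivative.eval s) * q.derivative.eval s ∂M.edge j|
      ≤ 6 * B * (η ^ 2)⁻¹ * (|b₀| * EK) + η * a / 6 := by
    refine y1.trans (add_le_add ?_ z1)
    rw [mul_inv, inv_inv]
    refine mul_le_mul_of_nonneg_left (hKE.trans ?_) (by positivity)
    exact mul_le_mul_of_nonneg_right (le_abs_self _) hEK0
  rw [inv_inv] at y2 y3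
  have hX : η * a ≤ 12 * B * ((η ^ 2)⁻¹ * (|b₀| * EK) + EJ + O) := by
    have t1 := le_abs_self
      (∫ s, M.KΓe c j * (pΓ.der s - (wh j).derivative.eval s) * q.derivative.eval s ∂M.edge j)
    have t2 := neg_abs_le (∫ s, (fluxJump c p pΓ s - M.jumpN uh j s) * q.eval s ∂M.edge j)
    have t3 := le_abs_self (∫ s, c.ℓ s * ((fΓh j).eval s - fΓ s) * q.eval s ∂M.edge j)
    linarith
  have hsq : ∫ s, M.fracResidual c fΓ uh wh j s ^ 2 ∂M.edge j ≤
      2 * (∫ s, w.eval s ^ 2 ∂M.edge j) + 2 * O := by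
    have i1 := mw.integrable_sq.const_mul 2
    have i2 := mO.integrable_sq.const_mul 2
    rw [hO, ← integral_const_mul, ← integral_const_mul, ← integral_add i1 i2]
    refine integral_mono_ae mR.integrable_sq (i1.add i2) (M.ae_edge j fun s hs => ?_)
    simp only [hRw s hs]
    nlinarith [sq_nonneg (M.fracResidual c fΓ uh wh j s + 2 * (c.ℓ s * ((fΓh j).eval s - fΓ s)))]
  have hfin : ∫ s, M.fracResidual c fΓ uh wh j s ^ 2 ∂M.edge j ≤
      24 * B ^ 2 * ((η ^ 2)⁻¹ * (|b₀| * EK) + EJ + O) + 2 * O := by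
    calc _ ≤ 2 * (B * (12 * B * ((η ^ 2)⁻¹ * (|b₀| * EK) + EJ + O))) + 2 * O := by
          refine hsq.trans (add_le_add ?_ le_rfl)
          exact mul_le_mul_of_nonneg_left
            (e4.trans (mul_le_mul_of_nonneg_left hX hB.le)) zero_le_two
      _ = _ := by ring
  -- The flux jump enters the error norm without a power of the edge length, so the surplus factor
  -- `η ^ 2` is bounded by the length of the fracture.
  have hη2 : η ^ 2 ≤ D.L ^ 2 := pow_le_pow_left₀ hh.le hL 2
  calc _ ≤ η ^ 2 * (24 * B ^ 2 * ((η ^ 2)⁻¹ * (|b₀| * EK) + EJ + O) + 2 * O) := by gcongr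
    _ = 24 * B ^ 2 * (|b₀| * EK + η ^ 2 * EJ + η ^ 2 * O) + 2 * (η ^ 2 * O) := by field_simp
    _ ≤ 24 * B ^ 2 * ((|b₀| + D.L ^ 2 + 1) * (EK + EJ + η ^ 2 * O)) + 2 * (EK + EJ + η ^ 2 * O) := by
      have k1 : η ^ 2 * EJ ≤ D.L ^ 2 * EJ := by gcongr
      have k2 : 0 ≤ η ^ 2 * O := by positivity
      have k3 : 0 ≤ |b₀| * EJ + |b₀| * (η ^ 2 * O) + D.L ^ 2 * EK + D.L ^ 2 * (η ^ 2 * O) + EK + EJ := by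
        positivity
      gcongr 24 * B ^ 2 * ?_ + 2 * ?_
      · linarith
      · linarith
    _ = _ := by ring

set_option maxHeartbeats 1600000 in
/-- Efficiency of the vertex residual. -/
theorem exists_vertexResidual_le {D : FracturedDomain} (c : Coefficients D) {ρS ρE : ℝ}
    (hρS : 0 < ρS) (hρE : 0 < ρE) :
    ∃ C : ℝ, 0 < C ∧ ∀ (M : Mesh D), M.Resolves c → M.StarShaped ρS → M.EdgesComparable ρE →
      ∀ (f : Plane → ℝ) (fΓ : ℝ → ℝ) (u : Plane → Plane) (p : BulkH1 D) (pΓ : FracH10 D),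
      IsWeakSolution c f fΓ u p pΓ → MemLp fΓ 2 D.frac → ∀ (uh : M.PwVec) (wh : M.PwFrac),
      ∑ z : Fin M.nΓ, max (M.hFrac z.castSucc) (M.hFrac z.succ) * M.vertexResidual c wh z ≤
        C * ∑ j, ((∫ s, c.KΓ s * (pΓ.der s - (wh j).derivative.eval s) ^ 2 ∂M.edge j)
          + (∫ s, (fluxJump c p pΓ s - M.jumpN uh j s) ^ 2 ∂M.edge j)
          + M.hFrac j ^ 2 * ∫ s, M.fracResidual c fΓ uh wh j s ^ 2 ∂M.edge j) := by
  obtain ⟨B, hB, hcomp⟩ := Mesh.exists_hFrac_comparable (D := D) hρS hρE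
  obtain ⟨a₀, b₀, ha₀, hab₀⟩ := c.KΓ_bdd
  -- At least one, so that `A` bounds the ratio of the longer edge at a node to either edge, the
  -- longer one included.
  set A := max B 1 with hA
  have hA0 : 0 < A := by positivity
  refine ⟨48 * A * (|b₀| + D.L ^ 2 + 1) / a₀, by positivity, ?_⟩
  intro M hres hS hE f fΓ u p pΓ h hf uh wh
  set EK : Fin (M.nΓ + 1) → ℝ := fun j =>
    ∫ s, c.KΓ s * (pΓ.der s - (wh j).derivative.eval s) ^ 2 ∂M.edge j with hEK
  set EJ : Fin (M.nΓ + 1) → ℝ := fun j =>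
    ∫ s, (fluxJump c p pΓ s - M.jumpN uh j s) ^ 2 ∂M.edge j with hEJ
  set R2 : Fin (M.nΓ + 1) → ℝ := fun j =>
    ∫ s, M.fracResidual c fΓ uh wh j s ^ 2 ∂M.edge j with hR2
  have hEK0 : ∀ j, 0 ≤ EK j := fun j => integral_nonneg_of_ae (by
    filter_upwards [M.ae_edge_of_ae j hab₀] with s hs
    exact mul_nonneg (ha₀.le.trans hs.1) (sq_nonneg _))
  have hEJ0 : ∀ j, 0 ≤ EJ j := fun j => integral_nonneg fun s => sq_nonneg _
  have hR0 : ∀ j, 0 ≤ R2 j := fun j => integral_nonneg fun s => sq_nonneg _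
  set G : Fin (M.nΓ + 1) → ℝ := fun j => EK j + EJ j + M.hFrac j ^ 2 * R2 j with hG
  have hG0 : ∀ j, 0 ≤ G j := fun j =>
    add_nonneg (add_nonneg (hEK0 j) (hEJ0 j)) (mul_nonneg (sq_nonneg _) (hR0 j))
  have hz : ∀ z : Fin M.nΓ,
      max (M.hFrac z.castSucc) (M.hFrac z.succ) * M.vertexResidual c wh z ≤
        24 * A * (|b₀| + D.L ^ 2 + 1) / a₀ * (G z.castSucc + G z.succ) := by
    intro z
    have hne : z.castSucc ≠ z.succ := Fin.castSucc_lt_succ.ne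
    set l := z.castSucc with hl
    set m := z.succ with hm
    set Z := M.node m.castSucc with hZ
    have hZl : M.node l.succ = Z := rfl
    have hhl := M.hFrac_pos l
    have hhm := M.hFrac_pos m
    -- The two linear pieces of the hat function at the node; `V` below lists its nodal values.
    set q₁ : Polynomial ℝ :=
      Polynomial.C (M.hFrac l)⁻¹ * (Polynomial.X - Polynomial.C (M.node l.castSucc)) with hq₁
    set q₂ : Polynomial ℝ :=
      Polynomial.C (M.hFrac m)⁻¹ * (Polynomial.C (M.node m.succ) - Polynomial.X) with hq₂
    set r : M.PwFrac := fun i => if i = l then q₁ else if i = m then q₂ else 0 with hr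
    have hrl : r l = q₁ := if_pos rfl
    have hrm : r m = q₂ := by simp only [hr]; rw [if_neg hne.symm, if_pos trivial]
    have hri : ∀ i, i ≠ l ∧ i ≠ m → r i = 0 := fun i hi => by
      simp only [hr]; rw [if_neg hi.1, if_neg hi.2]
    set V : Fin (M.nΓ + 2) → ℝ := fun n => if n = m.castSucc then 1 else 0 with hV
    have v1 : q₁.eval (M.node l.castSucc) = 0 := by simp [hq₁]
    have v2 : q₁.eval (M.node l.succ) = 1 := by
      have : M.node l.succ - M.node l.castSucc = M.hFrac l := rfl
      simp [hq₁, this, hhl.ne']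
    have v3 : q₂.eval (M.node m.castSucc) = 1 := by
      have : M.node m.succ - M.node m.castSucc = M.hFrac m := rfl
      simp [hq₂, this, hhm.ne']
    have v4 : q₂.eval (M.node m.succ) = 0 := by simp [hq₂]
    have hrV : ∀ i, (r i).eval (M.node i.castSucc) = V i.castSucc ∧
        (r i).eval (M.node i.succ) = V i.succ := by
      intro i
      by_cases hil : i = l
      · rw [hil, hrl, v1, v2]
        simp only [hV]
        rw [if_neg, if_pos]
        · exact ⟨rfl, rfl⟩
        · rfl
        · intro h'
          exact hne (Fin.castSucc_injective _ h')
      by_cases him : i = m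
      · rw [him, hrm, v3, v4]
        simp only [hV]
        rw [if_pos trivial, if_neg]
        · exact ⟨rfl, rfl⟩
        · exact (Fin.castSucc_lt_succ (i := m)).ne'
      rw [hri i ⟨hil, him⟩]
      simp only [hV, Polynomial.eval_zero]
      rw [if_neg, if_neg]
      · exact ⟨rfl, rfl⟩
      · intro h'
        have : i.succ = l.succ := h'
        exact hil (Fin.succ_injective _ this)
      · intro h'
        exact him (Fin.castSucc_injective _ h')
    have hrc : M.Conforming r := by
      obtain ⟨-, h0, h1, -⟩ := M.partition
      refine ⟨fun y => ?_, ?_, ?_⟩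
      · rw [(hrV y.succ).1]
        exact (hrV y.castSucc).2
      · have := (hrV 0).1
        rw [Fin.castSucc_zero, h0] at this
        rw [this]
        simp only [hV]
        rw [if_neg]
        intro h'
        have := congrArg Fin.val h'
        simp [hm] at this
      · have := (hrV (Fin.last _)).2
        rw [Fin.succ_last, h1] at this
        rw [this]
        simp only [hV]
        rw [if_neg]
        exact (Fin.castSucc_lt_last m).ne'
    have hsum := M.sum_fracResidual h hf hres uh wh hrc
    rw [Finset.sum_eq_add l m hne (fun i _ hi => by simp [hri i hi]) (by simp) (by simp),
      hrl, hrm, v1, v2, v3, v4] at hsum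
    simp only [mul_zero, mul_one, sub_zero, zero_sub] at hsum
    set J := M.KΓe c l * (wh l).derivative.eval Z - M.KΓe c m * (wh m).derivative.eval Z with hJ
    -- The contribution of one edge, multiplied by the vertex jump `J`. Each of the three terms
    -- costs `J ^ 2 / 12`, so the two edges together cost `J ^ 2 / 2`. The hat function is bounded
    -- by one and its slope is the inverse length, which produces the factor `(M.hFrac i)⁻¹`.
    have hloc : ∀ i : Fin (M.nΓ + 1), ∀ q : Polynomial ℝ,
        (∀ s ∈ Ioo (M.node i.castSucc) (M.node i.succ), q.eval s ^ 2 ≤ 1) →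
        (∀ s, q.derivative.eval s ^ 2 = ((M.hFrac i)⁻¹) ^ 2) →
        J * ((∫ s, M.fracResidual c fΓ uh wh i s * q.eval s ∂M.edge i)
          - (∫ s, M.KΓe c i * (pΓ.der s - (wh i).derivative.eval s) * q.derivative.eval s ∂M.edge i)
          + ∫ s, (fluxJump c p pΓ s - M.jumpN uh i s) * q.eval s ∂M.edge i) ≤
        J ^ 2 / 4 + 12 * (M.hFrac i)⁻¹ * (|b₀| + D.L ^ 2 + 1) * G i := by
      intro i q hq1 hq2
      have hh := M.hFrac_pos i
      set η := M.hFrac i with hη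
      have mR := M.memLp_fracResidual c hf uh wh i
      have mE := M.memLp_fluxJump_sub c p pΓ uh i
      have mD := (M.memLp_der_sub pΓ wh i).const_mul (M.KΓe c i)
      have mq := (M.memLp_edge_eval i q).const_mul J
      have mq' := (M.memLp_edge_eval i q.derivative).const_mul J
      have hvol : ∀ κ : ℝ, ∫ _s, κ ∂M.edge i = η * κ := fun κ => by
        rw [← M.intFrac_eq_integral, Mesh.intFrac, intervalIntegral.integral_const, smul_eq_mul]
        rfl
      have n1 : ∫ s, (J * q.eval s) ^ 2 ∂M.edge i ≤ η * J ^ 2 := by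
        rw [← hvol]
        refine integral_mono_ae mq.integrable_sq (integrable_const _) (M.ae_edge i fun s hs => ?_)
        simp only [mul_pow]
        exact mul_le_of_le_one_right (sq_nonneg _) (hq1 s hs)
      have n2 : ∫ s, (J * q.derivative.eval s) ^ 2 ∂M.edge i = η⁻¹ * J ^ 2 := by
        simp_rw [mul_pow, hq2]
        rw [hvol]
        field_simp
      have d1 : 0 < (12 * η)⁻¹ := by positivity
      have d2 : 0 < η / 12 := by positivity
      have y1 := abs_integral_mul_le mR mq d1
      have y2 := abs_integral_mul_le mE mq d1
      have y3 := abs_integral_mul_le mD mq' d2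
      have s1 : (12 * η)⁻¹ * ∫ s, (J * q.eval s) ^ 2 ∂M.edge i ≤ J ^ 2 / 12 := by
        calc _ ≤ (12 * η)⁻¹ * (η * J ^ 2) := by gcongr
          _ = _ := by field_simp
      have s2 : η / 12 * ∫ s, (J * q.derivative.eval s) ^ 2 ∂M.edge i = J ^ 2 / 12 := by
        rw [n2]; field_simp
      rw [s2] at y3
      have hKE := (M.integral_flux_sq_le hres ha₀ hab₀ pΓ wh i).trans
        (mul_le_mul_of_nonneg_right (le_abs_self b₀) (hEK0 i))
      have pull : ∀ g k : ℝ → ℝ, ∫ s, g s * (J * k s) ∂M.edge i = J * ∫ s, g s * k s ∂M.edge i :=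
        fun g k => by
          rw [← integral_const_mul]
          congr 1
          ext s
          ring
      rw [pull] at y1 y2 y3
      rw [inv_inv] at y1 y2
      rw [inv_div] at y3
      have t1 := le_abs_self (J * ∫ s, M.fracResidual c fΓ uh wh i s * q.eval s ∂M.edge i)
      have t2 := le_abs_self (J * ∫ s, (fluxJump c p pΓ s - M.jumpN uh i s) * q.eval s ∂M.edge i)
      have t3 := neg_abs_le (J * ∫ s, M.KΓe c i * (pΓ.der s - (wh i).derivative.eval s)
        * q.derivative.eval s ∂M.edge i)
      have y3' : 12 / η * (∫ s, (M.KΓe c i * (pΓ.der s - (wh i).derivative.eval s)) ^ 2 ∂M.edge i) ≤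
          12 / η * (|b₀| * EK i) := mul_le_mul_of_nonneg_left hKE (by positivity)
      have hη2 : η ^ 2 ≤ D.L ^ 2 := pow_le_pow_left₀ hh.le (M.hFrac_le i) 2
      have fin : 12 * η * R2 i + 12 * η * EJ i + 12 / η * (|b₀| * EK i) ≤
          12 * η⁻¹ * (|b₀| + D.L ^ 2 + 1) * G i := by
        have e : 12 * η * R2 i + 12 * η * EJ i + 12 / η * (|b₀| * EK i) =
            12 * η⁻¹ * (η ^ 2 * R2 i + η ^ 2 * EJ i + |b₀| * EK i) := by field_simp
        rw [e, mul_assoc (12 * η⁻¹)]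
        refine mul_le_mul_of_nonneg_left ?_ (by positivity)
        have k1 : η ^ 2 * EJ i ≤ D.L ^ 2 * EJ i := mul_le_mul_of_nonneg_right hη2 (hEJ0 i)
        have k2 : 0 ≤ η ^ 2 * R2 i := mul_nonneg (sq_nonneg _) (hR0 i)
        have k3 : 0 ≤ |b₀| * EJ i := mul_nonneg (abs_nonneg _) (hEJ0 i)
        have k4 : 0 ≤ |b₀| * (η ^ 2 * R2 i) := mul_nonneg (abs_nonneg _) k2
        have k5 : 0 ≤ D.L ^ 2 * (η ^ 2 * R2 i) := mul_nonneg (sq_nonneg _) k2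
        have k6 : 0 ≤ D.L ^ 2 * EK i := mul_nonneg (sq_nonneg _) (hEK0 i)
        have k7 := hEK0 i
        have k8 := hEJ0 i
        simp only [hG]
        linarith
      have y1' : |J * ∫ s, M.fracResidual c fΓ uh wh i s * q.eval s ∂M.edge i| ≤
          12 * η * R2 i + J ^ 2 / 12 := y1.trans (by linarith)
      have y2' : |J * ∫ s, (fluxJump c p pΓ s - M.jumpN uh i s) * q.eval s ∂M.edge i| ≤
          12 * η * EJ i + J ^ 2 / 12 := y2.trans (by linarith)
      rw [mul_add, mul_sub]
      linarith
    have hb1 := hloc l q₁ (fun s hs => by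
        have h1 : 0 ≤ (M.hFrac l)⁻¹ * (s - M.node l.castSucc) :=
          mul_nonneg (by positivity) (by linarith [hs.1])
        have h2 : (M.hFrac l)⁻¹ * (s - M.node l.castSucc) ≤ 1 := by
          rw [inv_mul_le_one₀ hhl, Mesh.hFrac]; linarith [hs.2]
        simp only [hq₁, Polynomial.eval_mul, Polynomial.eval_C, Polynomial.eval_sub,
          Polynomial.eval_X]
        exact pow_le_one₀ h1 h2) (fun s => by simp [hq₁])
    have hb2 := hloc m q₂ (fun s hs => by
        have h1 : 0 ≤ (M.hFrac m)⁻¹ * (M.node m.succ - s) :=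
          mul_nonneg (by positivity) (by linarith [hs.2])
        have h2 : (M.hFrac m)⁻¹ * (M.node m.succ - s) ≤ 1 := by
          rw [inv_mul_le_one₀ hhm, Mesh.hFrac]; linarith [hs.1]
        simp only [hq₂, Polynomial.eval_mul, Polynomial.eval_C, Polynomial.eval_sub,
          Polynomial.eval_X]
        exact pow_le_one₀ h1 h2) (fun s => by simp [hq₂])
    set X₁ := (∫ s, M.fracResidual c fΓ uh wh l s * q₁.eval s ∂M.edge l)
      - (∫ s, M.KΓe c l * (pΓ.der s - (wh l).derivative.eval s) * q₁.derivative.eval s ∂M.edge l)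
      + ∫ s, (fluxJump c p pΓ s - M.jumpN uh l s) * q₁.eval s ∂M.edge l
    set X₂ := (∫ s, M.fracResidual c fΓ uh wh m s * q₂.eval s ∂M.edge m)
      - (∫ s, M.KΓe c m * (pΓ.der s - (wh m).derivative.eval s) * q₂.derivative.eval s ∂M.edge m)
      + ∫ s, (fluxJump c p pΓ s - M.jumpN uh m s) * q₂.eval s ∂M.edge m
    have hJX : J = X₁ + X₂ := by
      rw [hZl, ← hZ] at hsum
      rw [hJ]
      linarith
    have hJ2 : J ^ 2 ≤ 24 * (|b₀| + D.L ^ 2 + 1)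
        * ((M.hFrac l)⁻¹ * G l + (M.hFrac m)⁻¹ * G m) := by
      have : J ^ 2 = J * X₁ + J * X₂ := by rw [← mul_add, ← hJX, sq]
      linarith
    -- The weight is the longer length, whereas each edge brings its own inverse length;
    -- comparability makes the quotients bounded.
    obtain ⟨k1, k2⟩ := hcomp M hS hE z
    have hB1 : B ≤ A := le_max_left _ _
    have h1A : 1 ≤ A := le_max_right _ _
    have m1 : max (M.hFrac l) (M.hFrac m) ≤ A * M.hFrac l := max_le
      (le_mul_of_one_le_left hhl.le h1A) (k2.trans (mul_le_mul_of_nonneg_right hB1 hhl.le))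
    have m2 : max (M.hFrac l) (M.hFrac m) ≤ A * M.hFrac m := max_le
      (k1.trans (mul_le_mul_of_nonneg_right hB1 hhm.le)) (le_mul_of_one_le_left hhm.le h1A)
    have hmul : max (M.hFrac l) (M.hFrac m) * J ^ 2 ≤
        24 * A * (|b₀| + D.L ^ 2 + 1) * (G l + G m) := by
      have n1 : max (M.hFrac l) (M.hFrac m) * ((M.hFrac l)⁻¹ * G l) ≤ A * G l := by
        rw [← mul_assoc]
        refine mul_le_mul_of_nonneg_right ?_ (hG0 l)
        rwa [← div_eq_mul_inv, div_le_iff₀ hhl]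
      have n2 : max (M.hFrac l) (M.hFrac m) * ((M.hFrac m)⁻¹ * G m) ≤ A * G m := by
        rw [← mul_assoc]
        refine mul_le_mul_of_nonneg_right ?_ (hG0 m)
        rwa [← div_eq_mul_inv, div_le_iff₀ hhm]
      have hmax : 0 ≤ max (M.hFrac l) (M.hFrac m) := hhl.le.trans (le_max_left _ _)
      calc _ ≤ max (M.hFrac l) (M.hFrac m) * (24 * (|b₀| + D.L ^ 2 + 1)
          * ((M.hFrac l)⁻¹ * G l + (M.hFrac m)⁻¹ * G m)) := mul_le_mul_of_nonneg_left hJ2 hmax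
        _ = 24 * (|b₀| + D.L ^ 2 + 1) * (max (M.hFrac l) (M.hFrac m) * ((M.hFrac l)⁻¹ * G l)
          + max (M.hFrac l) (M.hFrac m) * ((M.hFrac m)⁻¹ * G m)) := by ring
        _ ≤ 24 * (|b₀| + D.L ^ 2 + 1) * (A * G l + A * G m) := by gcongr
        _ = _ := by ring
    -- The denominator of the vertex residual stays away from zero, whatever the jump of the
    -- coefficient.
    have hmean : a₀ ≤ (M.KΓe c l + M.KΓe c m) / 2 := by
      linarith [(hres.KΓe_bdd hab₀ l).1, (hres.KΓe_bdd hab₀ m).1]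
    have hvr : M.vertexResidual c wh z = J ^ 2 / ((M.KΓe c l + M.KΓe c m) / 2) := rfl
    rw [hvr, ← mul_div_assoc, div_mul_eq_mul_div]
    refine div_le_div₀ ?_ hmul ha₀ hmean
    have := hG0 l
    have := hG0 m
    positivity
  refine (Finset.sum_le_sum fun z _ => hz z).trans ?_
  rw [← Finset.mul_sum, Finset.sum_add_distrib]
  have hs1 : ∑ z : Fin M.nΓ, G z.castSucc ≤ ∑ j, G j := by
    rw [Fin.sum_univ_castSucc]; linarith [hG0 (Fin.last _)]
  have hs2 : ∑ z : Fin M.nΓ, G z.succ ≤ ∑ j, G j := by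
    rw [Fin.sum_univ_succ G]; linarith [hG0 0]
  calc _ ≤ 24 * A * (|b₀| + D.L ^ 2 + 1) / a₀ * (∑ j, G j + ∑ j, G j) := by gcongr
    _ = _ := by ring

/-! ### The estimator -/

/-- For the two interface terms: `κ` is $\alpha_\Gamma$ or $\eta_\Gamma$, `y` an error of pressures
and `z` an error of normal fluxes. The error norm weights `y ^ 2` with `κ⁻¹` only, and the second
factor `κ⁻¹` is bounded. -/
theorem integral_inv_mul_sub_sq_le {α : Type*} [MeasurableSpace α] {μ : Measure α}
    {κ y z : α → ℝ} {a : ℝ} (ha : 0 < a) (hκ : ∀ᵐ s ∂μ, a ≤ κ s) (hm : Measurable κ)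
    (hy : MemLp y 2 μ) (hz : MemLp z 2 μ) :
    ∫ s, ((κ s)⁻¹ * y s - z s) ^ 2 ∂μ ≤
      2 * (a⁻¹ + 1) * ((∫ s, (κ s)⁻¹ * y s ^ 2 ∂μ) + ∫ s, z s ^ 2 ∂μ) := by
  have mκ : MemLp (fun s => (κ s)⁻¹ * y s) 2 μ :=
    MemLp_two.bdd_smul hy hm.inv.aestronglyMeasurable (ae_abs_inv_le ha hκ)
  have iy : Integrable (fun s => (κ s)⁻¹ * y s ^ 2) μ := by
    have := MemLp_two.integrable_mul mκ hy
    simpa only [mul_assoc, ← sq] using this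
  have hpos : 0 < a⁻¹ := inv_pos.2 ha
  rw [← integral_add iy hz.integrable_sq, ← integral_const_mul]
  refine integral_mono_ae (mκ.sub hz).integrable_sq ((iy.add hz.integrable_sq).const_mul _) ?_
  filter_upwards [hκ] with s hs
  have hκ0 : 0 < (κ s)⁻¹ := inv_pos.2 (ha.trans_le hs)
  have h1 : (κ s)⁻¹ ≤ a⁻¹ := inv_anti₀ ha hs
  have h2 : ((κ s)⁻¹ * y s) ^ 2 ≤ a⁻¹ * ((κ s)⁻¹ * y s ^ 2) := by
    calc _ = (κ s)⁻¹ * ((κ s)⁻¹ * y s ^ 2) := by ring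
      _ ≤ _ := mul_le_mul_of_nonneg_right h1 (by positivity)
  have h3 : 0 ≤ (κ s)⁻¹ * y s ^ 2 := by positivity
  have h4 : 0 ≤ a⁻¹ * z s ^ 2 := by positivity
  nlinarith [sq_nonneg ((κ s)⁻¹ * y s + z s)]

namespace Mesh

variable {D : FracturedDomain} (M : Mesh D)

theorem hFrac_mul_integral_le (j : Fin (M.nΓ + 1)) {κ y z : ℝ → ℝ} {a : ℝ} (ha : 0 < a)
    (hκ : ∀ᵐ s ∂D.frac, a ≤ κ s) (hm : Measurable κ) (hy : MemLp y 2 (M.edge j))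
    (hz : MemLp z 2 (M.edge j)) :
    M.hFrac j * ∫ s, ((κ s)⁻¹ * y s - z s) ^ 2 ∂M.edge j ≤
      2 * D.L * (a⁻¹ + 1) * ((∫ s, (κ s)⁻¹ * y s ^ 2 ∂M.edge j) + ∫ s, z s ^ 2 ∂M.edge j) := by
  calc _ ≤ D.L * (2 * (a⁻¹ + 1) *
        ((∫ s, (κ s)⁻¹ * y s ^ 2 ∂M.edge j) + ∫ s, z s ^ 2 ∂M.edge j)) :=
        mul_le_mul (M.hFrac_le j)
          (integral_inv_mul_sub_sq_le ha (M.ae_edge_of_ae j hκ) hm hy hz)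
          (integral_nonneg fun _ => sq_nonneg _) D.L_pos.le
    _ = _ := by ring

theorem setIntegral_error_le {c : Coefficients D} {a b : ℝ} (ha : 0 < a)
    (hab : ∀ᵐ x ∂D.bulk, a ≤ c.K x ∧ c.K x ≤ b) {u : Plane → Plane} (hu : MemLp u 2 D.bulk)
    (uh : M.PwVec) (τ : M.Tri) :
    ∫ x in tri τ, ‖u x - vval (uh τ) x‖ ^ 2 ≤
      |b| * ∫ x in tri τ, (c.K x)⁻¹ * ‖u x - vval (uh τ) x‖ ^ 2 := by
  have me := M.memLp_error hu uh τ
  have hK := M.ae_tri hab τ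
  have hKa : ∀ᵐ x ∂volume.restrict (tri τ), a ≤ c.K x := hK.mono fun _ h => h.1
  have mκ := MemLp_two.bdd_smul me c.K_meas.inv.aestronglyMeasurable (ae_abs_inv_le ha hKa)
  have ik : Integrable (fun x => (c.K x)⁻¹ * ‖u x - vval (uh τ) x‖ ^ 2)
      (volume.restrict (tri τ)) := by
    have := MemLp_two.integrable_inner mκ me
    simpa only [Pi.inv_apply, real_inner_smul_left, real_inner_self_eq_norm_sq] using this
  rw [← integral_const_mul]
  refine integral_mono_ae (MemLp_two.integrable_norm_sq me) (ik.const_mul _) ?_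
  filter_upwards [hK] with x hx
  have h0 : 0 < c.K x := ha.trans_le hx.1
  rw [← mul_assoc, ← div_eq_mul_inv]
  refine le_mul_of_one_le_left (sq_nonneg _) ?_
  rw [one_le_div h0]
  exact hx.2.trans (le_abs_self b)

end Mesh

/-- Passes from a bound for squares to the sum of the error norm and the oscillation. -/
theorem sqrt_le_mul_add {T κ X Y : ℝ} (hX : 0 ≤ X) (hY : 0 ≤ Y) (h : T ≤ κ * (X + Y)) :
    Real.sqrt T ≤ Real.sqrt κ * (Real.sqrt X + Real.sqrt Y) := by
  refine (Real.sqrt_le_sqrt h).trans ?_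
  rw [Real.sqrt_mul' _ (add_nonneg hX hY)]
  refine mul_le_mul_of_nonneg_left ?_ (Real.sqrt_nonneg _)
  rw [Real.sqrt_le_left (by positivity), add_sq, Real.sq_sqrt hX, Real.sq_sqrt hY]
  have : 0 ≤ 2 * Real.sqrt X * Real.sqrt Y := by positivity
  linarith

/-- The squared form of each of the eight terms is bounded by a constant times a few components of
the squared error and oscillation. The chain is ordered by dependence: the pressure jumps use the
Darcy residual, the normal jumps use the bulk residual, and the vertex residual uses the residual on
the fracture edges. -/
theorem exists_estimator_le (D : FracturedDomain) (c : Coefficients D) (k m : ℕ) {ρS ρE : ℝ}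
    (hρS : 0 < ρS) (hρE : 0 < ρE) :
    ∃ C : ℝ, 0 < C ∧ ∀ M : Mesh D, M.Resolves c → M.StarShaped ρS → M.EdgesComparable ρE →
      ∀ (f : Plane → ℝ) (fΓ : ℝ → ℝ), MemLp f 2 D.bulk → MemLp fΓ 2 D.frac →
      ∀ (u : Plane → Plane) (p : BulkH1 D) (pΓ : FracH10 D), IsWeakSolution c f fΓ u p pΓ →
      ∀ (uh : M.PwVec) (ph : M.PwPoly) (wh : M.PwFrac),
        M.IsDiscreteSolution c k f fΓ uh ph wh →
      ∀ (fh : M.PwPoly) (fΓh : M.PwFrac),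
        (∀ τ, (fh τ).totalDegree ≤ m) → (∀ j, (fΓh j).natDegree ≤ m) →
        M.estimator c f fΓ uh ph wh ≤
          C * (M.sdgError c u (normalFlux c p pΓ) p pΓ uh ph wh + M.osc c f fΓ fh fΓh) := by
  obtain ⟨aK, bK, haK, hK⟩ := c.K_bdd
  obtain ⟨aα, haα, hα⟩ := c.αΓ_bdd
  obtain ⟨aη, haη, hη⟩ := c.ηΓ_bdd
  obtain ⟨aΓ, bΓ, haΓ, hΓ⟩ := c.KΓ_bdd
  -- The polynomial residuals mix discrete functions of degree `k` with data approximations of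
  -- degree `m`.
  set N := max k m with hN
  set ρ := ρS * ρE with hρd
  have hρ : 0 < ρ := mul_pos hρS hρE
  obtain ⟨C₂, hC₂, h₂⟩ := exists_bulkResidual_le D N hρ
  obtain ⟨C₄, hC₄, h₄⟩ := exists_jumpE_le D N hρ
  obtain ⟨C₅, hC₅, h₅⟩ := exists_fracResidual_le c N
  obtain ⟨C₆, hC₆, h₆⟩ := exists_vertexResidual_le c hρS hρE
  have hL := D.L_pos
  set κ₂ := C₂ * (|bK| + 1) with hκ₂
  set κ₃ := 16 * (aK⁻¹ * ρ⁻¹) * 2 with hκ₃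
  set κ₄ := C₄ * (|bK| + κ₂) with hκ₄
  set κ₆ := C₆ * (1 + C₅) with hκ₆
  set κ₇ := 2 * D.L * (aα⁻¹ + 1) with hκ₇
  set κ₈ := 2 * D.L * (aη⁻¹ + 1) with hκ₈
  have hκ₂0 : 0 < κ₂ := by positivity
  refine ⟨Real.sqrt 2 + Real.sqrt κ₂ + Real.sqrt κ₃ + Real.sqrt κ₄ + Real.sqrt C₅ + Real.sqrt κ₆
    + Real.sqrt κ₇ + Real.sqrt κ₈, by positivity, ?_⟩
  intro M hres hS hE f fΓ hf hfΓ u p pΓ h uh ph wh hd fh fΓh hfh hfΓh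
  have hreg : ∀ τ, ρ * M.hTri τ ^ 2 ≤ M.area τ := fun τ => by
    refine le_trans ?_ (hS.le_area hE hρS τ)
    exact mul_le_mul_of_nonneg_left
      (pow_le_pow_left₀ (Mesh.hTri_pos τ).le (M.hTri_le_diam τ) 2) hρ.le
  have huN : ∀ τ i, (uh τ i).totalDegree ≤ N := fun τ i => (hd.uh_mem.1 τ i).trans (le_max_left _ _)
  have hwN : ∀ j, (wh j).natDegree ≤ N := fun j => (hd.wh_mem.1 j).trans (le_max_left _ _)
  have hfN : ∀ τ, (fh τ).totalDegree ≤ N := fun τ => (hfh τ).trans (le_max_right _ _)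
  have hfΓN : ∀ j, (fΓh j).natDegree ≤ N := fun j => (hfΓh j).trans (le_max_right _ _)
  have hK0 : ∀ τ : M.Tri, ∀ᵐ x ∂volume.restrict (tri τ), 0 ≤ c.K x := fun τ =>
    (M.ae_tri hK τ).mono fun x hx => haK.le.trans hx.1
  unfold Mesh.estimator Mesh.sdgError Mesh.osc
  simp only [normalFlux_sub, normalFlux_add, M.intFrac_eq_integral]
  set e₁ := ∑ τ : M.Tri, ∫ x in tri τ, (c.K x)⁻¹ * ‖u x - vval (uh τ) x‖ ^ 2 with he₁
  set e₂ := ∑ j, ∫ s, (c.αΓ s)⁻¹ *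
    ((p.avg s - M.avgΓ ph j s) - (pΓ.val s - (wh j).eval s)) ^ 2 ∂M.edge j with he₂
  set e₃ := ∑ j, ∫ s, (c.ηΓ s)⁻¹ * (p.jump s - M.jumpΓ ph j s) ^ 2 ∂M.edge j with he₃
  set e₄ := ∑ τ : M.Tri, ∫ x in tri τ, c.K x * ‖p.grad x - pgrad (ph τ) x‖ ^ 2 with he₄
  set e₅ := ∑ j, ∫ s, c.KΓ s * (pΓ.der s - (wh j).derivative.eval s) ^ 2 ∂M.edge j with he₅
  set e₆ := ∑ j, ∫ s, (fluxJump c p pΓ s - M.jumpN uh j s) ^ 2 ∂M.edge j with he₆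
  set e₇ := ∑ j, ∫ s, (fluxAvg c p s - M.avgN uh j s) ^ 2 ∂M.edge j with he₇
  set o₁ := ∑ j, M.hFrac j ^ 2 * ∫ s, (c.ℓ s * ((fΓh j).eval s - fΓ s)) ^ 2 ∂M.edge j with ho₁
  set o₂ := ∑ τ : M.Tri, M.hTri τ ^ 2 * ∫ x in tri τ, (f x - pval (fh τ) x) ^ 2 with ho₂
  have p₁ : 0 ≤ e₁ := Finset.sum_nonneg fun τ _ => integral_nonneg_of_ae <|
    (hK0 τ).mono fun x hx => mul_nonneg (inv_nonneg.2 hx) (sq_nonneg _)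
  have p₂ : 0 ≤ e₂ := Finset.sum_nonneg fun j _ => integral_nonneg_of_ae <|
    (M.ae_edge_of_ae j hα).mono fun x hx =>
      mul_nonneg (inv_nonneg.2 (haα.le.trans hx)) (sq_nonneg _)
  have p₃ : 0 ≤ e₃ := Finset.sum_nonneg fun j _ => integral_nonneg_of_ae <|
    (M.ae_edge_of_ae j hη).mono fun x hx =>
      mul_nonneg (inv_nonneg.2 (haη.le.trans hx)) (sq_nonneg _)
  have p₄ : 0 ≤ e₄ := Finset.sum_nonneg fun τ _ => integral_nonneg_of_ae <|
    (hK0 τ).mono fun x hx => mul_nonneg hx (sq_nonneg _)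
  have p₅ : 0 ≤ e₅ := Finset.sum_nonneg fun j _ => integral_nonneg_of_ae <|
    (M.ae_edge_of_ae j hΓ).mono fun x hx => mul_nonneg (haΓ.le.trans hx.1) (sq_nonneg _)
  have p₆ : 0 ≤ e₆ := Finset.sum_nonneg fun j _ => integral_nonneg fun s => sq_nonneg _
  have p₇ : 0 ≤ e₇ := Finset.sum_nonneg fun j _ => integral_nonneg fun s => sq_nonneg _
  have q₁ : 0 ≤ o₁ := Finset.sum_nonneg fun j _ =>
    mul_nonneg (sq_nonneg _) (integral_nonneg fun s => sq_nonneg _)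
  have q₂ : 0 ≤ o₂ := Finset.sum_nonneg fun τ _ =>
    mul_nonneg (sq_nonneg _) (integral_nonneg fun s => sq_nonneg _)
  set X := e₁ + e₂ + e₃ + e₄ + e₅ + e₆ + e₇ with hX
  set Y := o₁ + o₂ with hY
  have hX0 : 0 ≤ X := by positivity
  have hY0 : 0 ≤ Y := by positivity
  have err : ∑ τ : M.Tri, ∫ x in tri τ, ‖u x - vval (uh τ) x‖ ^ 2 ≤ |bK| * e₁ := by
    rw [he₁, Finset.mul_sum]
    exact Finset.sum_le_sum fun τ _ => M.setIntegral_error_le haK hK h.u_mem uh τ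
  have t₁ : ∑ τ : M.Tri, ∫ x in tri τ,
      ‖(Real.sqrt (c.K x))⁻¹ • vval (uh τ) x + Real.sqrt (c.K x) • pgrad (ph τ) x‖ ^ 2 ≤
      2 * (e₁ + e₄) := by
    rw [mul_add, he₁, he₄, Finset.mul_sum, Finset.mul_sum, ← Finset.sum_add_distrib]
    exact Finset.sum_le_sum fun τ _ => M.setIntegral_darcy_le h uh ph τ
  have t₂ : ∑ τ : M.Tri, M.hTri τ ^ 2 * ∫ x in tri τ, (f x - vdiv (uh τ) x) ^ 2 ≤
      κ₂ * (e₁ + o₂) := by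
    refine (Finset.sum_le_sum fun τ _ => h₂ M c f fΓ u p pΓ h hf uh fh τ (huN τ) (hfN τ)
      (hreg τ)).trans ?_
    rw [← Finset.mul_sum, Finset.sum_add_distrib, hκ₂, mul_assoc]
    refine mul_le_mul_of_nonneg_left ((add_le_add err le_rfl).trans ?_) hC₂.le
    have : 0 ≤ |bK| * o₂ := by positivity
    change |bK| * e₁ + o₂ ≤ _
    linarith
  have t₃ := (M.sum_jumpP_le haK hK hρ hreg hd).trans
    (mul_le_mul_of_nonneg_left t₁ (by positivity : 0 ≤ 16 * (aK⁻¹ * ρ⁻¹)))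
  have t₄ : ∑ e ∈ M.intEdges, outerLen e.1 *
      edgeInt (src e.1) (tgt e.1) (fun x => M.jumpE uh e x ^ 2) ≤ κ₄ * (e₁ + o₂) := by
    -- The local bounds involve the two triangles at an edge. A triangle has only one outer edge, so
    -- summing over edges counts every triangle at most once.
    refine (Finset.sum_le_sum fun e he => h₄ M c f fΓ u p pΓ h hf uh huN hreg e he).trans ?_
    rw [← Finset.mul_sum]
    refine (mul_le_mul_of_nonneg_left (M.sum_intEdges_le (Φ := fun τ =>
      (∫ x in tri τ, ‖u x - vval (uh τ) x‖ ^ 2)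
        + M.hTri τ ^ 2 * ∫ x in tri τ, (f x - vdiv (uh τ) x) ^ 2) fun τ => ?_) hC₄.le).trans ?_
    · exact add_nonneg (integral_nonneg fun x => sq_nonneg _)
        (mul_nonneg (sq_nonneg _) (integral_nonneg fun x => sq_nonneg _))
    · rw [Finset.sum_add_distrib, hκ₄, mul_assoc]
      refine mul_le_mul_of_nonneg_left ((add_le_add err t₂).trans ?_) hC₄.le
      have : 0 ≤ |bK| * o₂ := by positivity
      linarith
  have t₅ : ∑ j, M.hFrac j ^ 2 * ∫ s, M.fracResidual c fΓ uh wh j s ^ 2 ∂M.edge j ≤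
      C₅ * (e₅ + e₆ + o₁) := by
    refine (Finset.sum_le_sum fun j _ => h₅ M hres f fΓ u p pΓ h hfΓ uh wh fΓh huN hwN hfΓN j).trans
      (le_of_eq ?_)
    rw [← Finset.mul_sum, Finset.sum_add_distrib, Finset.sum_add_distrib]
  have t₆ : ∑ z : Fin M.nΓ, max (M.hFrac z.castSucc) (M.hFrac z.succ) * M.vertexResidual c wh z ≤
      κ₆ * (e₅ + e₆ + o₁) := by
    refine (h₆ M hres hS hE f fΓ u p pΓ h hfΓ uh wh).trans ?_
    rw [Finset.sum_add_distrib, Finset.sum_add_distrib, hκ₆, mul_assoc]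
    refine mul_le_mul_of_nonneg_left ((add_le_add le_rfl t₅).trans ?_) hC₆.le
    change e₅ + e₆ + _ ≤ _
    linarith
  -- The exact solution satisfies the interface law by the definition of `fluxJump`. Up to sign, the
  -- discrete defect is therefore the weighted pressure error minus the flux error.
  have t₇ : ∑ j, M.hFrac j * ∫ s,
      ((c.αΓ s)⁻¹ * (M.avgΓ ph j s - (wh j).eval s) - M.jumpN uh j s) ^ 2 ∂M.edge j ≤
      κ₇ * (e₂ + e₆) := by
    rw [he₂, he₆, ← Finset.sum_add_distrib, Finset.mul_sum]
    refine Finset.sum_le_sum fun j _ => ?_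
    refine le_trans (le_of_eq ?_) (M.hFrac_mul_integral_le j haα hα c.measurable_αΓ
      (((M.memLp_edge p.memLp_avg j).sub (M.memLp_avgΓ ph j)).sub
        ((M.memLp_edge pΓ.memLp j).sub (M.memLp_edge_eval j (wh j))))
      (M.memLp_fluxJump_sub c p pΓ uh j))
    congr 2
    ext s
    simp only [fluxJump]
    ring
  have t₈ : ∑ j, M.hFrac j * ∫ s,
      (M.avgN uh j s - (c.ηΓ s)⁻¹ * M.jumpΓ ph j s) ^ 2 ∂M.edge j ≤ κ₈ * (e₃ + e₇) := by
    rw [he₃, he₇, ← Finset.sum_add_distrib, Finset.mul_sum]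
    refine Finset.sum_le_sum fun j _ => ?_
    refine le_trans (le_of_eq ?_) (M.hFrac_mul_integral_le j haη hη c.measurable_ηΓ
      ((M.memLp_edge p.memLp_jump j).sub (M.memLp_jumpΓ ph j))
      ((M.memLp_edge (memLp_fluxAvg c p) j).sub (M.memLp_avgN uh j)))
    congr 2
    ext s
    simp only [fluxAvg]
    ring
  have up : ∀ {T κ Z : ℝ}, T ≤ κ * Z → 0 ≤ κ → Z ≤ X + Y →
      Real.sqrt T ≤ Real.sqrt κ * (Real.sqrt X + Real.sqrt Y) := fun hT hκ hZ =>
    sqrt_le_mul_add hX0 hY0 (hT.trans (mul_le_mul_of_nonneg_left hZ hκ))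
  have s₁ := up t₁ zero_le_two (by linarith)
  have s₂ := up t₂ hκ₂0.le (by linarith)
  have s₃ := up (t₃.trans (le_of_eq (mul_assoc _ _ _).symm)) (by positivity) (by linarith)
  have s₄ := up t₄ (by positivity) (by linarith)
  have s₅ := up t₅ hC₅.le (by linarith)
  have s₆ := up t₆ (by positivity) (by linarith)
  have s₇ := up t₇ (by positivity) (by linarith)
  have s₈ := up t₈ (by positivity) (by linarith)
  simp only [add_mul]
  exact add_le_add (add_le_add (add_le_add (add_le_add (add_le_add (add_le_add (add_le_add
    s₁ s₂) s₃) s₄) s₅) s₆) s₇) s₈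

end FractureSDG

end

theorem mainTheorem2 (D : FractureSDG.FracturedDomain) (c : FractureSDG.Coefficients D)
    (k m : ℕ) (ρS ρE : ℝ) (hρS : 0 < ρS) (hρE : 0 < ρE) :
    ∃ C : ℝ, 0 < C ∧
      ∀ M : FractureSDG.Mesh D, M.Resolves c → M.StarShaped ρS → M.EdgesComparable ρE →
      ∀ (f : FractureSDG.Plane → ℝ) (fΓ : ℝ → ℝ),
        MeasureTheory.MemLp f 2 D.bulk → MeasureTheory.MemLp fΓ 2 D.frac →
      ∀ (u : FractureSDG.Plane → FractureSDG.Plane) (p : FractureSDG.BulkH1 D)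
        (pΓ : FractureSDG.FracH10 D), FractureSDG.IsWeakSolution c f fΓ u p pΓ →
      ∃ g : Fin 2 → ℝ → ℝ, FractureSDG.HasNormalTraces D u g ∧
        ∀ (uh : M.PwVec) (ph : M.PwPoly) (wh : M.PwFrac),
          M.IsDiscreteSolution c k f fΓ uh ph wh →
        ∀ (fh : M.PwPoly) (fΓh : M.PwFrac),
          (∀ τ, (fh τ).totalDegree ≤ m) → (∀ j, (fΓh j).natDegree ≤ m) →
          M.estimator c f fΓ uh ph wh
            ≤ C * (M.sdgError c u g p pΓ uh ph wh + M.osc c f fΓ fh fΓh) := by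
  obtain ⟨C, hC, h⟩ := FractureSDG.exists_estimator_le D c k m hρS hρE
  -- The witness for the traces depends on the exact solution alone, not on the mesh or the discrete
  -- solution.
  refine ⟨C, hC, fun M hres hS hE f fΓ hf hfΓ u p pΓ hw =>
    ⟨FractureSDG.normalFlux c p pΓ, hw.hasNormalTraces hf, fun uh ph wh hd fh fΓh hfh hfΓh => ?_⟩⟩
  exact h M hres hS hE f fΓ hf hfΓ u p pΓ hw uh ph wh hd fh fΓh hfh hfΓh
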